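/- Let $\Omega=(A,\le)$ be a linear order ($\le$ reflexive, transitive and total; antisymmetry is not needed). Let $(\varepsilon_\Omega,\preceq)$ be the following notation system. Its terms are the constants $0$, $\omega$ and $\varepsilon_\alpha$ for $\alpha\in A$, and the terms $\langle t_0,\dots,t_{k-1}\rangle$ with $k\ge 1$, where $t_0\succ t_1\succ\dots\succ t_{k-1}$ are terms and, if $k=1$, $t_0$ is neither $\omega$ nor any $\varepsilon_\alpha$. The order is given by $0\prec\omega\prec\varepsilon_\alpha$; $\varepsilon_\alpha\preceq\varepsilon_\beta$ iff $\alpha\le\beta$; terms $\langle\dots\rangle$ are compared with each other lexicographically (a proper initial segment being smaller); and for a constant $c$ and a term $t=\langle t_0,\dots,t_{k-1}\rangle$, $c\prec t$ if $c\preceq t_0$, and $t\prec c$ if $t_0\prec c$. For a non-empty quasi-order $Q$, let $\mathsf{T_f}(Q)$ be the set of finite leaf-labelled trees over $Q$: the leaves $\cdot q$ for $q\in Q$, and the trees $\cdot(\tau_0,\dots,\tau_{k-1})$ for finite non-empty collections of trees $\tau_i\in\mathsf{T_f}(Q)$. It is quasi-ordered by: $\cdot x\le_T\cdot y$ iff $x\le_Q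 y$; $\cdot x\le_T\cdot(\tau_j)_{j<l}$ iff $\cdot x\le_T\tau_j$ for some $j<l$; $\cdot(\sigma_i)_{i<k}\le_T\cdot(\tau_j)_{j<l}$ iff for every $i<k$ there is $j<l$ with $\sigma_i\le_T\tau_j$; and never $\cdot(\sigma_i)_{i<k}\le_T\cdot y$. Let $2\cup\Omega$ be $\Omega$ with two new elements $0<1$ placed below all elements of $\Omega$. **Theorem.** $\mathsf{RCA_0}$ proves: for every linear order $\Omega$ (on a set of natural numbers), the systems $\varepsilon_\Omega$ and $\mathsf{T_f}(2\cup\Omega)$ exist (with terms and trees coded by natural numbers), and there is an order-reflecting map $h\colon\varepsilon_\Omega\to\mathsf{T_f}(2\cup\Omega)$, that is, a map such that $h(s)\le_T h(t)$ implies $s\preceq t$ for all $s,t\in\varepsilon_\Omega$. Equivalently, this statement holds in every model of $\mathsf{RCA_0}$, including those with non-standard numbers. -/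

import Mathlib

namespace RevMath

universe u

/-! ### The language of second-order arithmetic and the theory `RCA₀` -/

/-- A structure for the language of second-order arithmetic: a number domain `M` with
`0, 1, +, ·, <`, and a non-empty collection of subsets of `M` over which the set variables range.
Neither part needs to be standard. -/
class L2Structure (M : Type u) extends Zero M, One M, Add M, Mul M, LT M where
  /-- the range of the set variables -/
  sets : Set (Set M)
  sets_nonempty : sets.Nonempty

/-- The range of the set variables of `M`. -/
abbrev sets (M : Type u) [L2Structure M] : Set (Set M) := L2Structure.sets

/-- Numerical terms; number variables are de Bruijn indices. -/
inductive NumTerm : Type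
  | var : ℕ → NumTerm
  | zero : NumTerm
  | one : NumTerm
  | add : NumTerm → NumTerm → NumTerm
  | mul : NumTerm → NumTerm → NumTerm

/-- Bounded-quantifier (`Δ⁰₀`) formulas, with free number variables and free set variables.
In `bex t φ`, read `∃ x < t, φ`, variable `0` of `φ` is bound and the variables of `t` are not
shifted, so that `t` cannot mention `x`. -/
inductive BddFormula : Type
  | eq : NumTerm → NumTerm → BddFormula
  | lt : NumTerm → NumTerm → BddFormula
  | mem : NumTerm → ℕ → BddFormula
  | neg : BddFormula → BddFormula
  | and : BddFormula → BddFormula → BddFormula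
  | bex : NumTerm → BddFormula → BddFormula

section Semantics

variable {M : Type u} [L2Structure M]

/-- Prepend a value to an assignment of the number variables. -/
def push (a : M) (e : ℕ → M) : ℕ → M
  | 0 => a
  | n + 1 => e n

/-- Value of a term under an assignment. -/
def NumTerm.eval (e : ℕ → M) : NumTerm → M
  | .var i => e i
  | .zero => 0
  | .one => 1
  | .add s t => s.eval e + t.eval e
  | .mul s t => s.eval e * t.eval e

/-- Satisfaction of a bounded formula, under an assignment `X` of the set variables and an
assignment of the number variables. -/
def BddFormula.Sat (X : ℕ → Set M) : BddFormula → (ℕ → M) → Prop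
  | .eq s t, e => s.eval e = t.eval e
  | .lt s t, e => s.eval e < t.eval e
  | .mem t i, e => t.eval e ∈ X i
  | .neg φ, e => ¬ φ.Sat X e
  | .and φ ψ, e => φ.Sat X e ∧ ψ.Sat X e
  | .bex t φ, e => ∃ x : M, x < t.eval e ∧ φ.Sat X (push x e)

end Semantics

/-- `M` is a model of `RCA₀`: the basic axioms, induction for `Σ⁰₁` formulas `∃ x, φ(x, n)`, and
comprehension for `Δ⁰₁` formulas, both with arbitrary number and set parameters from `M`. -/
structure ModelsRCA0 (M : Type u) [L2Structure M] : Prop where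
  succ_ne_zero : ∀ n : M, n + 1 ≠ 0
  succ_inj : ∀ m n : M, m + 1 = n + 1 → m = n
  add_zero : ∀ m : M, m + 0 = m
  add_succ : ∀ m n : M, m + (n + 1) = (m + n) + 1
  mul_zero : ∀ m : M, m * 0 = 0
  mul_succ : ∀ m n : M, m * (n + 1) = m * n + m
  not_lt_zero : ∀ m : M, ¬ m < 0
  lt_succ_iff : ∀ m n : M, m < n + 1 ↔ m < n ∨ m = n
  sigma1_induction : ∀ (φ : BddFormula) (e : ℕ → M) (X : ℕ → Set M), (∀ i, X i ∈ sets M) →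
    (∃ x, φ.Sat X (push x (push 0 e))) →
    (∀ n, (∃ x, φ.Sat X (push x (push n e))) → ∃ x, φ.Sat X (push x (push (n + 1) e))) →
    ∀ n, ∃ x, φ.Sat X (push x (push n e))
  delta1_comprehension : ∀ (φ ψ : BddFormula) (e : ℕ → M) (X : ℕ → Set M), (∀ i, X i ∈ sets M) →
    (∀ n, (∃ x, φ.Sat X (push x (push n e))) ↔ ∀ x, ψ.Sat X (push x (push n e))) →
    ∃ Y ∈ sets M, ∀ n, n ∈ Y ↔ ∃ x, φ.Sat X (push x (push n e))

/-! ### Orders, finite lists and maps inside a structure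

From here on every quantifier ranges over the numbers or the sets of `M`, so that each notion is
the interpretation in `M` of a formula of second-order arithmetic. -/

section Coding

variable {M : Type u} [L2Structure M]

/-- Polynomial pairing. In a model of `RCA₀` it is injective, its value is never `0`, and its value
exceeds both arguments. Finite lists are coded by `nil = 0` and `cons t ℓ = pair t ℓ`. -/
def pair (a b : M) : M := (a + b) * (a + b) + a + 1

/-- The binary relation coded by a set of pairs. -/
def Rel (R : Set M) (a b : M) : Prop := pair a b ∈ R

/-- The strict part of the relation coded by a set of pairs. -/
def SRel (R : Set M) (a b : M) : Prop := Rel R a b ∧ ¬ Rel R b a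

/-- `A` is linearly quasi-ordered by the relation coded by `LA`; antisymmetry is not required. -/
structure IsLinearOrder (A LA : Set M) : Prop where
  refl : ∀ a ∈ A, Rel LA a a
  trans : ∀ a ∈ A, ∀ b ∈ A, ∀ c ∈ A, Rel LA a b → Rel LA b c → Rel LA a c
  total : ∀ a ∈ A, ∀ b ∈ A, Rel LA a b ∨ Rel LA b a

/-- `h` is the graph of a map from `P` to `Q` that reflects the relation coded by `LQ` to the
relation coded by `LP`. -/
structure IsOrderReflecting (P LP Q LQ h : Set M) : Prop where
  graph : ∀ n ∈ h, ∃ p ∈ P, ∃ q ∈ Q, n = pair p q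
  total : ∀ p ∈ P, ∃! q, Rel h p q
  reflects : ∀ p p' q q', Rel h p q → Rel h p' q' → Rel LQ q q' → Rel LP p p'

/-! ### The notation system `ε_Ω` -/

/-- The constant `0`. -/
def zeroC : M := pair 0 0

/-- The constant `ω`. -/
def omegaC : M := pair 0 1

/-- The constant `ε_α`. -/
def epsC (α : M) : M := pair 1 α

/-- The term `⟨t₀, …, tₖ₋₁⟩`, where `ℓ` codes the list of the `tᵢ`. -/
def seqC (ℓ : M) : M := pair (1 + 1) ℓ

/-- `c` is one of the constants `0`, `ω`, `ε_α` with `α ∈ A`. -/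
def IsConst (A : Set M) (c : M) : Prop := c = zeroC ∨ c = omegaC ∨ ∃ α ∈ A, c = epsC α

/-- The notation system `ε_Ω` for `Ω = (A, LA)`, as sets of `M`: its terms with their order, and
simultaneously the strictly descending lists of terms with their lexicographic order. The clauses
are recursive along the codes, so that they determine the terms, the lists and both orders. -/
structure EpsilonNotation (A LA : Set M) where
  /-- the terms -/
  terms : Set M
  /-- the order `⪯` of the terms -/
  le : Set M
  /-- the finite lists `t₀ ≻ t₁ ≻ ⋯` of terms -/
  lists : Set M
  /-- the lexicographic order of these lists -/
  lex : Set M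
  terms_mem : terms ∈ sets M
  le_mem : le ∈ sets M
  lists_mem : lists ∈ sets M
  lex_mem : lex ∈ sets M
  mem_terms_iff : ∀ n, n ∈ terms ↔ IsConst A n ∨ ∃ t ℓ, n = seqC (pair t ℓ) ∧
    pair t ℓ ∈ lists ∧ (ℓ = 0 → t ≠ omegaC ∧ ∀ α ∈ A, t ≠ epsC α)
  mem_lists_iff : ∀ n, n ∈ lists ↔ n = 0 ∨ ∃ t ℓ, n = pair t ℓ ∧ t ∈ terms ∧ ℓ ∈ lists ∧
    ∀ t' ℓ', ℓ = pair t' ℓ' → SRel le t' t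
  zero_lt_omega : SRel le zeroC omegaC
  zero_lt_eps : ∀ α ∈ A, SRel le zeroC (epsC α)
  omega_lt_eps : ∀ α ∈ A, SRel le omegaC (epsC α)
  zero_le_zero : Rel le zeroC zeroC
  omega_le_omega : Rel le omegaC omegaC
  eps_le_eps : ∀ α ∈ A, ∀ β ∈ A, (Rel le (epsC α) (epsC β) ↔ Rel LA α β)
  const_le_seq : ∀ c t ℓ, IsConst A c → seqC (pair t ℓ) ∈ terms →
    (Rel le c (seqC (pair t ℓ)) ↔ Rel le c t)
  seq_le_const : ∀ c t ℓ, IsConst A c → seqC (pair t ℓ) ∈ terms →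
    (Rel le (seqC (pair t ℓ)) c ↔ SRel le t c)
  seq_le_seq : ∀ k ℓ, seqC k ∈ terms → seqC ℓ ∈ terms →
    (Rel le (seqC k) (seqC ℓ) ↔ Rel lex k ℓ)
  nil_lex : ∀ ℓ ∈ lists, Rel lex 0 ℓ
  cons_lex_nil : ∀ t ℓ, pair t ℓ ∈ lists → ¬ Rel lex (pair t ℓ) 0
  cons_lex_cons : ∀ s k t ℓ, pair s k ∈ lists → pair t ℓ ∈ lists →
    (Rel lex (pair s k) (pair t ℓ) ↔ SRel le s t ∨ (Rel le s t ∧ Rel le t s ∧ Rel lex k ℓ))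

/-! ### Finite leaf-labelled trees -/

/-- The tree with a single vertex, labelled by `q`. -/
def leafC (q : M) : M := pair 0 q

/-- The tree whose root has the children listed by `ℓ`. -/
def nodeC (ℓ : M) : M := pair 1 ℓ

/-- The quasi-order `T_f(Q)` of finite leaf-labelled trees over the quasi-order `Q` with elements
`inQ` and order `leQ`, as sets of `M`. The finite set of children of an inner vertex is given by a
non-empty list; order and repetition of its entries do not matter for `≤_T`. The clauses
are recursive along the codes, so that they determine the trees, the lists of trees and the order
of the trees. -/
structure LeafTrees (inQ : M → Prop) (leQ : M → M → Prop) where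
  /-- the trees -/
  trees : Set M
  /-- the order `≤_T` of the trees -/
  le : Set M
  /-- the finite lists of trees -/
  lists : Set M
  /-- the relation "is an entry of the list" -/
  entry : Set M
  trees_mem : trees ∈ sets M
  le_mem : le ∈ sets M
  lists_mem : lists ∈ sets M
  entry_mem : entry ∈ sets M
  mem_trees_iff : ∀ n, n ∈ trees ↔
    (∃ q, inQ q ∧ n = leafC q) ∨ ∃ ℓ ∈ lists, ℓ ≠ 0 ∧ n = nodeC ℓ
  mem_lists_iff : ∀ n, n ∈ lists ↔ n = 0 ∨ ∃ τ ℓ, n = pair τ ℓ ∧ τ ∈ trees ∧ ℓ ∈ lists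
  not_entry_nil : ∀ σ, ¬ Rel entry σ 0
  entry_cons : ∀ σ τ ℓ, pair τ ℓ ∈ lists → (Rel entry σ (pair τ ℓ) ↔ σ = τ ∨ Rel entry σ ℓ)
  leaf_le_leaf : ∀ x y, inQ x → inQ y → (Rel le (leafC x) (leafC y) ↔ leQ x y)
  leaf_le_node : ∀ x ℓ, inQ x → nodeC ℓ ∈ trees →
    (Rel le (leafC x) (nodeC ℓ) ↔ ∃ τ, Rel entry τ ℓ ∧ Rel le (leafC x) τ)
  not_node_le_leaf : ∀ k y, nodeC k ∈ trees → inQ y → ¬ Rel le (nodeC k) (leafC y)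
  node_le_node : ∀ k ℓ, nodeC k ∈ trees → nodeC ℓ ∈ trees →
    (Rel le (nodeC k) (nodeC ℓ) ↔ ∀ σ, Rel entry σ k → ∃ τ, Rel entry τ ℓ ∧ Rel le σ τ)

/-! ### The labels `2 ∪ Ω` -/

/-- The label `0` of `2 ∪ Ω`. -/
def label0 : M := pair 0 0

/-- The label `1` of `2 ∪ Ω`. -/
def label1 : M := pair 0 1

/-- The label of `2 ∪ Ω` given by an element of `Ω`. -/
def labelOf (α : M) : M := pair 1 α

/-- The elements of `2 ∪ Ω`, for `Ω` with elements `A`. -/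
def InTwoUnion (A : Set M) (x : M) : Prop := x = label0 ∨ x = label1 ∨ ∃ α ∈ A, x = labelOf α

/-- The order of `2 ∪ Ω`: `0 < 1 < α` for all `α` in `Ω`, and the order of `Ω` above. -/
def LeTwoUnion (A LA : Set M) (x y : M) : Prop :=
  (x = label0 ∧ InTwoUnion A y) ∨
  (x = label1 ∧ (y = label1 ∨ ∃ β ∈ A, y = labelOf β)) ∨
  ∃ α ∈ A, ∃ β ∈ A, x = labelOf α ∧ y = labelOf β ∧ Rel LA α β

end Coding

end RevMath

/-!
The map `h` is defined by recursion on terms. The constants `0`, `ω`, `ε_α` become leaves. Any other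
term `⟨t₀, …, tₖ₋₁⟩` is given the height `1 + ∑ᵢ 2 ^ (height tᵢ + 3)`, which is strictly monotone on
the terms below `ω`, and a term below `ω` is sent to the linear tree of its height. The remaining
terms become nodes with one child for each entry, in which `h(tᵢ)` occurs together with the linear
tree of height `∑_{j < i} 2 ^ (height tⱼ + 3)`. As `h(t)` contains no linear tree higher than the
height of `t`, the child of an entry embeds into no child of an earlier equivalent entry. Hence, if
all children of one node embed into children of another, then the lists of entries are compared
lexicographically, by induction along the lists. The leaf `·1` in `guard h(tᵢ)` keeps the two parts
of a child apart: it does not embed into a linear tree with leaf `·0`.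

All recursions take place inside a possibly nonstandard model: finite sequences are coded with
Gödel's `β` function, whose existence statements come from `Σ⁰₁` collection and induction, and
functions defined by course-of-values recursion are `Δ⁰₁`.
-/

namespace RevMath

/-! ### Arithmetic in models of `RCA₀` -/

section Arithmetic

variable {M : Type*} [L2Structure M]

namespace ModelsRCA0

/-- The induction variable has index `1` and the parameters start at index `2`; index `0` is the
dummy witness of the `Σ⁰₁` formula. -/
theorem bdd_induction (hM : ModelsRCA0 M) (φ : BddFormula) (e : ℕ → M) (P : M → Prop)
    (hP : ∀ X x n, φ.Sat X (push x (push n e)) ↔ P n)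
    (h0 : P 0) (hs : ∀ n, P n → P (n + 1)) (n : M) : P n := by
  obtain ⟨X, hX⟩ := L2Structure.sets_nonempty (M := M)
  obtain ⟨x, hx⟩ := hM.sigma1_induction φ e (fun _ => X) (fun _ => hX)
    ⟨0, (hP _ _ _).2 h0⟩ (fun n ⟨x, hx⟩ => ⟨0, (hP _ _ _).2 (hs n ((hP _ _ _).1 hx))⟩) n
  exact (hP _ _ _).1 hx

theorem zero_add (hM : ModelsRCA0 M) (n : M) : 0 + n = n :=
  hM.bdd_induction (.eq (.add .zero (.var 1)) (.var 1)) (fun _ => 0) (fun n => 0 + n = n)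
    (fun _ _ _ => Iff.rfl) (hM.add_zero 0) (fun n h => by rw [hM.add_succ, h]) n

theorem succ_add (hM : ModelsRCA0 M) (m n : M) : m + 1 + n = m + n + 1 :=
  hM.bdd_induction (.eq (.add (.add (.var 2) .one) (.var 1)) (.add (.add (.var 2) (.var 1)) .one))
    (fun _ => m) (fun n => m + 1 + n = m + n + 1) (fun _ _ _ => Iff.rfl)
    (by rw [hM.add_zero, hM.add_zero]) (fun n h => by rw [hM.add_succ, h, hM.add_succ]) n

theorem add_comm (hM : ModelsRCA0 M) (m n : M) : m + n = n + m :=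
  hM.bdd_induction (.eq (.add (.var 2) (.var 1)) (.add (.var 1) (.var 2)))
    (fun _ => m) (fun n => m + n = n + m) (fun _ _ _ => Iff.rfl)
    (by rw [hM.add_zero, hM.zero_add]) (fun n h => by rw [hM.add_succ, h, hM.succ_add]) n

theorem add_assoc (hM : ModelsRCA0 M) (a b n : M) : a + b + n = a + (b + n) :=
  hM.bdd_induction (.eq (.add (.add (.var 2) (.var 3)) (.var 1))
      (.add (.var 2) (.add (.var 3) (.var 1))))
    (push a fun _ => b) (fun n => a + b + n = a + (b + n)) (fun _ _ _ => Iff.rfl)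
    (by rw [hM.add_zero, hM.add_zero])
    (fun n h => by rw [hM.add_succ, h, hM.add_succ, hM.add_succ]) n

theorem zero_mul (hM : ModelsRCA0 M) (n : M) : 0 * n = 0 :=
  hM.bdd_induction (.eq (.mul .zero (.var 1)) .zero) (fun _ => 0) (fun n => 0 * n = 0)
    (fun _ _ _ => Iff.rfl) (hM.mul_zero 0) (fun n h => by rw [hM.mul_succ, h, hM.add_zero]) n

theorem succ_mul (hM : ModelsRCA0 M) (m n : M) : (m + 1) * n = m * n + n :=
  hM.bdd_induction (.eq (.mul (.add (.var 2) .one) (.var 1))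
      (.add (.mul (.var 2) (.var 1)) (.var 1)))
    (fun _ => m) (fun n => (m + 1) * n = m * n + n) (fun _ _ _ => Iff.rfl)
    (by rw [hM.mul_zero, hM.mul_zero, hM.add_zero])
    (fun n h => by
      rw [hM.mul_succ, h, hM.mul_succ, ← hM.add_assoc, hM.add_succ, hM.add_assoc (m * n),
        hM.add_comm n m, ← hM.add_assoc]) n

theorem mul_comm (hM : ModelsRCA0 M) (m n : M) : m * n = n * m :=
  hM.bdd_induction (.eq (.mul (.var 2) (.var 1)) (.mul (.var 1) (.var 2)))
    (fun _ => m) (fun n => m * n = n * m) (fun _ _ _ => Iff.rfl)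
    (by rw [hM.mul_zero, hM.zero_mul]) (fun n h => by rw [hM.mul_succ, h, hM.succ_mul]) n

theorem mul_add (hM : ModelsRCA0 M) (a b n : M) : a * (b + n) = a * b + a * n :=
  hM.bdd_induction (.eq (.mul (.var 2) (.add (.var 3) (.var 1)))
      (.add (.mul (.var 2) (.var 3)) (.mul (.var 2) (.var 1))))
    (push a fun _ => b) (fun n => a * (b + n) = a * b + a * n) (fun _ _ _ => Iff.rfl)
    (by rw [hM.add_zero, hM.mul_zero, hM.add_zero])
    (fun n h => by rw [hM.add_succ, hM.mul_succ, h, hM.mul_succ, hM.add_assoc]) n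

theorem mul_assoc (hM : ModelsRCA0 M) (a b n : M) : a * b * n = a * (b * n) :=
  hM.bdd_induction (.eq (.mul (.mul (.var 2) (.var 3)) (.var 1))
      (.mul (.var 2) (.mul (.var 3) (.var 1))))
    (push a fun _ => b) (fun n => a * b * n = a * (b * n)) (fun _ _ _ => Iff.rfl)
    (by rw [hM.mul_zero, hM.mul_zero, hM.mul_zero])
    (fun n h => by rw [hM.mul_succ, h, hM.mul_succ, hM.mul_add]) n

theorem mul_one (hM : ModelsRCA0 M) (n : M) : n * 1 = n := by
  conv_lhs => rw [← hM.zero_add 1]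
  rw [hM.mul_succ, hM.mul_zero, hM.zero_add]

theorem lt_add_succ (hM : ModelsRCA0 M) (a n : M) : a < a + n + 1 :=
  hM.bdd_induction (.lt (.var 2) (.add (.add (.var 2) (.var 1)) .one))
    (fun _ => a) (fun n => a < a + n + 1) (fun _ _ _ => Iff.rfl)
    ((hM.lt_succ_iff _ _).2 (Or.inr (hM.add_zero a).symm))
    (fun n h => by rw [hM.add_succ]; exact (hM.lt_succ_iff _ _).2 (Or.inl h)) n

theorem exists_eq_add_succ_of_lt (hM : ModelsRCA0 M) (a b : M) (h : a < b) :
    ∃ c, b = a + c + 1 := by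
  obtain ⟨X, hX⟩ := L2Structure.sets_nonempty (M := M)
  have key : ∀ n, ∃ x, ¬ (a < n ∧ ¬ n = a + x + 1) :=
    hM.sigma1_induction (.neg (.and (.lt (.var 2) (.var 1))
      (.neg (.eq (.var 1) (.add (.add (.var 2) (.var 0)) .one))))) (fun _ => a) (fun _ => X)
      (fun _ => hX) ⟨0, fun h => hM.not_lt_zero _ h.1⟩ (fun n ⟨x, hx⟩ => by
        change ¬ (a < n ∧ ¬ n = a + x + 1) at hx
        change ∃ x, ¬ (a < n + 1 ∧ ¬ n + 1 = a + x + 1)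
        by_cases han : a < n
        · have : n = a + x + 1 := by tauto
          exact ⟨x + 1, fun h => h.2 (by rw [hM.add_succ, ← this])⟩
        · refine ⟨0, fun h => ?_⟩
          rcases (hM.lt_succ_iff _ _).1 h.1 with h' | h'
          · exact han h'
          · exact h.2 (by rw [hM.add_zero, h']))
  obtain ⟨x, hx⟩ := key b
  exact ⟨x, by tauto⟩

theorem lt_iff_exists_eq_add_succ (hM : ModelsRCA0 M) (a b : M) : a < b ↔ ∃ c, b = a + c + 1 :=
  ⟨hM.exists_eq_add_succ_of_lt a b, fun ⟨c, h⟩ => h ▸ hM.lt_add_succ a c⟩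

theorem lt_trans (hM : ModelsRCA0 M) {a b c : M} (h : a < b) (h' : b < c) : a < c := by
  rw [hM.lt_iff_exists_eq_add_succ] at *
  obtain ⟨x, rfl⟩ := h
  obtain ⟨y, rfl⟩ := h'
  exact ⟨x + 1 + y, by rw [hM.add_assoc a x 1, hM.add_assoc a]⟩

theorem add_right_cancel (hM : ModelsRCA0 M) {a b : M} (n : M) : a + n = b + n → a = b := by
  have : ∀ n, ¬ (a + n = b + n ∧ ¬ a = b) :=
    hM.bdd_induction (.neg (.and (.eq (.add (.var 2) (.var 1)) (.add (.var 3) (.var 1)))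
      (.neg (.eq (.var 2) (.var 3))))) (push a fun _ => b)
      (fun n => ¬ (a + n = b + n ∧ ¬ a = b)) (fun _ _ _ => Iff.rfl)
      (by rw [hM.add_zero, hM.add_zero]; tauto)
      (fun n h h' => h ⟨hM.succ_inj _ _ (by rw [← hM.add_succ, ← hM.add_succ, h'.1]), h'.2⟩)
  have := this n
  tauto

theorem lt_irrefl (hM : ModelsRCA0 M) (a : M) : ¬ a < a := by
  rw [hM.lt_iff_exists_eq_add_succ]
  rintro ⟨c, hc⟩
  refine hM.succ_ne_zero c (hM.add_right_cancel a ?_)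
  rw [hM.zero_add, hM.add_comm, ← hM.add_assoc, ← hc]

theorem zero_lt_or_eq (hM : ModelsRCA0 M) (n : M) : 0 < n ∨ 0 = n := by
  have : ∀ n : M, ¬ (¬ 0 < n ∧ ¬ 0 = n) :=
    hM.bdd_induction (.neg (.and (.neg (.lt .zero (.var 1))) (.neg (.eq .zero (.var 1)))))
      (fun _ => 0) (fun n => ¬ (¬ 0 < n ∧ ¬ 0 = n)) (fun _ _ _ => Iff.rfl)
      (by tauto) (fun n h h' => by rw [hM.lt_succ_iff] at h'; tauto)
  have := this n
  tauto

theorem succ_lt_or_eq_of_lt (hM : ModelsRCA0 M) {a b : M} (h : a < b) : a + 1 < b ∨ a + 1 = b := by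
  obtain ⟨c, rfl⟩ := (hM.lt_iff_exists_eq_add_succ _ _).1 h
  rcases hM.zero_lt_or_eq c with h0 | rfl
  · obtain ⟨d, rfl⟩ := (hM.lt_iff_exists_eq_add_succ _ _).1 h0
    refine Or.inl ((hM.lt_iff_exists_eq_add_succ _ _).2 ⟨d, ?_⟩)
    rw [hM.zero_add, hM.succ_add, hM.add_succ]
  · exact Or.inr (by rw [hM.add_zero])

theorem lt_trichotomy (hM : ModelsRCA0 M) (a n : M) : a < n ∨ a = n ∨ n < a := by
  have : ∀ n : M, ¬ (¬ a < n ∧ ¬ a = n ∧ ¬ n < a) :=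
    hM.bdd_induction (.neg (.and (.neg (.lt (.var 2) (.var 1)))
      (.and (.neg (.eq (.var 2) (.var 1))) (.neg (.lt (.var 1) (.var 2))))))
      (fun _ => a) (fun n => ¬ (¬ a < n ∧ ¬ a = n ∧ ¬ n < a)) (fun _ _ _ => Iff.rfl)
      (fun h => (hM.zero_lt_or_eq a).elim h.2.2 fun h' => h.2.1 h'.symm)
      (fun n h h' => by
        rw [hM.lt_succ_iff] at h'
        have : n < a := by tauto
        rcases hM.succ_lt_or_eq_of_lt this with h2 | h2
        · exact h'.2.2 h2
        · exact h'.2.1 h2.symm)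
  have := this n
  tauto

end ModelsRCA0

variable [hM : Fact (ModelsRCA0 M)]

noncomputable instance instCommSemiring : CommSemiring M where
  zero := 0
  one := 1
  add := (· + ·)
  mul := (· * ·)
  nsmul := nsmulRec
  npow := npowRec
  zero_add := hM.out.zero_add
  add_zero := hM.out.add_zero
  add_comm := hM.out.add_comm
  add_assoc := hM.out.add_assoc
  zero_mul := hM.out.zero_mul
  mul_zero := hM.out.mul_zero
  one_mul n := by rw [hM.out.mul_comm, hM.out.mul_one]
  mul_one := hM.out.mul_one
  mul_comm := hM.out.mul_comm
  mul_assoc := hM.out.mul_assoc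
  left_distrib := hM.out.mul_add
  right_distrib a b c := by
    rw [hM.out.mul_comm, hM.out.mul_add, hM.out.mul_comm c, hM.out.mul_comm c]

open Classical in
noncomputable instance instLinearOrder : LinearOrder M where
  lt := (· < ·)
  le a b := a < b ∨ a = b
  le_refl a := Or.inr rfl
  le_trans a b c := by
    rintro (h | rfl) (h' | rfl)
    · exact Or.inl (hM.out.lt_trans h h')
    · exact Or.inl h
    · exact Or.inl h'
    · exact Or.inr rfl
  lt_iff_le_not_ge a b := by
    constructor
    · intro h
      refine ⟨Or.inl h, ?_⟩
      rintro (h' | rfl)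
      · exact hM.out.lt_irrefl _ (hM.out.lt_trans h h')
      · exact hM.out.lt_irrefl _ h
    · rintro ⟨h | rfl, h'⟩
      · exact h
      · exact (h' (Or.inr rfl)).elim
  le_antisymm a b := by
    rintro (h | rfl) (h' | h')
    · exact (hM.out.lt_irrefl _ (hM.out.lt_trans h h')).elim
    · exact h'.symm
    · rfl
    · rfl
  le_total a b := by
    rcases hM.out.lt_trichotomy a b with h | h | h
    · exact Or.inl (Or.inl h)
    · exact Or.inl (Or.inr h)
    · exact Or.inr (Or.inl h)
  toDecidableLE := Classical.decRel _

theorem lt_iff_exists_eq_add_succ {a b : M} : a < b ↔ ∃ c, b = a + c + 1 :=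
  hM.out.lt_iff_exists_eq_add_succ a b

theorem exists_eq_add_one_of_ne_zero {n : M} (hn : n ≠ 0) : ∃ k, n = k + 1 := by
  obtain ⟨k, hk⟩ := lt_iff_exists_eq_add_succ.1 ((hM.out.zero_lt_or_eq n).resolve_right hn.symm)
  exact ⟨k, by rwa [zero_add] at hk⟩

noncomputable instance : SuccOrder M :=
  SuccOrder.ofSuccLeIff (· + 1)
    ⟨fun h => lt_of_lt_of_le ((hM.out.lt_succ_iff _ _).2 (Or.inr rfl)) h,
      hM.out.succ_lt_or_eq_of_lt⟩

noncomputable instance : SuccAddOrder M := ⟨fun _ => rfl⟩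

instance : Nontrivial M := ⟨1, 0, by simpa only [zero_add] using hM.out.succ_ne_zero 0⟩

instance : IsOrderedAddMonoid M where
  add_le_add_left a b h c := by
    rcases h with h | rfl
    · obtain ⟨x, rfl⟩ := lt_iff_exists_eq_add_succ.1 h
      exact Or.inl (lt_iff_exists_eq_add_succ.2 ⟨x, by ring⟩)
    · exact le_rfl

instance : IsOrderedCancelAddMonoid M where
  le_of_add_le_add_left a b c h := by
    by_contra! hlt
    obtain ⟨x, rfl⟩ := lt_iff_exists_eq_add_succ.1 hlt
    exact h.not_gt (lt_iff_exists_eq_add_succ.2 ⟨x, by ring⟩)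

theorem mul_lt_mul_of_lt_of_pos {a b c : M} (h : a < b) (hc : 0 < c) : a * c < b * c := by
  obtain ⟨x, rfl⟩ := lt_iff_exists_eq_add_succ.1 h
  obtain ⟨y, rfl⟩ := lt_iff_exists_eq_add_succ.1 hc
  exact lt_iff_exists_eq_add_succ.2 ⟨x * y + x + y, by ring⟩

instance : IsStrictOrderedRing M where
  zero_le_one := hM.out.zero_lt_or_eq 1
  mul_lt_mul_of_pos_left c hc a b h := by
    simpa only [mul_comm c] using mul_lt_mul_of_lt_of_pos h hc
  mul_lt_mul_of_pos_right c hc a b h := mul_lt_mul_of_lt_of_pos h hc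

instance : CanonicallyOrderedAdd M where
  exists_add_of_le {a b} h := by
    rcases h with h | rfl
    · obtain ⟨x, rfl⟩ := lt_iff_exists_eq_add_succ.1 h
      exact ⟨x + 1, by ring⟩
    · exact ⟨0, (add_zero a).symm⟩
  le_add_self a b := le_add_of_nonneg_left (hM.out.zero_lt_or_eq b)
  le_self_add a b := le_add_of_nonneg_right (hM.out.zero_lt_or_eq b)

end Arithmetic

/-! ### Bounded and `Σ⁰₁` definability -/

section Formulas

variable {M : Type*}

/-- Renaming of the variables of a term. -/
def NumTerm.rename (ρ : ℕ → ℕ) : NumTerm → NumTerm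
  | .var i => .var (ρ i)
  | .zero => .zero
  | .one => .one
  | .add s t => .add (s.rename ρ) (t.rename ρ)
  | .mul s t => .mul (s.rename ρ) (t.rename ρ)

/-- A renaming of variables, extended below one quantifier. -/
def liftRename (ρ : ℕ → ℕ) : ℕ → ℕ
  | 0 => 0
  | n + 1 => ρ n + 1

theorem push_liftRename (ρ : ℕ → ℕ) (e : ℕ → M) (x : M) :
    (fun i => push x e (liftRename ρ i)) = push x (fun i => e (ρ i)) := by
  funext i
  cases i <;> rfl

/-- Renaming of the number variables of a formula. -/
def BddFormula.rename : (ℕ → ℕ) → BddFormula → BddFormula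
  | ρ, .eq s t => .eq (s.rename ρ) (t.rename ρ)
  | ρ, .lt s t => .lt (s.rename ρ) (t.rename ρ)
  | ρ, .mem t i => .mem (t.rename ρ) i
  | ρ, .neg φ => .neg (φ.rename ρ)
  | ρ, .and φ ψ => .and (φ.rename ρ) (ψ.rename ρ)
  | ρ, .bex t φ => .bex (t.rename ρ) (φ.rename (liftRename ρ))

variable [L2Structure M]

theorem NumTerm.eval_rename (ρ : ℕ → ℕ) (e : ℕ → M) (t : NumTerm) :
    (t.rename ρ).eval e = t.eval (fun i => e (ρ i)) := by
  induction t <;> simp_all [NumTerm.rename, NumTerm.eval]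

theorem BddFormula.sat_rename (X : ℕ → Set M) (φ : BddFormula) (ρ : ℕ → ℕ) (e : ℕ → M) :
    (φ.rename ρ).Sat X e ↔ φ.Sat X (fun i => e (ρ i)) := by
  induction φ generalizing ρ e with
  | bex t φ ih => simp [BddFormula.rename, BddFormula.Sat, NumTerm.eval_rename, ih, push_liftRename]
  | _ => simp_all [BddFormula.rename, BddFormula.Sat, NumTerm.eval_rename]

/-- Renaming of the set variables of a formula. -/
def BddFormula.renameSet (f : ℕ → ℕ) : BddFormula → BddFormula
  | .eq s t => .eq s t
  | .lt s t => .lt s t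
  | .mem t i => .mem t (f i)
  | .neg φ => .neg (φ.renameSet f)
  | .and φ ψ => .and (φ.renameSet f) (ψ.renameSet f)
  | .bex t φ => .bex t (φ.renameSet f)

theorem BddFormula.sat_renameSet (X : ℕ → Set M) (f : ℕ → ℕ) (φ : BddFormula) (e : ℕ → M) :
    (φ.renameSet f).Sat X e ↔ φ.Sat (fun i => X (f i)) e := by
  induction φ generalizing e <;> simp_all [BddFormula.renameSet, BddFormula.Sat]

/-- Predicates of assignments that are defined by a bounded formula with set parameters. -/
def IsDelta0 (P : (ℕ → M) → Prop) : Prop :=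
  ∃ (φ : BddFormula) (X : ℕ → Set M), (∀ i, X i ∈ sets M) ∧ ∀ e, φ.Sat X e ↔ P e

theorem IsDelta0.exists_common_parameters {P Q : (ℕ → M) → Prop} (hP : IsDelta0 P)
    (hQ : IsDelta0 Q) :
    ∃ (φ ψ : BddFormula) (X : ℕ → Set M), (∀ i, X i ∈ sets M) ∧ (∀ e, φ.Sat X e ↔ P e) ∧
      ∀ e, ψ.Sat X e ↔ Q e := by
  obtain ⟨φ, X, hX, hφ⟩ := hP
  obtain ⟨ψ, Y, hY, hψ⟩ := hQ
  refine ⟨φ.renameSet (fun i => 2 * i), ψ.renameSet (fun i => 2 * i + 1),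
    fun n => if n % 2 = 0 then X (n / 2) else Y (n / 2), ?_, ?_, ?_⟩
  · intro i
    dsimp only
    split_ifs
    exacts [hX _, hY _]
  · intro e
    rw [BddFormula.sat_renameSet, ← hφ]
    simp
  · intro e
    have odd_div (i : ℕ) : (2 * i + 1) / 2 = i := by omega
    have odd_mod (i : ℕ) : (2 * i + 1) % 2 = 1 := by omega
    rw [BddFormula.sat_renameSet, ← hψ]
    simp [odd_div, odd_mod]

theorem IsDelta0.congr {P Q : (ℕ → M) → Prop} (hP : IsDelta0 P) (h : ∀ e, Q e ↔ P e) :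
    IsDelta0 Q := by
  obtain ⟨φ, X, hX, hφ⟩ := hP
  exact ⟨φ, X, hX, fun e => (hφ e).trans (h e).symm⟩

theorem IsDelta0.eq (s t : NumTerm) : IsDelta0 fun e : ℕ → M => s.eval e = t.eval e := by
  obtain ⟨X, hX⟩ := L2Structure.sets_nonempty (M := M)
  exact ⟨.eq s t, fun _ => X, fun _ => hX, fun e => Iff.rfl⟩

theorem IsDelta0.lt (s t : NumTerm) : IsDelta0 fun e : ℕ → M => s.eval e < t.eval e := by
  obtain ⟨X, hX⟩ := L2Structure.sets_nonempty (M := M)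
  exact ⟨.lt s t, fun _ => X, fun _ => hX, fun e => Iff.rfl⟩

theorem IsDelta0.mem (t : NumTerm) {X : Set M} (hX : X ∈ sets M) :
    IsDelta0 fun e : ℕ → M => t.eval e ∈ X :=
  ⟨.mem t 0, fun _ => X, fun _ => hX, fun _ => Iff.rfl⟩

theorem IsDelta0.not {P : (ℕ → M) → Prop} (hP : IsDelta0 P) : IsDelta0 fun e => ¬ P e := by
  obtain ⟨φ, X, hX, hφ⟩ := hP
  exact ⟨.neg φ, X, hX, fun e => not_congr (hφ e)⟩

theorem IsDelta0.and {P Q : (ℕ → M) → Prop} (hP : IsDelta0 P) (hQ : IsDelta0 Q) :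
    IsDelta0 fun e => P e ∧ Q e := by
  obtain ⟨φ, ψ, X, hX, hφ, hψ⟩ := hP.exists_common_parameters hQ
  exact ⟨.and φ ψ, X, hX, fun e => and_congr (hφ e) (hψ e)⟩

theorem IsDelta0.or {P Q : (ℕ → M) → Prop} (hP : IsDelta0 P) (hQ : IsDelta0 Q) :
    IsDelta0 fun e => P e ∨ Q e :=
  (hP.not.and hQ.not).not.congr fun e => by tauto

theorem IsDelta0.bex (t : NumTerm) {P : (ℕ → M) → Prop} (hP : IsDelta0 P) :
    IsDelta0 fun e => ∃ x, x < t.eval e ∧ P (push x e) := by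
  obtain ⟨φ, X, hX, hφ⟩ := hP
  exact ⟨.bex t φ, X, hX, fun e => exists_congr fun x => and_congr_right fun _ => hφ _⟩

theorem IsDelta0.ball (t : NumTerm) {P : (ℕ → M) → Prop} (hP : IsDelta0 P) :
    IsDelta0 fun e => ∀ x, x < t.eval e → P (push x e) :=
  (hP.not.bex t).not.congr fun e => by simp

theorem IsDelta0.rename {P : (ℕ → M) → Prop} (hP : IsDelta0 P) (ρ : ℕ → ℕ) :
    IsDelta0 fun e => P (fun i => e (ρ i)) := by
  obtain ⟨φ, X, hX, hφ⟩ := hP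
  exact ⟨φ.rename ρ, X, hX, fun e => by rw [BddFormula.sat_rename, hφ]⟩

/-- Predicates of assignments that are defined by a `Σ⁰₁` formula with set parameters. -/
def IsSigma1 (P : (ℕ → M) → Prop) : Prop :=
  ∃ Q : (ℕ → M) → Prop, IsDelta0 Q ∧ ∀ e, P e ↔ ∃ x, Q (push x e)

theorem IsSigma1.congr {P Q : (ℕ → M) → Prop} (hP : IsSigma1 P) (h : ∀ e, Q e ↔ P e) :
    IsSigma1 Q := by
  obtain ⟨R, hR, hRP⟩ := hP
  exact ⟨R, hR, fun e => (h e).trans (hRP e)⟩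

theorem IsDelta0.isSigma1 {P : (ℕ → M) → Prop} (hP : IsDelta0 P) : IsSigma1 P :=
  ⟨fun e => P (fun i => e (i + 1)), hP.rename _, fun e => by simp [push]⟩

theorem IsSigma1.rename {P : (ℕ → M) → Prop} (hP : IsSigma1 P) (ρ : ℕ → ℕ) :
    IsSigma1 fun e => P (fun i => e (ρ i)) := by
  obtain ⟨R, hR, hRP⟩ := hP
  refine ⟨_, hR.rename (liftRename ρ), fun e => ?_⟩
  simp_rw [push_liftRename]
  exact hRP _

theorem IsSigma1.or {P Q : (ℕ → M) → Prop} (hP : IsSigma1 P) (hQ : IsSigma1 Q) :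
    IsSigma1 fun e => P e ∨ Q e := by
  obtain ⟨R, hR, hRP⟩ := hP
  obtain ⟨S, hS, hSQ⟩ := hQ
  exact ⟨_, hR.or hS, fun e => by simp only [hRP, hSQ, exists_or]⟩

variable [hM : Fact (ModelsRCA0 M)]

theorem IsSigma1.ex {P : (ℕ → M) → Prop} (hP : IsSigma1 P) :
    IsSigma1 fun e => ∃ x, P (push x e) := by
  obtain ⟨R, hR, hRP⟩ := hP
  refine ⟨_, ((hR.rename (liftRename (liftRename Nat.succ))).bex (.add (.var 1) .one)).bex
    (.add (.var 0) .one), fun e => ?_⟩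
  simp only [push_liftRename]
  change _ ↔ ∃ z : M, ∃ y : M, y < z + 1 ∧ ∃ x : M, x < z + 1 ∧ R (push x (push y e))
  constructor
  · rintro ⟨y, hy⟩
    obtain ⟨x, hx⟩ := (hRP _).1 hy
    exact ⟨max x y, y, Order.lt_add_one_iff.2 (le_max_right _ _), x,
      Order.lt_add_one_iff.2 (le_max_left _ _), hx⟩
  · rintro ⟨z, y, -, x, -, hx⟩
    exact ⟨y, (hRP _).2 ⟨x, hx⟩⟩

theorem IsSigma1.and {P Q : (ℕ → M) → Prop} (hP : IsSigma1 P) (hQ : IsSigma1 Q) :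
    IsSigma1 fun e => P e ∧ Q e := by
  obtain ⟨R, hR, hRP⟩ := hP
  obtain ⟨S, hS, hSQ⟩ := hQ
  have hRS : IsSigma1 fun e : ℕ → M => ∃ x, R (push x fun i => e (i + 1)) ∧ S e := by
    refine ⟨_, (hR.rename (liftRename Nat.succ)).and (hS.rename Nat.succ), fun e => ?_⟩
    simp only [push_liftRename]
    rfl
  refine (hRS.ex).congr fun e => ?_
  rw [hRP, hSQ, exists_and_exists_comm, exists_comm]
  rfl

theorem IsSigma1.induction {P : (ℕ → M) → Prop} (hP : IsSigma1 P) (e : ℕ → M)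
    (zero : P (push 0 e)) (succ : ∀ n, P (push n e) → P (push (n + 1) e)) (n : M) :
    P (push n e) := by
  obtain ⟨Q, ⟨φ, X, hX, hφ⟩, hQP⟩ := hP
  have sat_iff (n : M) : P (push n e) ↔ ∃ x, φ.Sat X (push x (push n e)) := by
    simp only [hQP, hφ]
  simp only [sat_iff] at zero succ ⊢
  exact hM.out.sigma1_induction φ e X hX zero succ n

theorem IsDelta0.collection {R : (ℕ → M) → Prop} (hR : IsDelta0 R) (e : ℕ → M) (b : M)
    (h : ∀ y, y < b → ∃ x, R (push x (push y e))) :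
    ∃ z, ∀ y, y < b → ∃ x, x < z + 1 ∧ R (push x (push y e)) := by
  have hBounded : IsDelta0 fun e : ℕ → M => ∀ y : M, y < e 1 → ¬ y < e 2 ∨ ∃ x : M, x < e 0 + 1 ∧
      R (push x (push y fun i => e (i + 3))) := by
    have h' := (((IsDelta0.lt (.var 0) (.var 3)).not.or
      ((hR.rename (liftRename (liftRename (· + 3)))).bex (.add (.var 1) .one))).ball (.var 1))
    simp only [push_liftRename] at h'
    exact h'
  have key := IsSigma1.induction (P := fun e => ∃ z, ∀ y : M, y < e 0 → ¬ y < e 1 ∨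
      ∃ x : M, x < z + 1 ∧ R (push x (push y fun i => e (i + 2))))
    ⟨_, hBounded, fun _ => Iff.rfl⟩ (push b e) ⟨0, fun y hy => (not_lt_zero hy).elim⟩ ?_ b
  · obtain ⟨z, hz⟩ := key
    exact ⟨z, fun y hy => (hz y hy).resolve_left (not_not_intro hy)⟩
  · rintro n ⟨z, hz⟩
    obtain ⟨x, hx⟩ : ∃ x, n < b → R (push x (push n e)) := by
      by_cases hn : n < b
      · exact (h n hn).imp fun x hx _ => hx
      · exact ⟨0, fun hnb => (hn hnb).elim⟩
    refine ⟨max z x, fun y hy => ?_⟩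
    rcases (hM.out.lt_succ_iff _ _).1 hy with hy | rfl
    · refine (hz y hy).imp_right fun ⟨w, hw, hR⟩ => ⟨w, hw.trans_le ?_, hR⟩
      gcongr
      exact le_max_left z x
    · by_cases hy : y < b
      · exact Or.inr ⟨x, Order.lt_add_one_iff.2 (le_max_right _ _), hx hy⟩
      · exact Or.inl hy

theorem IsSigma1.ball (t : NumTerm) {P : (ℕ → M) → Prop} (hP : IsSigma1 P) :
    IsSigma1 fun e => ∀ x, x < t.eval e → P (push x e) := by
  obtain ⟨R, hR, hRP⟩ := hP
  refine ⟨_, ((hR.rename (liftRename (liftRename Nat.succ))).bex (.add (.var 1) .one)).ball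
    (t.rename Nat.succ), fun e => ?_⟩
  simp only [NumTerm.eval_rename, push_liftRename, hRP]
  exact ⟨hR.collection e _, fun ⟨z, hz⟩ y hy => (hz y hy).imp fun x hx => hx.2⟩

theorem singleton_mem_sets (c : M) : {c} ∈ sets M := by
  obtain ⟨X, hX⟩ := L2Structure.sets_nonempty (M := M)
  obtain ⟨Y, hY, h⟩ := hM.out.delta1_comprehension (.eq (.var 1) (.var 2)) (.eq (.var 1) (.var 2))
    (fun _ => c) (fun _ => X) (fun _ => hX) fun n => by
      change (∃ _ : M, n = c) ↔ ∀ _ : M, n = c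
      rw [exists_const, forall_const]
  convert hY
  ext n
  simp [h, BddFormula.Sat, NumTerm.eval, push]

theorem setOf_mem_sets {P : M → Prop} {Q R : (ℕ → M) → Prop} (hQ : IsSigma1 Q) (hR : IsSigma1 R)
    (hPQ : ∀ n e, P n ↔ Q (push n e)) (hPR : ∀ n e, ¬ P n ↔ R (push n e)) :
    {n | P n} ∈ sets M := by
  obtain ⟨Q', hQ', hQQ'⟩ := hQ
  obtain ⟨R', hR', hRR'⟩ := hR
  obtain ⟨φ, ψ, X, hX, hφ, hψ⟩ := hQ'.exists_common_parameters hR'.not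
  obtain ⟨Y, hY, hYφ⟩ := hM.out.delta1_comprehension φ ψ (fun _ => 0) X hX fun n => by
    simp only [hφ, hψ]
    rw [← hQQ', ← hPQ, ← not_exists, ← hRR', ← hPR, not_not]
  convert hY
  ext n
  rw [hYφ, Set.mem_ofPred_eq, hPQ n fun _ => 0, hQQ']
  simp only [hφ]

end Formulas

/-! ### Recursive predicates and functions -/

section Pairing

variable {M : Type*} [L2Structure M]

/-- The term for the pairing function. -/
def NumTerm.pair (s t : NumTerm) : NumTerm :=
  .add (.add (.mul (.add s t) (.add s t)) s) .one

theorem IsDelta0.eq_pair (i j k : ℕ) : IsDelta0 fun e : ℕ → M => e i = pair (e j) (e k) :=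
  .eq (.var i) (.pair (.var j) (.var k))

variable [hM : Fact (ModelsRCA0 M)]

theorem add_lt_pair (a b : M) : a + b < pair a b := by
  rw [pair, Order.lt_add_one_iff]
  rcases eq_zero_or_pos (a + b) with h | h
  · rw [h]
    exact zero_le
  · exact (le_mul_of_one_le_right zero_le (Order.one_le_iff_pos.2 h)).trans le_self_add

theorem left_lt_pair (a b : M) : a < pair a b :=
  le_self_add.trans_lt (add_lt_pair a b)

theorem right_lt_pair (a b : M) : b < pair a b :=
  le_add_self.trans_lt (add_lt_pair a b)

theorem pair_ne_zero (a b : M) : pair a b ≠ 0 := hM.out.succ_ne_zero _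

theorem pair_lt_pair {a b c d : M} (h : a + b < c + d) : pair a b < pair c d := by
  obtain ⟨x, hx⟩ := lt_iff_exists_eq_add_succ.1 h
  unfold pair
  rw [hx]
  refine lt_iff_exists_eq_add_succ.2 ⟨x * x + 2 * (a + b) * x + 2 * x + a + b + b + c, ?_⟩
  ring

theorem pair_inj {a b c d : M} : pair a b = pair c d ↔ a = c ∧ b = d := by
  refine ⟨fun h => ?_, fun ⟨hac, hbd⟩ => by rw [hac, hbd]⟩
  rcases lt_trichotomy (a + b) (c + d) with hlt | heq | hgt
  · exact absurd h (pair_lt_pair hlt).ne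
  · unfold pair at h
    rw [heq] at h
    grind
  · exact absurd h (pair_lt_pair hgt).ne'

end Pairing

section Codes

/-- Types whose elements are coded by the numbers of a bounded-definable subset of `M`. -/
class Coded (M : Type*) [L2Structure M] (γ : Type*) where
  enc : γ → M
  enc_injective : Function.Injective enc
  isDelta0_range : IsDelta0 fun e : ℕ → M => ∃ a, enc a = e 0

variable {M : Type*} [L2Structure M]

open Coded

instance Coded.self : Coded M M where
  enc := id
  enc_injective := Function.injective_id
  isDelta0_range := (IsDelta0.eq .zero .zero).congr fun e => by
    simp only [id_eq, exists_eq]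

variable [hM : Fact (ModelsRCA0 M)]

instance Coded.prod {γ δ : Type*} [Coded M γ] [Coded M δ] : Coded M (γ × δ) where
  enc a := pair (enc a.1) (enc a.2)
  enc_injective a b h := by
    obtain ⟨h₁, h₂⟩ := pair_inj.1 h
    exact Prod.ext (enc_injective h₁) (enc_injective h₂)
  isDelta0_range := by
    have h : IsDelta0 fun e : ℕ → M => ∃ x, x < e 0 ∧ ∃ y, y < e 0 ∧
        (e 0 = pair x y ∧ (∃ a : γ, enc a = x) ∧ ∃ b : δ, enc b = y) :=
      (((IsDelta0.eq_pair 2 1 0).and (((isDelta0_range (M := M) (γ := γ)).rename fun i => i + 1).and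
        (isDelta0_range (M := M) (γ := δ)))).bex (.var 1)).bex (.var 0)
    refine h.congr fun e => ⟨?_, ?_⟩
    · rintro ⟨⟨a, b⟩, h⟩
      rw [← h]
      exact ⟨_, left_lt_pair _ _, _, right_lt_pair _ _, rfl, ⟨a, rfl⟩, b, rfl⟩
    · rintro ⟨_, -, _, -, h, ⟨a, rfl⟩, b, rfl⟩
      exact ⟨(a, b), h.symm⟩

open Classical in
noncomputable instance Coded.prop : Coded M Prop where
  enc p := if p then 1 else 0
  enc_injective p q h := by
    by_cases hp : p <;> by_cases hq : q <;> simp_all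
  isDelta0_range := by
    refine ((IsDelta0.eq (.var 0) .zero).or (IsDelta0.eq (.var 0) .one)).congr fun e => ?_
    rw [← Prop.exists_iff.symm]
    simp only [if_true, if_false, eq_comm (b := e 0)]
    rfl

end Codes

section Recursive

open Coded

variable (M : Type*) [L2Structure M]

/-- Recursively enumerable predicates relative to the sets of `M`: `Σ⁰₁` predicates, with number
and set parameters, on a coded type. -/
def RecEnum {γ : Type*} [Coded M γ] (P : γ → Prop) : Prop :=
  ∃ Q : (ℕ → M) → Prop, IsSigma1 Q ∧ ∀ a e, P a ↔ Q (push (enc a) e)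

/-- Recursive functions between coded types relative to the sets of `M`: those with a `Σ⁰₁` graph,
with number and set parameters. For functions with values in `Prop` these are the `Δ⁰₁`
predicates. -/
@[fun_prop]
def Recursive {γ δ : Type*} [Coded M γ] [Coded M δ] (f : γ → δ) : Prop :=
  ∃ G : (ℕ → M) → Prop, IsSigma1 G ∧ ∀ a y e, y = enc (f a) ↔ G (push y (push (enc a) e))

variable {M} {γ δ ε : Type*} [Coded M γ] [Coded M δ] [Coded M ε]

theorem RecEnum.congr {P Q : γ → Prop} (hP : RecEnum M P) (h : ∀ a, Q a ↔ P a) : RecEnum M Q := by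
  rwa [show Q = P from funext fun a => propext (h a)]

theorem Recursive.id : Recursive M fun a : γ => a :=
  ⟨_, (IsDelta0.eq (.var 0) (.var 1)).isSigma1, fun _ _ _ => Iff.rfl⟩

theorem RecEnum.or {P Q : γ → Prop} (hP : RecEnum M P) (hQ : RecEnum M Q) :
    RecEnum M fun a => P a ∨ Q a := by
  obtain ⟨R, hR, hRP⟩ := hP
  obtain ⟨S, hS, hSQ⟩ := hQ
  exact ⟨_, hR.or hS, fun a e => or_congr (hRP a e) (hSQ a e)⟩

variable [hM : Fact (ModelsRCA0 M)]

theorem RecEnum.and {P Q : γ → Prop} (hP : RecEnum M P) (hQ : RecEnum M Q) :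
    RecEnum M fun a => P a ∧ Q a := by
  obtain ⟨R, hR, hRP⟩ := hP
  obtain ⟨S, hS, hSQ⟩ := hQ
  exact ⟨_, hR.and hS, fun a e => and_congr (hRP a e) (hSQ a e)⟩

theorem RecEnum.comp {P : δ → Prop} {f : γ → δ} (hP : RecEnum M P) (hf : Recursive M f) :
    RecEnum M fun a => P (f a) := by
  obtain ⟨R, hR, hRP⟩ := hP
  obtain ⟨G, hG, hGf⟩ := hf
  refine ⟨_, (hG.and hR).ex, fun a e => ⟨fun h => ⟨_, (hGf a _ e).1 rfl, (hRP _ _).1 h⟩, ?_⟩⟩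
  rintro ⟨y, hy, hRy⟩
  obtain rfl := (hGf a _ e).2 hy
  exact (hRP _ _).2 hRy

theorem Recursive.comp {g : δ → ε} {f : γ → δ} (hg : Recursive M g) (hf : Recursive M f) :
    Recursive M fun a => g (f a) := by
  obtain ⟨G, hG, hGf⟩ := hf
  obtain ⟨H, hH, hHg⟩ := hg
  refine ⟨_, ((hG.rename (liftRename Nat.succ)).and
    (hH.rename fun i => if i = 0 then 1 else if i = 1 then 0 else i)).ex, fun a y e => ?_⟩
  have swap (x y : M) (e : ℕ → M) : (fun i => push x (push y e)
      (if i = 0 then 1 else if i = 1 then 0 else i)) = push y (push x e) := by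
    funext i
    rcases i with - | - | i <;> rfl
  simp only [push_liftRename, swap]
  constructor
  · rintro rfl
    exact ⟨_, (hGf _ _ _).1 rfl, (hHg _ _ _).1 rfl⟩
  · rintro ⟨z, hz, hy⟩
    obtain rfl := (hGf _ _ _).2 hz
    exact (hHg _ _ _).2 hy

theorem Recursive.const (c : δ) : Recursive M fun _ : γ => c :=
  ⟨_, (IsDelta0.mem (.var 0) (singleton_mem_sets (enc c))).isSigma1, fun _ _ _ => Iff.rfl⟩

theorem recursive_fst : Recursive M (Prod.fst : γ × δ → γ) := by
  have h : IsDelta0 fun e : ℕ → M => ∃ x, x < e 1 ∧ e 1 = pair (e 0) x :=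
    (IsDelta0.eq_pair 2 1 0).bex (.var 1)
  refine ⟨_, h.isSigma1, fun a y e => ⟨?_, ?_⟩⟩
  · rintro rfl
    exact ⟨enc a.2, right_lt_pair _ _, rfl⟩
  · rintro ⟨x, -, h⟩
    exact (pair_inj.1 h).1.symm

theorem recursive_snd : Recursive M (Prod.snd : γ × δ → δ) := by
  have h : IsDelta0 fun e : ℕ → M => ∃ x, x < e 1 ∧ e 1 = pair x (e 0) :=
    (IsDelta0.eq_pair 2 0 1).bex (.var 1)
  refine ⟨_, h.isSigma1, fun a y e => ⟨?_, ?_⟩⟩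
  · rintro rfl
    exact ⟨enc a.1, left_lt_pair _ _, rfl⟩
  · rintro ⟨x, -, h⟩
    exact (pair_inj.1 h).2.symm

theorem Recursive.prodMk {f : γ → δ} {g : γ → ε} (hf : Recursive M f) (hg : Recursive M g) :
    Recursive M fun a => (f a, g a) := by
  obtain ⟨F, hF, hFf⟩ := hf
  obtain ⟨G, hG, hGg⟩ := hg
  have skip (x y z : M) (e : ℕ → M) :
      (fun i => push x (push y (push z e)) (if i = 0 then 1 else i + 2)) = push y e := by
    funext i
    cases i <;> rfl
  refine ⟨_, (((IsDelta0.eq_pair 2 1 0).isSigma1.and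
    ((hF.rename fun i => if i = 0 then 1 else i + 2).and
      (hG.rename (liftRename fun i => i + 2)))).ex).ex, fun a y e => ?_⟩
  simp only [skip, push_liftRename]
  constructor
  · rintro rfl
    exact ⟨_, _, rfl, (hFf _ _ _).1 rfl, (hGg _ _ _).1 rfl⟩
  · rintro ⟨u, v, h, hu, hv⟩
    obtain rfl := (hFf _ _ _).2 hu
    obtain rfl := (hGg _ _ _).2 hv
    exact h

attribute [fun_prop] Recursive.comp Recursive.id Recursive.const Recursive.prodMk

@[fun_prop]
theorem Recursive.fst {f : γ → δ × ε} (hf : Recursive M f) : Recursive M fun a => (f a).1 :=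
  recursive_fst.comp hf

@[fun_prop]
theorem Recursive.snd {f : γ → δ × ε} (hf : Recursive M f) : Recursive M fun a => (f a).2 :=
  recursive_snd.comp hf

theorem RecEnum.ex {P : γ → δ → Prop} (hP : RecEnum M fun x : γ × δ => P x.1 x.2) :
    RecEnum M fun a => ∃ b, P a b := by
  obtain ⟨R, hR, hRP⟩ := hP
  refine ⟨_, (((IsDelta0.eq_pair 1 2 0).isSigma1.and ((isDelta0_range (M := M)
    (γ := δ)).isSigma1.and (hR.rename fun i => i + 1))).ex).ex, fun a e => ?_⟩
  constructor
  · rintro ⟨b, h⟩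
    exact ⟨_, _, rfl, ⟨b, rfl⟩, (hRP (a, b) _).1 h⟩
  · rintro ⟨z, _, hz, ⟨b, rfl⟩, hRz⟩
    obtain rfl : z = pair (enc a) (enc b) := hz
    exact ⟨b, (hRP (a, b) _).2 hRz⟩

theorem RecEnum.ball {P : γ → M → Prop} {g : γ → M} (hg : Recursive M g)
    (hP : RecEnum M fun x : γ × M => P x.1 x.2) : RecEnum M fun a => ∀ b < g a, P a b := by
  obtain ⟨R, hR, hRP⟩ := hP
  obtain ⟨G, hG, hGg⟩ := hg
  have hBall : IsSigma1 fun e : ℕ → M => ∀ b, b < e 0 → ∃ z, z = pair (e 1) b ∧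
      R (push z fun i => push b e (i + 1)) := by
    refine IsSigma1.ball (.var 0) (P := fun e => ∃ z, z = pair (e 2) (e 0) ∧
      R (push z fun i => e (i + 1))) ?_
    refine IsSigma1.ex (P := fun e => e 0 = pair (e 3) (e 1) ∧
      R (push (e 0) fun i => e (i + 2))) ?_
    refine ((IsDelta0.eq_pair 0 3 1).isSigma1.and
      (hR.rename (liftRename Nat.succ))).congr fun e => and_congr_right fun _ => ?_
    refine iff_of_eq (congrArg R ?_)
    funext i
    cases i <;> rfl
  refine ⟨_, (hG.and hBall).ex, fun a e => ?_⟩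
  constructor
  · intro h
    exact ⟨_, (hGg _ _ _).1 rfl, fun b hb => ⟨_, rfl, (hRP (a, b) _).1 (h b hb)⟩⟩
  · rintro ⟨n, hn, hR⟩ b hb
    obtain rfl := (hGg _ _ _).2 hn
    obtain ⟨z, hz, hRz⟩ := hR b hb
    obtain rfl : z = pair (enc a) b := hz
    exact (hRP (a, b) _).2 hRz

theorem Recursive.recEnum_graph {f : γ → δ} (hf : Recursive M f) :
    RecEnum M fun x : γ × δ => x.2 = f x.1 := by
  obtain ⟨G, hG, hGf⟩ := hf
  refine ⟨_, ((IsDelta0.eq_pair 2 1 0).isSigma1.and (hG.rename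
    (liftRename (liftRename Nat.succ)))).ex.ex, fun a e => ?_⟩
  simp only [push_liftRename]
  constructor
  · intro h
    exact ⟨enc a.1, enc a.2, rfl, (hGf _ _ _).1 (by rw [h])⟩
  · rintro ⟨x, y, hxy, hG⟩
    obtain ⟨rfl, rfl⟩ := pair_inj.1 (show pair (enc a.1) (enc a.2) = pair x y from hxy)
    exact enc_injective ((hGf _ _ _).2 hG)

theorem Recursive.of_graph {f : γ → δ} (hf : RecEnum M fun x : γ × δ => x.2 = f x.1) :
    Recursive M f := by
  obtain ⟨G, hG, hGf⟩ := hf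
  refine ⟨_, ((IsDelta0.eq_pair 0 2 1).isSigma1.and (((isDelta0_range (M := M)
    (γ := δ)).rename (fun i => i + 1)).isSigma1.and hG)).ex, fun a y e => ?_⟩
  constructor
  · rintro rfl
    exact ⟨_, rfl, ⟨_, rfl⟩, (hGf (a, f a) _).1 rfl⟩
  · rintro ⟨z, hz, ⟨b, hb⟩, hGz⟩
    obtain rfl : enc b = y := hb
    obtain rfl : z = pair (enc a) (enc b) := hz
    exact congrArg enc ((hGf (a, b) _).2 hGz)

theorem Recursive.recEnum {P : γ → Prop} (hP : Recursive M P) : RecEnum M P :=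
  (hP.recEnum_graph.comp (.prodMk .id (.const True))).congr fun a => by
    simp only [eq_comm (a := True), eq_iff_iff, iff_true]

theorem Recursive.recEnum_not {P : γ → Prop} (hP : Recursive M P) : RecEnum M fun a => ¬ P a :=
  (hP.recEnum_graph.comp (.prodMk .id (.const False))).congr fun a => by
    simp only [eq_comm (a := False), eq_iff_iff, iff_false]

theorem Recursive.of_recEnum {P : γ → Prop} (hP : RecEnum M P) (hNot : RecEnum M fun a => ¬ P a) :
    Recursive M P :=
  .of_graph <| (((recursive_snd.recEnum).and (hP.comp recursive_fst)).or
    ((recursive_snd.recEnum_not).and (hNot.comp recursive_fst))).congr fun ⟨a, p⟩ => by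
      by_cases hp : p <;> by_cases ha : P a <;> simp [hp, ha]

end Recursive

section RecursiveClosure

open Coded

variable {M : Type*} [L2Structure M] [hM : Fact (ModelsRCA0 M)] {γ δ : Type*} [Coded M γ]
  [Coded M δ]

namespace Recursive

theorem congr_iff {P Q : γ → Prop} (hP : Recursive M P) (h : ∀ a, Q a ↔ P a) : Recursive M Q := by
  rwa [show Q = P from funext fun a => propext (h a)]

@[fun_prop]
theorem not {P : γ → Prop} (hP : Recursive M P) : Recursive M fun a => ¬ P a :=
  .of_recEnum hP.recEnum_not (hP.recEnum.congr fun _ => not_not)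

@[fun_prop]
theorem and {P Q : γ → Prop} (hP : Recursive M P) (hQ : Recursive M Q) :
    Recursive M fun a => P a ∧ Q a :=
  .of_recEnum (hP.recEnum.and hQ.recEnum)
    ((hP.recEnum_not.or hQ.recEnum_not).congr fun _ => not_and_or)

@[fun_prop]
theorem or {P Q : γ → Prop} (hP : Recursive M P) (hQ : Recursive M Q) :
    Recursive M fun a => P a ∨ Q a :=
  .of_recEnum (hP.recEnum.or hQ.recEnum)
    ((hP.recEnum_not.and hQ.recEnum_not).congr fun _ => not_or)

theorem imp {P Q : γ → Prop} (hP : Recursive M P) (hQ : Recursive M Q) :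
    Recursive M fun a => P a → Q a :=
  (hP.not.or hQ).congr_iff fun _ => imp_iff_not_or

end Recursive

theorem IsDelta0.recEnum_uncurry {Q : (ℕ → M) → Prop} (hQ : IsDelta0 Q) {P : M → M → Prop}
    (h : ∀ x y e, Q (push x (push y e)) ↔ P x y) :
    RecEnum M fun a : γ × δ => P (enc a.1) (enc a.2) := by
  have hPair : IsDelta0 fun e : ℕ → M =>
      ∃ y, y < e 0 ∧ ∃ x, x < e 0 ∧ e 0 = pair x y ∧ Q (push x (push y e)) :=
    (((IsDelta0.eq_pair 2 0 1).and hQ).bex (.var 1)).bex (.var 0)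
  refine ⟨_, hPair.isSigma1, fun a e => ⟨fun ha => ?_, ?_⟩⟩
  · exact ⟨_, right_lt_pair _ _, _, left_lt_pair _ _, rfl, (h _ _ _).2 ha⟩
  · rintro ⟨y, -, x, -, hxy, hQ⟩
    obtain ⟨rfl, rfl⟩ := pair_inj.1 (show pair (enc a.1) (enc a.2) = pair x y from hxy)
    exact (h _ _ _).1 hQ

theorem recursive_eval_uncurry (t : NumTerm) {g : M → M → M}
    (h : ∀ x y e, t.eval (push x (push y e)) = g x y) :
    Recursive M fun a : M × M => g a.1 a.2 := by
  have hGraph : IsDelta0 fun e : ℕ → M => ∃ y, y < e 1 ∧ ∃ x, x < e 1 ∧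
      e 1 = pair x y ∧ e 0 = (t.rename (liftRename (liftRename Nat.succ))).eval
        (push x (push y e)) := by
    refine (((IsDelta0.eq_pair 3 0 1).and (.eq (.var 2)
      (t.rename (liftRename (liftRename Nat.succ))))).bex (.var 2)).bex (.var 1)
  refine ⟨_, hGraph.isSigma1, fun a z e => ?_⟩
  simp only [NumTerm.eval_rename, push_liftRename, h]
  constructor
  · intro hz
    exact ⟨a.2, right_lt_pair _ _, a.1, left_lt_pair _ _, rfl, hz⟩
  · rintro ⟨y, -, x, -, hxy, hz⟩
    obtain ⟨rfl, rfl⟩ := pair_inj.1 (show pair a.1 a.2 = pair x y from hxy)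
    exact hz

namespace Recursive

@[fun_prop]
theorem lt {f g : γ → M} (hf : Recursive M f) (hg : Recursive M g) :
    Recursive M fun a => f a < g a := by
  have h : Recursive M fun x : M × M => x.1 < x.2 :=
    .of_recEnum ((IsDelta0.lt (.var 0) (.var 1)).recEnum_uncurry fun _ _ _ => Iff.rfl)
      ((IsDelta0.lt (.var 0) (.var 1)).not.recEnum_uncurry (P := fun x y => ¬ x < y)
        fun _ _ _ => Iff.rfl)
  exact h.comp (hf.prodMk hg)

@[fun_prop]
theorem le {f g : γ → M} (hf : Recursive M f) (hg : Recursive M g) :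
    Recursive M fun a => f a ≤ g a :=
  (hg.lt hf).not.congr_iff fun _ => not_lt.symm

@[fun_prop]
theorem eq {f g : γ → δ} (hf : Recursive M f) (hg : Recursive M g) :
    Recursive M fun a => f a = g a := by
  have h : Recursive M fun x : δ × δ => enc (M := M) x.1 = enc x.2 :=
    .of_recEnum ((IsDelta0.eq (.var 0) (.var 1)).recEnum_uncurry fun _ _ _ => Iff.rfl)
      ((IsDelta0.eq (.var 0) (.var 1)).not.recEnum_uncurry (P := fun x y => ¬ x = y)
        fun _ _ _ => Iff.rfl)
  exact (h.comp (hf.prodMk hg)).congr_iff fun _ => enc_injective.eq_iff.symm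

@[fun_prop]
theorem ne {f g : γ → δ} (hf : Recursive M f) (hg : Recursive M g) :
    Recursive M fun a => f a ≠ g a :=
  (hf.eq hg).not

@[fun_prop]
theorem add {f g : γ → M} (hf : Recursive M f) (hg : Recursive M g) :
    Recursive M fun a => f a + g a :=
  (recursive_eval_uncurry (.add (.var 0) (.var 1)) fun _ _ _ => rfl).comp (hf.prodMk hg)

@[fun_prop]
theorem mul {f g : γ → M} (hf : Recursive M f) (hg : Recursive M g) :
    Recursive M fun a => f a * g a :=
  (recursive_eval_uncurry (.mul (.var 0) (.var 1)) fun _ _ _ => rfl).comp (hf.prodMk hg)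

@[fun_prop]
theorem pair {f g : γ → M} (hf : Recursive M f) (hg : Recursive M g) :
    Recursive M fun a => pair (f a) (g a) := by
  unfold RevMath.pair
  fun_prop

theorem ball {P : γ → M → Prop} {g : γ → M} (hg : Recursive M g)
    (hP : Recursive M fun x : γ × M => P x.1 x.2) : Recursive M fun a => ∀ b < g a, P a b := by
  have hlt : Recursive M fun x : γ × M => x.2 < g x.1 := by fun_prop
  exact .of_recEnum (.ball hg hP.recEnum) ((RecEnum.ex (P := fun a b => b < g a ∧ ¬ P a b)
    (hlt.recEnum.and hP.recEnum_not)).congr fun a => by simp only [not_forall, exists_prop])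

theorem bex {P : γ → M → Prop} {g : γ → M} (hg : Recursive M g)
    (hP : Recursive M fun x : γ × M => P x.1 x.2) : Recursive M fun a => ∃ b < g a, P a b :=
  (ball (P := fun a b => ¬ P a b) hg hP.not).not.congr_iff fun a => by
    simp only [not_forall, not_not, exists_prop]

theorem mem {X : Set M} (hX : X ∈ sets M) : Recursive M fun n : M => n ∈ X :=
  .of_recEnum ⟨_, (IsDelta0.mem (.var 0) hX).isSigma1, fun _ _ => Iff.rfl⟩
    ⟨_, (IsDelta0.mem (.var 0) hX).not.isSigma1, fun _ _ => Iff.rfl⟩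

theorem setOf_mem {P : M → Prop} (hP : Recursive M P) : {n | P n} ∈ sets M := by
  obtain ⟨Q, hQ, hPQ⟩ := hP.recEnum
  obtain ⟨R, hR, hPR⟩ := hP.recEnum_not
  exact setOf_mem_sets hQ hR hPQ hPR

@[fun_prop]
theorem ite {P : γ → Prop} [∀ a, Decidable (P a)] {f g : γ → δ} (hP : Recursive M P)
    (hf : Recursive M f) (hg : Recursive M g) :
    Recursive M fun a => if P a then f a else g a :=
  .of_graph <| (((hP.recEnum.comp recursive_fst).and hf.recEnum_graph).or
    ((hP.recEnum_not.comp recursive_fst).and hg.recEnum_graph)).congr fun a => by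
      by_cases h : P a.1 <;> simp [h]

end Recursive

theorem RecEnum.induction {P : M → Prop} (hP : RecEnum M P) (zero : P 0)
    (succ : ∀ n, P n → P (n + 1)) (n : M) : P n := by
  obtain ⟨Q, hQ, hPQ⟩ := hP
  have hPQ₀ (n : M) := hPQ n fun _ => 0
  simp only [hPQ₀] at zero succ ⊢
  exact hQ.induction _ zero succ n

namespace Recursive

/-- Induction for `Π⁰₁` predicates: a counterexample at `n` would by `Σ⁰₁` induction on `i` yield
counterexamples at all `n - i`. -/
theorem pi1_induction {P : M → γ → Prop} (hP : Recursive M fun x : M × γ => P x.1 x.2)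
    (zero : ∀ a, P 0 a) (succ : ∀ n, (∀ a, P n a) → ∀ a, P (n + 1) a) (n : M) (a : γ) :
    P n a := by
  by_contra hn
  have descent : ∀ i, ∃ m a, ¬ P m a ∧ (m + i = n ∨ n < i) := by
    refine RecEnum.induction (.ex (P := fun i m => ∃ a, ¬ P m a ∧ (m + i = n ∨ n < i))
      (.ex (P := fun (x : M × M) a => ¬ P x.2 a ∧ (x.2 + x.1 = n ∨ n < x.1)) (recEnum ?_)))
      ⟨n, a, hn, Or.inl (add_zero n)⟩ ?_
    · exact .and (.not (hP.comp (f := fun x : (M × M) × γ => (x.1.2, x.2)) (by fun_prop)))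
        (by fun_prop)
    · rintro i ⟨m, b, hb, hmi⟩
      obtain ⟨k, rfl⟩ := exists_eq_add_one_of_ne_zero fun h : m = 0 => hb (h ▸ zero b)
      obtain ⟨c, hc⟩ : ∃ c, ¬ P k c := by
        by_contra! hk
        exact hb (succ k hk b)
      refine ⟨k, c, hc, hmi.imp (fun h => ?_) fun h => h.trans (Order.lt_add_one_iff.2 le_rfl)⟩
      rw [← h, add_right_comm, add_assoc]
  obtain ⟨m, b, hb, h | h⟩ := descent n
  · exact hb (add_eq_right.1 h ▸ zero b)
  · exact lt_irrefl _ h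

theorem measure_induction {P : γ → Prop} (hP : Recursive M P) {μ : γ → M} (hμ : Recursive M μ)
    (step : ∀ a, (∀ b, μ b < μ a → P b) → P a) (a : γ) : P a := by
  have below := pi1_induction (M := M) (P := fun n a => μ a < n → P a)
    (.imp (by fun_prop) (by fun_prop)) (fun _ h => (not_lt_zero h).elim)
    (fun n ih a ha => step a fun b hb => ih b (hb.trans_le (Order.lt_add_one_iff.1 ha)))
  exact below _ a (Order.lt_add_one_iff.2 le_rfl)

theorem strong_induction {P : M → Prop} (hP : Recursive M P)
    (step : ∀ n, (∀ m < n, P m) → P n) (n : M) : P n :=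
  hP.measure_induction .id step n

theorem exists_least {P : M → Prop} (hP : Recursive M P) (h : ∃ n, P n) :
    ∃ n, P n ∧ ∀ m < n, ¬ P m := by
  by_contra! hNoLeast
  obtain ⟨n, hn⟩ := h
  refine hP.not.strong_induction (fun n ih hn => ?_) n hn
  obtain ⟨m, hmn, hm⟩ := hNoLeast n hn
  exact ih m hmn hm

theorem exists_choice {P : γ → M → Prop} (hP : Recursive M fun x : γ × M => P x.1 x.2)
    (h : ∀ a, ∃ n, P a n) : ∃ f : γ → M, Recursive M f ∧ ∀ a, P a (f a) := by
  have hLeast (a : γ) := exists_least (hP.comp (f := fun n => (a, n)) (by fun_prop)) (h a)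
  choose f hf hmin using hLeast
  refine ⟨f, .of_graph ?_, hf⟩
  have hGraph : Recursive M fun x : γ × M => P x.1 x.2 ∧ ∀ m < x.2, ¬ P x.1 m :=
    hP.and (.ball (by fun_prop) (.not (hP.comp (f := fun x : (γ × M) × M => (x.1.1, x.2))
      (by fun_prop))))
  refine hGraph.recEnum.congr fun ⟨a, n⟩ => ⟨?_, ?_⟩
  · rintro (rfl : n = f a)
    exact ⟨hf a, hmin a⟩
  · rintro ⟨hn, hlt⟩
    exact le_antisymm (not_lt.1 fun h => hlt _ h (hf a)) (not_lt.1 fun h => hmin a n h hn)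

end Recursive

end RecursiveClosure

/-! ### The `β` function and course-of-values recursion -/

section Decoding

open Coded

variable {M : Type*} [L2Structure M]

/-- The element with a given code, and a junk value for numbers that are not codes. -/
noncomputable def dec {γ : Type*} [Coded M γ] [Nonempty γ] : M → γ :=
  Function.invFun enc

/-- The first component of the pair coded by a number. -/
noncomputable def left [Fact (ModelsRCA0 M)] (n : M) : M := (dec n : M × M).1

/-- The second component of the pair coded by a number. -/
noncomputable def right [Fact (ModelsRCA0 M)] (n : M) : M := (dec n : M × M).2

variable {γ δ : Type*} [Coded M γ] [Coded M δ]

@[simp]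
theorem dec_enc [Nonempty γ] (a : γ) : dec (enc a : M) = a :=
  Function.leftInverse_invFun enc_injective a

variable [hM : Fact (ModelsRCA0 M)]

@[simp]
theorem left_pair (a b : M) : left (pair a b) = a :=
  congrArg Prod.fst (dec_enc (M := M) (a, b))

@[simp]
theorem right_pair (a b : M) : right (pair a b) = b :=
  congrArg Prod.snd (dec_enc (M := M) (a, b))

namespace Recursive

@[fun_prop]
theorem enc {f : γ → δ} (hf : Recursive M f) : Recursive M fun a => (enc (f a) : M) := by
  have h : Recursive M fun b : δ => (Coded.enc b : M) :=
    ⟨_, (IsDelta0.eq (.var 0) (.var 1)).isSigma1, fun _ _ _ => Iff.rfl⟩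
  exact h.comp hf

@[fun_prop]
theorem dec [Nonempty δ] {f : γ → M} (hf : Recursive M f) :
    Recursive M fun a => (dec (f a) : δ) := by
  have hRange : Recursive M fun n : M => ∃ b : δ, Coded.enc b = n :=
    .of_recEnum ⟨_, isDelta0_range.isSigma1, fun _ _ => Iff.rfl⟩
      ⟨_, isDelta0_range.not.isSigma1, fun _ _ => Iff.rfl⟩
  have hGraph : Recursive M fun x : M × δ => Coded.enc x.2 = x.1 ∨
      (¬ ∃ b : δ, Coded.enc b = x.1) ∧ x.2 = Classical.arbitrary δ :=
    .or (by fun_prop) (.and (hRange.comp recursive_fst).not (by fun_prop))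
  have h : Recursive M (RevMath.dec : M → δ) := .of_graph <| hGraph.recEnum.congr fun ⟨n, b⟩ => by
    by_cases hn : ∃ b : δ, Coded.enc b = n
    · obtain ⟨c, rfl⟩ := hn
      simp only [dec_enc, enc_injective.eq_iff, exists_eq, not_true, false_and, or_false]
    · simp only [hn, not_false_eq_true, true_and, RevMath.dec, Function.invFun, dite_false]
      exact ⟨Or.inr, fun h => h.resolve_left fun h => hn ⟨b, h⟩⟩
  exact h.comp hf

@[fun_prop]
theorem left {f : γ → M} (hf : Recursive M f) : Recursive M fun a => left (f a) :=
  recursive_fst.comp (dec hf)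

@[fun_prop]
theorem right {f : γ → M} (hf : Recursive M f) : Recursive M fun a => right (f a) :=
  recursive_snd.comp (dec hf)

end Recursive

end Decoding

section Beta

variable {M : Type*} [L2Structure M] [hM : Fact (ModelsRCA0 M)] {γ : Type*} [Coded M γ]

theorem exists_div_rem {m : M} (hm : 0 < m) (n : M) : ∃ r < m, ∃ q < n + 1, n = q * m + r := by
  refine RecEnum.induction (P := fun n => ∃ r < m, ∃ q < n + 1, n = q * m + r)
    (Recursive.bex (by fun_prop) (.bex (by fun_prop) (by fun_prop))).recEnum ?_ ?_ n
  · exact ⟨0, hm, 0, Order.lt_add_one_iff.2 le_rfl, by ring⟩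
  · rintro n ⟨r, hr, q, hq, h⟩
    rcases (Order.add_one_le_iff.2 hr).lt_or_eq with hr | hr
    · exact ⟨r + 1, hr, q, hq.trans (Order.lt_add_one_iff.2 le_rfl), by rw [h]; ring⟩
    · exact ⟨0, hm, q + 1, add_lt_add_left hq 1, by rw [h, ← hr]; ring⟩

theorem le_of_mul_add_eq_mul_add {q q' m r r' : M} (h : q * m + r = q' * m + r') (hr : r < m) :
    q' ≤ q := by
  by_contra! hq
  refine h.not_lt ?_
  calc q * m + r < q * m + m := by gcongr
    _ = (q + 1) * m := by ring
    _ ≤ q' * m := by gcongr; exact Order.add_one_le_iff.2 hq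
    _ ≤ q' * m + r' := le_self_add

theorem eq_of_mul_add_eq_mul_add {q q' m r r' : M} (h : q * m + r = q' * m + r') (hr : r < m)
    (hr' : r' < m) : r = r' := by
  obtain rfl := le_antisymm (le_of_mul_add_eq_mul_add h.symm hr') (le_of_mul_add_eq_mul_add h hr)
  exact add_left_cancel h

theorem exists_rem : ∃ f : M × M → M, Recursive M f ∧ ∀ q m r, r < m → f (q * m + r, m) = r := by
  obtain ⟨f, hf, h⟩ := Recursive.exists_choice (M := M) (γ := M × M)
    (P := fun x r => 0 < x.2 → r < x.2 ∧ ∃ q < x.1 + 1, x.1 = q * x.2 + r)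
    (.imp (by fun_prop) (.and (by fun_prop) (.bex (by fun_prop) (by fun_prop))))
    (fun x => by
      by_cases hx : 0 < x.2
      · exact (exists_div_rem hx x.1).imp fun r hr _ => hr
      · exact ⟨0, fun h => absurd h hx⟩)
  refine ⟨f, hf, fun q m r hr => ?_⟩
  obtain ⟨hlt, q', -, hq'⟩ := h (q * m + r, m) (zero_le.trans_lt hr)
  exact (eq_of_mul_add_eq_mul_add hq' hr hlt).symm

/-- The moduli of Gödel's `β` function. -/
def modulus (b i : M) : M := (i + 1) * b + 1

/-- Gödel's `β` function: `beta c i` is entry `i` of the finite sequence coded by `c`. -/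
noncomputable def beta (c i : M) : M := exists_rem.choose (left c, modulus (right c) i)

@[fun_prop]
theorem Recursive.beta {f g : γ → M} (hf : Recursive M f) (hg : Recursive M g) :
    Recursive M fun a => beta (f a) (g a) := by
  unfold RevMath.beta modulus
  exact exists_rem.choose_spec.1.comp (by fun_prop)

theorem beta_pair {b i q r : M} (hr : r < modulus b i) :
    beta (pair (q * modulus b i + r) b) i = r := by
  simp only [beta, left_pair, right_pair]
  exact exists_rem.choose_spec.2 q _ r hr

theorem exists_upper_bound {x : M → M} (hx : Recursive M x) (n : M) : ∃ B, ∀ i < n, x i < B := by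
  refine RecEnum.induction (P := fun n => ∃ B, ∀ i < n, x i < B) (.ex (.ball (by fun_prop)
    (Recursive.recEnum (by fun_prop)))) ⟨0, fun i hi => (not_lt_zero hi).elim⟩ ?_ n
  rintro n ⟨B, hB⟩
  refine ⟨max B (x n + 1), fun i hi => ?_⟩
  rcases (Order.lt_add_one_iff.1 hi).lt_or_eq with h | rfl
  · exact (hB i h).trans_le (le_max_left _ _)
  · exact (Order.lt_add_one_iff.2 le_rfl).trans_le (le_max_right _ _)

theorem RecEnum.dvd {f g : γ → M} (hf : Recursive M f) (hg : Recursive M g) :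
    RecEnum M fun a => f a ∣ g a :=
  RecEnum.ex (P := fun a e => g a = f a * e) (Recursive.recEnum (by fun_prop))

theorem exists_common_multiple (n : M) : ∃ L : M, L ≠ 0 ∧ ∀ i < n, i + 1 ∣ L := by
  refine RecEnum.induction (P := fun n : M => ∃ L : M, L ≠ 0 ∧ ∀ i < n, i + 1 ∣ L)
    (.ex (.and (Recursive.recEnum (by fun_prop)) (.ball (by fun_prop)
      (.dvd (by fun_prop) (by fun_prop))))) ⟨1, one_ne_zero, fun i hi => (not_lt_zero hi).elim⟩ ?_ n
  rintro n ⟨L, hL, h⟩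
  refine ⟨L * (n + 1), mul_ne_zero hL (hM.out.succ_ne_zero n), fun i hi => ?_⟩
  rcases (Order.lt_add_one_iff.1 hi).lt_or_eq with hi | rfl
  · exact (h i hi).mul_right _
  · exact dvd_mul_left _ _

/-- `P` is invertible modulo `m`, stated without subtraction. -/
def InvertibleMod (m P : M) : Prop := ∃ u v, u * P = v * m + 1

theorem RecEnum.invertibleMod {f g : γ → M} (hf : Recursive M f) (hg : Recursive M g) :
    RecEnum M fun a => InvertibleMod (f a) (g a) :=
  RecEnum.ex (P := fun a u => ∃ v, u * g a = v * f a + 1)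
    (.ex (P := fun (x : γ × M) v => x.2 * g x.1 = v * f x.1 + 1) (Recursive.recEnum (by fun_prop)))

theorem InvertibleMod.mul {m P Q : M} (hP : InvertibleMod m P) (hQ : InvertibleMod m Q) :
    InvertibleMod m (P * Q) := by
  obtain ⟨u, v, hP⟩ := hP
  obtain ⟨u', v', hQ⟩ := hQ
  refine ⟨u * u', v * v' * m + v + v', ?_⟩
  calc u * u' * (P * Q) = (u * P) * (u' * Q) := by ring
    _ = (v * v' * m + v + v') * m + 1 := by rw [hP, hQ]; ring

theorem InvertibleMod.exists_add_mul_eq {c P : M} (h : InvertibleMod (c + 1) P) (a x : M) :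
    ∃ t q, a + t * P = q * (c + 1) + x := by
  obtain ⟨u, v, h⟩ := h
  refine ⟨u * (x + c * a), v * (x + c * a) + a, ?_⟩
  calc a + u * (x + c * a) * P = a + (x + c * a) * (u * P) := by ring
    _ = (v * (x + c * a) + a) * (c + 1) + x := by rw [h]; ring

theorem InvertibleMod.of_mul_add_one_eq {w P z c : M}
    (h : w * P + 1 = (z + 1) * (c + 1 + 1)) : InvertibleMod (c + 1 + 1) P := by
  refine ⟨w * (c + 1), z * (c + 1) + c, add_right_cancel (b := c + 1) ?_⟩
  calc w * (c + 1) * P + (c + 1) = (w * P + 1) * (c + 1) := by ring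
    _ = (z * (c + 1) + c) * (c + 1 + 1) + 1 + (c + 1) := by rw [h]; ring

theorem InvertibleMod.modulus {b d : M} (hb : b ≠ 0) (hd : d ∣ b) (i : M) :
    InvertibleMod (modulus b (i + d)) (modulus b i) := by
  obtain ⟨e, he⟩ := hd
  obtain ⟨c, hc⟩ := exists_eq_add_one_of_ne_zero hb
  have hm : RevMath.modulus b (i + d) = (i + d) * b + c + 1 + 1 := by
    conv_rhs => rw [add_assoc _ c, ← hc]
    unfold RevMath.modulus
    ring
  rw [hm]
  refine .of_mul_add_one_eq (w := e * (i + d + 1) * (i + d + 1))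
    (z := e * (i + 1) * (i + d + 1)) ?_
  rw [← hm]
  unfold RevMath.modulus
  calc _ = e * (i + d + 1) * (i + d + 1) * (i + 1) * b + e * (i + d + 1) * (i + 1)
        + (i + d + 1) * (d * e) + 1 := by ring
    _ = _ := by rw [← he]; ring

theorem exists_solution_succ {b a P k : M} {x : M → M}
    (ha : ∀ i < k, ∃ q, a = q * modulus b i + x i)
    (hP : ∀ i < k, modulus b i ∣ P) (hk : InvertibleMod (modulus b k) P) :
    ∃ a', ∀ i < k + 1, ∃ q, a' = q * modulus b i + x i := by
  obtain ⟨t, q, hq⟩ := hk.exists_add_mul_eq a (x k)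
  refine ⟨a + t * P, fun i hi => ?_⟩
  rcases (Order.lt_add_one_iff.1 hi).lt_or_eq with hi | rfl
  · obtain ⟨q, hq⟩ := ha i hi
    obtain ⟨p, hp⟩ := hP i hi
    refine ⟨q + t * p, ?_⟩
    calc a + t * P = q * modulus b i + x i + t * (modulus b i * p) := by
          rw [← hq, ← hp]
      _ = _ := by ring
  · exact ⟨q, hq⟩

theorem exists_product_of_moduli {b n : M} (hb : b ≠ 0) (hn : ∀ i < n, i + 1 ∣ b) (k : M) :
    ∃ P, (∀ i < k, modulus b i ∣ P) ∧ ∀ j < n, j < k ∨ InvertibleMod (modulus b j) P := by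
  have hmod : Recursive M (modulus b) := by
    unfold modulus
    fun_prop
  refine RecEnum.induction (P := fun k => ∃ P, (∀ i < k, modulus b i ∣ P) ∧
    ∀ j < n, j < k ∨ InvertibleMod (modulus b j) P) ?_ ?_ ?_ k
  · exact .ex (.and (.ball (by fun_prop) (.dvd (by fun_prop) (by fun_prop)))
      (.ball (by fun_prop) (.or (Recursive.recEnum (by fun_prop))
        (.invertibleMod (by fun_prop) (by fun_prop)))))
  · exact ⟨1, fun i hi => (not_lt_zero hi).elim, fun j _ => Or.inr ⟨1, 0, by ring⟩⟩
  · rintro k ⟨P, hdvd, hinv⟩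
    refine ⟨P * modulus b k, fun i hi => ?_, fun j hj => ?_⟩
    · rcases (Order.lt_add_one_iff.1 hi).lt_or_eq with hi | rfl
      · exact (hdvd i hi).mul_right _
      · exact dvd_mul_left _ _
    · rcases lt_trichotomy j k with hjk | rfl | hkj
      · exact Or.inl (hjk.trans (Order.lt_add_one_iff.2 le_rfl))
      · exact Or.inl (Order.lt_add_one_iff.2 le_rfl)
      · refine Or.inr (((hinv j hj).resolve_left hkj.not_gt).mul ?_)
        obtain ⟨d, rfl⟩ := lt_iff_exists_eq_add_succ.1 hkj
        have hd : d < n := by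
          refine lt_of_le_of_lt ?_ hj
          rw [add_right_comm]
          exact le_add_self
        exact add_assoc k d 1 ▸ .modulus hb (hn d hd) k

theorem exists_chinese_remainder {x : M → M} (hx : Recursive M x) {b n : M} (hb : b ≠ 0)
    (hn : ∀ i < n, i + 1 ∣ b) : ∃ a, ∀ i < n, ∃ q, a = q * modulus b i + x i := by
  have hmod : Recursive M (modulus b) := by
    unfold modulus
    fun_prop
  have solvable (k : M) : n < k ∨ ∃ a, ∀ i < k, ∃ q, a = q * modulus b i + x i := by
    refine RecEnum.induction (P := fun k => n < k ∨ ∃ a, ∀ i < k, ∃ q, a = q * modulus b i + x i)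
      ?_ (Or.inr ⟨0, fun i hi => (not_lt_zero hi).elim⟩) ?_ k
    · exact .or (Recursive.recEnum (by fun_prop))
        (.ex (.ball (by fun_prop) (.ex (Recursive.recEnum (by fun_prop)))))
    · intro k ih
      rcases lt_or_ge k n with hk | hk
      · obtain ⟨a, ha⟩ := ih.resolve_left hk.not_gt
        obtain ⟨P, hdvd, hinv⟩ := exists_product_of_moduli hb hn k
        exact Or.inr (exists_solution_succ ha hdvd ((hinv k hk).resolve_left (lt_irrefl k)))
      · exact Or.inl (Order.lt_add_one_iff.2 hk)
  exact (solvable n).resolve_left (lt_irrefl n)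

theorem exists_beta_eq {x : M → M} (hx : Recursive M x) (n : M) : ∃ c, ∀ i < n, beta c i = x i := by
  obtain ⟨B, hB⟩ := exists_upper_bound hx n
  obtain ⟨L, hL, hdvd⟩ := exists_common_multiple n
  have hb : L * (B + 1) ≠ 0 := mul_ne_zero hL (hM.out.succ_ne_zero B)
  obtain ⟨a, ha⟩ := exists_chinese_remainder hx hb fun i hi => (hdvd i hi).mul_right (B + 1)
  refine ⟨pair a (L * (B + 1)), fun i hi => ?_⟩
  obtain ⟨q, hq⟩ := ha i hi
  rw [hq]
  refine beta_pair ?_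
  calc x i < B := hB i hi
    _ ≤ 1 * (1 * (B + 1)) := by rw [one_mul, one_mul]; exact le_self_add
    _ ≤ (i + 1) * (L * (B + 1)) := by
        gcongr
        · exact le_add_self
        · exact Order.one_le_iff_pos.2 (pos_iff_ne_zero.2 hL)
    _ ≤ modulus (L * (B + 1)) i := le_self_add

open Classical in
theorem exists_append : ∃ f : M × M × M → M, Recursive M f ∧ ∀ c n y,
    (∀ i < n, beta (f (c, n, y)) i = beta c i) ∧ beta (f (c, n, y)) n = y := by
  obtain ⟨f, hf, h⟩ := Recursive.exists_choice (M := M) (γ := M × M × M)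
    (P := fun x c => (∀ i < x.2.1, beta c i = beta x.1 i) ∧ beta c x.2.1 = x.2.2)
    (.and (.ball (by fun_prop) (by fun_prop)) (by fun_prop)) (fun ⟨c, n, y⟩ => by
      obtain ⟨c', hc'⟩ := exists_beta_eq (M := M) (x := fun i => if i = n then y else beta c i)
        (by fun_prop) (n + 1)
      have hn : n < n + 1 := Order.lt_add_one_iff.2 le_rfl
      exact ⟨c', fun i hi => by rw [hc' i (hi.trans hn), if_neg hi.ne],
        by rw [hc' n hn, if_pos rfl]⟩)
  exact ⟨f, hf, fun c n y => h (c, n, y)⟩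

end Beta

section CourseOfValues

open Coded

variable {M : Type*} [L2Structure M] [hM : Fact (ModelsRCA0 M)] {γ δ ε : Type*} [Coded M γ]
  [Coded M δ] [Coded M ε]

theorem exists_primitive_recursion (a : M) {s : M × M → M} (hs : Recursive M s) :
    ∃ f : M → M, Recursive M f ∧ f 0 = a ∧ ∀ n, f (n + 1) = s (n, f n) := by
  let IsTable (n c : M) : Prop := beta c 0 = a ∧ ∀ i < n, beta c (i + 1) = s (i, beta c i)
  have hTable : Recursive M fun x : M × M => IsTable x.1 x.2 :=
    .and (by fun_prop) (.ball (by fun_prop) (by fun_prop))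
  obtain ⟨append, -, happend⟩ := exists_append (M := M)
  have exists_table (n : M) : ∃ c, IsTable n c := by
    refine RecEnum.induction (.ex hTable.recEnum) ?_ ?_ n
    · exact ⟨append (0, 0, a), (happend _ _ _).2, fun i hi => (not_lt_zero hi).elim⟩
    · rintro n ⟨c, h0, hs⟩
      obtain ⟨hlt, heq⟩ := happend c (n + 1) (s (n, beta c n))
      refine ⟨append (c, n + 1, s (n, beta c n)), ?_, fun i hi => ?_⟩
      · rw [hlt 0 (Order.lt_add_one_iff.2 zero_le), h0]
      · rcases (Order.lt_add_one_iff.1 hi).lt_or_eq with h | rfl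
        · rw [hlt _ (add_lt_add_left h 1), hlt i hi, hs i h]
        · rw [heq, hlt i hi]
  have table_unique {n n' c c' : M} (h : IsTable n c) (h' : IsTable n' c') (i : M) :
      i ≤ n → i ≤ n' → beta c i = beta c' i := by
    refine RecEnum.induction (P := fun i => i ≤ n → i ≤ n' → beta c i = beta c' i)
      (Recursive.imp (by fun_prop) (.imp (by fun_prop) (by fun_prop))).recEnum
      (fun _ _ => h.1.trans h'.1.symm) (fun i ih hi hi' => ?_) i
    have hi := Order.add_one_le_iff.1 hi
    have hi' := Order.add_one_le_iff.1 hi'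
    rw [h.2 i hi, h'.2 i hi', ih hi.le hi'.le]
  obtain ⟨table, htable, hspec⟩ := hTable.exists_choice exists_table
  refine ⟨fun n => beta (table n) n, by fun_prop, (hspec 0).1, fun n => ?_⟩
  have hn : n < n + 1 := Order.lt_add_one_iff.2 le_rfl
  dsimp only
  rw [(hspec (n + 1)).2 n hn, table_unique (hspec (n + 1)) (hspec n) n hn.le le_rfl]

/-- The value at `a` stored in the table coded by `c`. -/
noncomputable def lookup [Nonempty δ] (c : M) (a : γ) : δ := dec (beta c (enc a))

@[fun_prop]
theorem Recursive.lookup [Nonempty δ] {c : ε → M} {f : ε → γ} (hc : Recursive M c)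
    (hf : Recursive M f) : Recursive M fun a => (lookup (c a) (f a) : δ) := by
  unfold RevMath.lookup
  fun_prop

/-- Recursion along the codes: `F` computes the value at `a` from a table of the values at all
elements with smaller codes. -/
theorem exists_course_of_values_recursion [Nonempty γ] [Nonempty δ] {F : M × γ → δ}
    (hF : Recursive M F) : ∃ f : γ → δ, Recursive M f ∧
      ∀ a, ∃ c : M, f a = F (c, a) ∧ ∀ b, (enc b : M) < enc a → lookup c b = f b := by
  obtain ⟨append, happend_rec, happend⟩ := exists_append (M := M)
  obtain ⟨table, htable, -, hsucc⟩ := exists_primitive_recursion (M := M) 0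
    (s := fun x => append (x.2, x.1, enc (F (x.2, dec x.1)))) (by fun_prop)
  have beta_table (n : M) : ∀ m < n, beta (table n) m = enc (F (table m, dec m)) := by
    refine RecEnum.induction (P := fun n => ∀ m < n,
      beta (table n) m = enc (F (table m, dec m))) (.ball (by fun_prop)
        (Recursive.recEnum (by fun_prop))) (fun m hm => (not_lt_zero hm).elim) ?_ n
    intro n ih m hm
    rw [hsucc]
    rcases (Order.lt_add_one_iff.1 hm).lt_or_eq with h | rfl
    · rw [(happend _ _ _).1 m h, ih m h]
    · rw [(happend _ _ _).2]
  refine ⟨fun a => F (table (enc a), a), by fun_prop, fun a => ⟨_, rfl, fun b hb => ?_⟩⟩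
  rw [lookup, beta_table _ _ hb, dec_enc, dec_enc]

theorem exists_recursion_on_sum [Nonempty δ] {F : M × M × M → δ} (hF : Recursive M F) :
    ∃ f : M × M → δ, Recursive M f ∧ ∀ a b, ∃ c : M, f (a, b) = F (c, a, b) ∧
      ∀ x y, x + y < a + b → lookup c (x, y) = f (x, y) := by
  obtain ⟨f, hf, h⟩ := exists_course_of_values_recursion hF
  refine ⟨f, hf, fun a b => ?_⟩
  obtain ⟨c, hc, htable⟩ := h (a, b)
  exact ⟨c, hc, fun x y hxy => htable (x, y) (pair_lt_pair hxy)⟩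

end CourseOfValues

section Relations

variable {M : Type*} [L2Structure M] [hM : Fact (ModelsRCA0 M)]

/-- The set coding a relation. -/
def relSet (P : M → M → Prop) : Set M := {n | n = pair (left n) (right n) ∧ P (left n) (right n)}

@[simp]
theorem rel_relSet {P : M → M → Prop} {a b : M} : Rel (relSet P) a b ↔ P a b := by
  simp [Rel, relSet]

theorem relSet_mem {P : M → M → Prop} (hP : Recursive M fun x : M × M => P x.1 x.2) :
    relSet P ∈ sets M :=
  Recursive.setOf_mem (by fun_prop)

theorem recursive_rel {R : Set M} (hR : R ∈ sets M) : Recursive M fun x : M × M => Rel R x.1 x.2 :=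
  (Recursive.mem hR).comp (by fun_prop)

theorem recursive_sRel {R : Set M} (hR : R ∈ sets M) :
    Recursive M fun x : M × M => SRel R x.1 x.2 := by
  have := recursive_rel hR
  unfold SRel
  fun_prop

end Relations

/-! ### Existence of the notation system and of the leaf-labelled trees -/

section Existence

open Coded

variable {M : Type*} [L2Structure M]

@[simp]
theorem right_epsC [Fact (ModelsRCA0 M)] (α : M) : right (epsC α) = α := right_pair _ _

theorem seqC_inj [Fact (ModelsRCA0 M)] {k l : M} : seqC k = seqC l ↔ k = l := by
  simp only [seqC, pair_inj, true_and]

variable [hM : Fact (ModelsRCA0 M)] {γ : Type*} [Coded M γ]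

namespace Recursive

theorem ex_pair {P : γ → M → M → Prop} {f : γ → M} (hf : Recursive M f)
    (hP : Recursive M fun x : γ × M × M => P x.1 x.2.1 x.2.2) :
    Recursive M fun a => ∃ s t, f a = RevMath.pair s t ∧ P a s t := by
  have h : Recursive M fun a => ∃ s < f a, ∃ t < f a, f a = RevMath.pair s t ∧ P a s t :=
    .bex hf (.bex (by fun_prop) (.and (by fun_prop)
      (hP.comp (f := fun x : (γ × M) × M => (x.1.1, x.1.2, x.2)) (by fun_prop))))
  refine h.congr_iff fun a => ⟨?_, fun ⟨s, _, t, _, h⟩ => ⟨s, t, h⟩⟩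
  rintro ⟨s, t, hst, h⟩
  exact ⟨s, hst ▸ left_lt_pair s t, t, hst ▸ right_lt_pair s t, hst, h⟩

@[fun_prop]
theorem epsC {f : γ → M} (hf : Recursive M f) : Recursive M fun a => epsC (f a) := by
  unfold RevMath.epsC
  fun_prop

@[fun_prop]
theorem seqC {f : γ → M} (hf : Recursive M f) : Recursive M fun a => seqC (f a) := by
  unfold RevMath.seqC
  fun_prop

@[fun_prop]
theorem labelOf {f : γ → M} (hf : Recursive M f) : Recursive M fun a => labelOf (f a) := by
  unfold RevMath.labelOf
  fun_prop

@[fun_prop]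
theorem leafC {f : γ → M} (hf : Recursive M f) : Recursive M fun a => leafC (f a) := by
  unfold RevMath.leafC
  fun_prop

@[fun_prop]
theorem nodeC {f : γ → M} (hf : Recursive M f) : Recursive M fun a => nodeC (f a) := by
  unfold RevMath.nodeC
  fun_prop

end Recursive

/-- Simultaneous recursive definition of a class of terms and of the lists of these terms. A term
is an element of `C` or codes, with a tag, a list in `S`; in a list `t :: ℓ` the entry `t` has to
be related by `D` to the rest `ℓ`. -/
theorem exists_terms_lists {C S : M → Prop} {D : M → M → Prop} (hC : Recursive M C)
    (hS : Recursive M S) (hD : Recursive M fun x : M × M => D x.1 x.2) (tag : M) :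
    ∃ T L : M → Prop, Recursive M T ∧ Recursive M L ∧
      (∀ n, T n ↔ C n ∨ ∃ ℓ, n = pair tag ℓ ∧ L ℓ ∧ S ℓ) ∧
      ∀ n, L n ↔ n = 0 ∨ ∃ t ℓ, n = pair t ℓ ∧ T t ∧ L ℓ ∧ D t ℓ := by
  obtain ⟨f, hf, hspec⟩ := exists_course_of_values_recursion (M := M) (γ := M) (δ := Prop × Prop)
    (F := fun x => (C x.2 ∨ ∃ s ℓ, x.2 = pair s ℓ ∧ s = tag ∧ (lookup x.1 ℓ : Prop × Prop).2 ∧ S ℓ,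
      x.2 = 0 ∨ ∃ t ℓ, x.2 = pair t ℓ ∧ (lookup x.1 t : Prop × Prop).1 ∧
        (lookup x.1 ℓ : Prop × Prop).2 ∧ D t ℓ))
    (.prodMk (.or (by fun_prop) (.ex_pair (by fun_prop) (by fun_prop)))
      (.or (by fun_prop) (.ex_pair (by fun_prop) (by fun_prop))))
  refine ⟨fun n => (f n).1, fun n => (f n).2, by fun_prop, by fun_prop, fun n => ?_, fun n => ?_⟩
  · obtain ⟨c, h, hc⟩ := hspec n
    simp only [h]
    refine or_congr_right ⟨?_, ?_⟩
    · rintro ⟨s, ℓ, rfl, rfl, hℓ, hS⟩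
      exact ⟨ℓ, rfl, hc ℓ (right_lt_pair _ _) ▸ hℓ, hS⟩
    · rintro ⟨ℓ, rfl, hℓ, hS⟩
      exact ⟨tag, ℓ, rfl, rfl, (hc ℓ (right_lt_pair _ _)).symm ▸ hℓ, hS⟩
  · obtain ⟨c, h, hc⟩ := hspec n
    simp only [h]
    refine or_congr_right (exists_congr fun t => exists_congr fun ℓ => and_congr_right ?_)
    rintro rfl
    rw [hc t (left_lt_pair _ _), hc ℓ (right_lt_pair _ _)]

theorem one_ne_two : (1 : M) ≠ 1 + 1 := by norm_num

theorem zero_ne_two : (0 : M) ≠ 1 + 1 := by norm_num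

theorem recursive_isConst {A : Set M} (hA : A ∈ sets M) : Recursive M fun c : M => IsConst A c := by
  have hAc := Recursive.mem hA
  have h : Recursive M fun c : M => c = zeroC ∨ c = omegaC ∨
      ∃ s α, c = pair s α ∧ s = 1 ∧ α ∈ A :=
    .or (by fun_prop) (.or (by fun_prop) (.ex_pair (by fun_prop) (by fun_prop)))
  refine h.congr_iff fun c => or_congr_right (or_congr_right ⟨?_, ?_⟩)
  · rintro ⟨α, hα, rfl⟩
    exact ⟨1, α, rfl, rfl, hα⟩
  · rintro ⟨_, α, rfl, rfl, hα⟩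
    exact ⟨α, hα, rfl⟩

@[simp]
theorem left_zeroC : left (zeroC : M) = 0 := left_pair _ _

@[simp]
theorem left_omegaC : left (omegaC : M) = 0 := left_pair _ _

@[simp]
theorem left_epsC (α : M) : left (epsC α) = 1 := left_pair _ _

theorem IsConst.left_ne_two {A : Set M} {c : M} (h : IsConst A c) : left c ≠ 1 + 1 := by
  rcases h with rfl | rfl | ⟨α, -, rfl⟩
  exacts [left_zeroC.trans_ne zero_ne_two, left_omegaC.trans_ne zero_ne_two,
    (left_epsC α).trans_ne one_ne_two]

theorem zeroC_ne_omegaC : (zeroC : M) ≠ omegaC := fun h => zero_ne_one (pair_inj.1 h).2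

theorem zeroC_ne_epsC (α : M) : zeroC ≠ epsC α := fun h => zero_ne_one (pair_inj.1 h).1

theorem omegaC_ne_epsC (α : M) : omegaC ≠ epsC α := fun h => zero_ne_one (pair_inj.1 h).1

theorem lt_seqC (k : M) : k < seqC k := right_lt_pair _ _

theorem lt_nodeC (k : M) : k < nodeC k := right_lt_pair _ _

/-- The recursive clauses for the order `le` of the notations and the lexicographic order `lex` of
lists of notations. They are imposed on all numbers, whether or not these code terms; a number
with left component `2` counts as `⟨⋯⟩` and any other number as a constant. -/
structure IsNotationOrder (LA : Set M) (le lex : M → M → Prop) : Prop where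
  const_const : ∀ a b, left a ≠ 1 + 1 → left b ≠ 1 + 1 → (le a b ↔ a = zeroC ∨
    (a = omegaC ∧ b ≠ zeroC) ∨ a = epsC (right a) ∧ b = epsC (right b) ∧ Rel LA (right a) (right b))
  const_seq : ∀ a t ℓ, left a ≠ 1 + 1 → (le a (seqC (pair t ℓ)) ↔ le a t)
  seq_const : ∀ a t ℓ, left a ≠ 1 + 1 → (le (seqC (pair t ℓ)) a ↔ le t a ∧ ¬ le a t)
  seq_seq : ∀ k ℓ, le (seqC k) (seqC ℓ) ↔ lex k ℓ
  nil_lex : ∀ ℓ, lex 0 ℓ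
  not_cons_lex_nil : ∀ t ℓ, ¬ lex (pair t ℓ) 0
  cons_lex_cons : ∀ s k t ℓ, lex (pair s k) (pair t ℓ) ↔
    le s t ∧ ¬ le t s ∨ le s t ∧ le t s ∧ lex k ℓ

/-- The truth values of `le a b` and of `lex a b` in terms of those for smaller arguments, for
orders satisfying `IsNotationOrder`. -/
def notationOrderStep (LA : Set M) (le lex : M → M → Prop) (a b : M) : Prop × Prop :=
  ((left a ≠ 1 + 1 ∧ left b ≠ 1 + 1 ∧ (a = zeroC ∨ (a = omegaC ∧ b ≠ zeroC) ∨
      a = epsC (right a) ∧ b = epsC (right b) ∧ Rel LA (right a) (right b))) ∨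
    (left a ≠ 1 + 1 ∧ left b = 1 + 1 ∧ le a (left (right b))) ∨
    (left a = 1 + 1 ∧ left b ≠ 1 + 1 ∧ le (left (right a)) b ∧ ¬ le b (left (right a))) ∨
    (left a = 1 + 1 ∧ left b = 1 + 1 ∧ lex (right a) (right b)),
  a = 0 ∨ b ≠ 0 ∧ (le (left a) (left b) ∧ ¬ le (left b) (left a) ∨
    le (left a) (left b) ∧ le (left b) (left a) ∧ lex (right a) (right b)))

theorem exists_isNotationOrder {LA : Set M} (hLA : LA ∈ sets M) :
    ∃ le lex : M → M → Prop, (Recursive M fun x : M × M => le x.1 x.2) ∧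
      (Recursive M fun x : M × M => lex x.1 x.2) ∧ IsNotationOrder LA le lex := by
  have hLAc := recursive_rel hLA
  obtain ⟨f, hf, hspec⟩ := exists_recursion_on_sum (M := M) (δ := Prop × Prop)
    (F := fun ⟨c, a, b⟩ => notationOrderStep LA (fun x y => (lookup c (x, y) : Prop × Prop).1)
      (fun x y => (lookup c (x, y) : Prop × Prop).2) a b)
    (by unfold notationOrderStep epsC; fun_prop)
  refine ⟨fun a b => (f (a, b)).1, fun k l => (f (k, l)).2, by fun_prop, by fun_prop, ?_⟩
  constructor
  · intro a b ha hb
    obtain ⟨c, h, -⟩ := hspec a b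
    simp [h, notationOrderStep, ha, hb]
  · intro a t ℓ ha
    obtain ⟨c, h, hc⟩ := hspec a (seqC (pair t ℓ))
    have ht : t < seqC (pair t ℓ) := (left_lt_pair t ℓ).trans (lt_seqC _)
    rw [h, ← hc a t (add_lt_add_right ht a)]
    simp [notationOrderStep, ha, seqC]
  · intro a t ℓ ha
    obtain ⟨c, h, hc⟩ := hspec (seqC (pair t ℓ)) a
    have ht : t + a < seqC (pair t ℓ) + a :=
      add_lt_add_left ((left_lt_pair t ℓ).trans (lt_seqC _)) a
    rw [h, ← hc t a ht, ← hc a t (add_comm t a ▸ ht)]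
    simp [notationOrderStep, ha, seqC]
  · intro k ℓ
    obtain ⟨c, h, hc⟩ := hspec (seqC k) (seqC ℓ)
    rw [h, ← hc k ℓ (add_lt_add (lt_seqC k) (lt_seqC ℓ))]
    simp [notationOrderStep, seqC]
  · intro ℓ
    obtain ⟨c, h, -⟩ := hspec 0 ℓ
    simp [h, notationOrderStep]
  · intro t ℓ
    obtain ⟨c, h, -⟩ := hspec (pair t ℓ) 0
    simp [h, notationOrderStep, pair_ne_zero]
  · intro s k t ℓ
    obtain ⟨c, h, hc⟩ := hspec (pair s k) (pair t ℓ)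
    have hst := add_lt_add (left_lt_pair s k) (left_lt_pair t ℓ)
    rw [h, ← hc s t hst, ← hc t s (add_comm s t ▸ hst),
      ← hc k ℓ (add_lt_add (right_lt_pair s k) (right_lt_pair t ℓ))]
    simp [notationOrderStep, pair_ne_zero]

namespace IsNotationOrder

variable {LA : Set M} {le lex : M → M → Prop} (ho : IsNotationOrder LA le lex)
include ho

theorem zero_lt_omega : le zeroC omegaC ∧ ¬ le omegaC zeroC := by
  simp [ho.const_const, zero_ne_two, zeroC_ne_omegaC.symm, omegaC_ne_epsC]

theorem zero_lt_eps (α : M) : le zeroC (epsC α) ∧ ¬ le (epsC α) zeroC := by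
  simp [ho.const_const, zero_ne_two, (zeroC_ne_epsC α).symm, zeroC_ne_epsC]

theorem omega_lt_eps (α : M) : le omegaC (epsC α) ∧ ¬ le (epsC α) omegaC := by
  simp [ho.const_const, zero_ne_two, (zeroC_ne_epsC α).symm, omegaC_ne_epsC,
    (omegaC_ne_epsC α).symm]

theorem zero_le_zero : le zeroC zeroC := by
  simp [ho.const_const, zero_ne_two]

theorem omega_le_omega : le omegaC omegaC := by
  simp [ho.const_const, zero_ne_two, zeroC_ne_omegaC.symm]

theorem eps_le_eps (α β : M) : le (epsC α) (epsC β) ↔ Rel LA α β := by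
  simp [ho.const_const, (zeroC_ne_epsC α).symm, (omegaC_ne_epsC α).symm]

end IsNotationOrder

theorem not_isConst_and_ne_zeroC_iff {A : Set M} {t : M} :
    ¬ (IsConst A t ∧ t ≠ zeroC) ↔ t ≠ omegaC ∧ ∀ α ∈ A, t ≠ epsC α := by
  refine ⟨fun h => ⟨?_, fun α hα => ?_⟩, ?_⟩
  · rintro rfl
    exact h ⟨.inr (.inl rfl), zeroC_ne_omegaC.symm⟩
  · rintro rfl
    exact h ⟨.inr (.inr ⟨α, hα, rfl⟩), (zeroC_ne_epsC α).symm⟩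
  · rintro ⟨hω, hε⟩ ⟨h | h | ⟨α, hα, h⟩, h0⟩
    exacts [h0 h, hω h, hε α hα h]

theorem nonempty_epsilonNotation {A LA : Set M} (hA : A ∈ sets M) (hLA : LA ∈ sets M) :
    Nonempty (EpsilonNotation A LA) := by
  obtain ⟨le, lex, hle, hlex, ho⟩ := exists_isNotationOrder hLA
  have hC := recursive_isConst hA
  have hlt := recursive_sRel (relSet_mem hle)
  obtain ⟨T, L, hT, hL, hTiff, hLiff⟩ := exists_terms_lists (M := M) (C := IsConst A)
    (S := fun ℓ => ∃ t k, ℓ = pair t k ∧ (k = 0 → ¬ (IsConst A t ∧ t ≠ zeroC)))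
    (D := fun t ℓ => ¬ ∃ t' ℓ', ℓ = pair t' ℓ' ∧ ¬ SRel (relSet le) t' t)
    hC (.ex_pair (by fun_prop) (.imp (by fun_prop) (by fun_prop)))
    (.not (.ex_pair (by fun_prop) (by fun_prop))) (1 + 1)
  refine ⟨{
    terms := {n | T n}, le := relSet le, lists := {n | L n}, lex := relSet lex
    terms_mem := Recursive.setOf_mem hT
    le_mem := relSet_mem hle
    lists_mem := Recursive.setOf_mem hL
    lex_mem := relSet_mem hlex
    mem_terms_iff := fun n => (hTiff n).trans (or_congr_right ⟨?_, ?_⟩)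
    mem_lists_iff := fun n => ?_
    zero_lt_omega := by simpa [SRel] using ho.zero_lt_omega
    zero_lt_eps := fun α _ => by simpa [SRel] using ho.zero_lt_eps α
    omega_lt_eps := fun α _ => by simpa [SRel] using ho.omega_lt_eps α
    zero_le_zero := by simpa using ho.zero_le_zero
    omega_le_omega := by simpa using ho.omega_le_omega
    eps_le_eps := fun α _ β _ => by simpa using ho.eps_le_eps α β
    const_le_seq := fun c t ℓ hc _ => by simpa using ho.const_seq c t ℓ hc.left_ne_two
    seq_le_const := fun c t ℓ hc _ => by simpa [SRel] using ho.seq_const c t ℓ hc.left_ne_two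
    seq_le_seq := fun k ℓ _ _ => by simpa using ho.seq_seq k ℓ
    nil_lex := fun ℓ _ => by simpa using ho.nil_lex ℓ
    cons_lex_nil := fun t ℓ _ => by simpa using ho.not_cons_lex_nil t ℓ
    cons_lex_cons := fun s k t ℓ _ _ => by simpa [SRel] using ho.cons_lex_cons s k t ℓ }⟩
  · rintro ⟨_, rfl, hL, t, ℓ, rfl, h⟩
    exact ⟨t, ℓ, rfl, hL, fun hℓ => not_isConst_and_ne_zeroC_iff.1 (h hℓ)⟩
  · rintro ⟨t, ℓ, rfl, hL, h⟩
    exact ⟨_, rfl, hL, t, ℓ, rfl, fun hℓ => not_isConst_and_ne_zeroC_iff.2 (h hℓ)⟩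
  · refine (hLiff n).trans (or_congr_right (exists_congr fun t => exists_congr fun ℓ => ?_))
    simp only [not_exists, not_and, not_not, Set.mem_ofPred_eq]

theorem recursive_inTwoUnion {A : Set M} (hA : A ∈ sets M) :
    Recursive M fun x : M => InTwoUnion A x := by
  have hAc := Recursive.mem hA
  have h : Recursive M fun x : M => x = label0 ∨ x = label1 ∨
      ∃ s α, x = pair s α ∧ s = 1 ∧ α ∈ A :=
    .or (by fun_prop) (.or (by fun_prop) (.ex_pair (by fun_prop) (by fun_prop)))
  refine h.congr_iff fun x => or_congr_right (or_congr_right ⟨?_, ?_⟩)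
  · rintro ⟨α, hα, rfl⟩
    exact ⟨1, α, rfl, rfl, hα⟩
  · rintro ⟨_, α, rfl, rfl, hα⟩
    exact ⟨α, hα, rfl⟩

theorem recursive_leTwoUnion {A LA : Set M} (hA : A ∈ sets M) (hLA : LA ∈ sets M) :
    Recursive M fun x : M × M => LeTwoUnion A LA x.1 x.2 := by
  have hAc := Recursive.mem hA
  have hR := recursive_rel hLA
  have hI := recursive_inTwoUnion hA
  have h : Recursive M fun x : M × M => (x.1 = label0 ∧ InTwoUnion A x.2) ∨
      (x.1 = label1 ∧ (x.2 = label1 ∨ ∃ s β, x.2 = pair s β ∧ s = 1 ∧ β ∈ A)) ∨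
      ∃ s α, x.1 = pair s α ∧ (s = 1 ∧ α ∈ A) ∧
        ∃ t β, x.2 = pair t β ∧ t = 1 ∧ β ∈ A ∧ Rel LA α β :=
    .or (by fun_prop) (.or (.and (by fun_prop) (.or (by fun_prop)
      (.ex_pair (by fun_prop) (by fun_prop)))) (.ex_pair (by fun_prop) (.and (by fun_prop)
      (.ex_pair (by fun_prop) (by fun_prop)))))
  refine h.congr_iff fun x => or_congr_right (or_congr (and_congr_right fun _ =>
    or_congr_right ⟨?_, ?_⟩) ⟨?_, ?_⟩)
  · rintro ⟨β, hβ, h⟩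
    exact ⟨1, β, h, rfl, hβ⟩
  · rintro ⟨_, β, h, rfl, hβ⟩
    exact ⟨β, hβ, h⟩
  · rintro ⟨α, hα, β, hβ, h, h', hαβ⟩
    exact ⟨1, α, h, ⟨rfl, hα⟩, 1, β, h', rfl, hβ, hαβ⟩
  · rintro ⟨_, α, h, ⟨rfl, hα⟩, _, β, h', rfl, hβ, hαβ⟩
    exact ⟨α, hα, β, hβ, h, h', hαβ⟩

variable (M) in
theorem exists_entry : ∃ entry : M → M → Prop, (Recursive M fun x : M × M => entry x.1 x.2) ∧
    ∀ σ ℓ, entry σ ℓ ↔ ∃ τ k, ℓ = pair τ k ∧ (σ = τ ∨ entry σ k) := by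
  obtain ⟨f, hf, hspec⟩ := exists_recursion_on_sum (M := M) (δ := Prop)
    (F := fun x => ∃ τ k, x.2.2 = pair τ k ∧ (x.2.1 = τ ∨ (lookup x.1 (x.2.1, k) : Prop)))
    (.ex_pair (by fun_prop) (by fun_prop))
  refine ⟨fun σ ℓ => f (σ, ℓ), by fun_prop, fun σ ℓ => ?_⟩
  obtain ⟨c, h, hc⟩ := hspec σ ℓ
  simp only [h]
  refine exists_congr fun τ => exists_congr fun k => and_congr_right ?_
  rintro rfl
  rw [hc σ k (add_lt_add_right (right_lt_pair _ _) σ)]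

theorem lt_of_entry {entry : M → M → Prop} (hrec : Recursive M fun x : M × M => entry x.1 x.2)
    (hentry : ∀ σ ℓ, entry σ ℓ ↔ ∃ τ k, ℓ = pair τ k ∧ (σ = τ ∨ entry σ k)) (σ ℓ : M) :
    entry σ ℓ → σ < ℓ := by
  refine Recursive.strong_induction (P := fun ℓ => entry σ ℓ → σ < ℓ)
    (.imp (by fun_prop) (by fun_prop)) (fun ℓ ih h => ?_) ℓ
  obtain ⟨τ, k, rfl, rfl | hk⟩ := (hentry σ ℓ).1 h
  · exact left_lt_pair _ _
  · exact (ih k (right_lt_pair _ _) hk).trans (right_lt_pair _ _)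

theorem exists_tree_order {entry leQ : M → M → Prop}
    (hentry : Recursive M fun x : M × M => entry x.1 x.2) (hlt : ∀ σ ℓ, entry σ ℓ → σ < ℓ)
    (hleQ : Recursive M fun x : M × M => leQ x.1 x.2) :
    ∃ le : M → M → Prop, (Recursive M fun x : M × M => le x.1 x.2) ∧
      (∀ x y, le (leafC x) (leafC y) ↔ leQ x y) ∧
      (∀ x ℓ, le (leafC x) (nodeC ℓ) ↔ ∃ τ, entry τ ℓ ∧ le (leafC x) τ) ∧
      (∀ k y, ¬ le (nodeC k) (leafC y)) ∧
      ∀ k ℓ, le (nodeC k) (nodeC ℓ) ↔ ∀ σ, entry σ k → ∃ τ, entry τ ℓ ∧ le σ τ := by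
  let leT (c a b : M) : Prop := lookup c (a, b)
  obtain ⟨f, hf, hspec⟩ := exists_recursion_on_sum (M := M) (δ := Prop)
    (F := fun ⟨c, a, b⟩ => (left a = 0 ∧ left b = 0 ∧ leQ (right a) (right b)) ∨
      (left a = 0 ∧ left b = 1 ∧ ∃ τ < b, entry τ (right b) ∧ leT c a τ) ∨
      (left a = 1 ∧ left b = 1 ∧
        ∀ σ < a, entry σ (right a) → ∃ τ < b, entry τ (right b) ∧ leT c σ τ))
    (.or (by fun_prop) (.or (.and (by fun_prop) (.and (by fun_prop)
      (.bex (by fun_prop) (by fun_prop)))) (.and (by fun_prop) (.and (by fun_prop)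
      (.ball (by fun_prop) (.imp (by fun_prop) (.bex (by fun_prop) (by fun_prop))))))))
  have lt_node {τ ℓ : M} (h : entry τ ℓ) : τ < nodeC ℓ := (hlt τ ℓ h).trans (lt_nodeC ℓ)
  refine ⟨fun a b => f (a, b), by fun_prop, fun x y => ?_, fun x ℓ => ?_, fun k y => ?_,
    fun k ℓ => ?_⟩
  · obtain ⟨c, h, -⟩ := hspec (leafC x) (leafC y)
    simp only [h]
    simp [leafC]
  · obtain ⟨c, h, hc⟩ := hspec (leafC x) (nodeC ℓ)
    have h' : f (leafC x, nodeC ℓ) ↔ ∃ τ < nodeC ℓ, entry τ ℓ ∧ leT c (leafC x) τ := by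
      simp only [h]
      simp [leafC, nodeC]
    simp only [h']
    refine exists_congr fun τ => ⟨fun ⟨hτ, he, hle⟩ => ?_, fun ⟨he, hle⟩ => ?_⟩
    · exact ⟨he, (hc _ _ (add_lt_add_right hτ _)).mp hle⟩
    · exact ⟨lt_node he, he, (hc _ _ (add_lt_add_right (lt_node he) _)).mpr hle⟩
  · obtain ⟨c, h, -⟩ := hspec (nodeC k) (leafC y)
    simp only [h]
    simp [leafC, nodeC]
  · obtain ⟨c, h, hc⟩ := hspec (nodeC k) (nodeC ℓ)
    have h' : f (nodeC k, nodeC ℓ) ↔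
        ∀ σ < nodeC k, entry σ k → ∃ τ < nodeC ℓ, entry τ ℓ ∧ leT c σ τ := by
      simp only [h]
      simp [nodeC]
    simp only [h']
    refine forall_congr' fun σ => ⟨fun H hσ => ?_, fun H hσ' hσ => ?_⟩
    · obtain ⟨τ, hτ, he, hle⟩ := H (lt_node hσ) hσ
      exact ⟨τ, he, (hc _ _ (add_lt_add (lt_node hσ) hτ)).mp hle⟩
    · obtain ⟨τ, he, hle⟩ := H hσ
      exact ⟨τ, lt_node he, he, (hc _ _ (add_lt_add hσ' (lt_node he))).mpr hle⟩

theorem nonempty_leafTrees {inQ : M → Prop} {leQ : M → M → Prop} (hQ : Recursive M inQ)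
    (hleQ : Recursive M fun x : M × M => leQ x.1 x.2) : Nonempty (LeafTrees inQ leQ) := by
  obtain ⟨T, L, hT, hL, hTiff, hLiff⟩ := exists_terms_lists (M := M)
    (C := fun n => ∃ s q, n = pair s q ∧ s = 0 ∧ inQ q) (S := fun ℓ => ℓ ≠ 0)
    (D := fun _ _ => True) (.ex_pair (by fun_prop) (by fun_prop)) (by fun_prop) (by fun_prop) 1
  obtain ⟨entry, hentry, hentry_iff⟩ := exists_entry M
  obtain ⟨le, hle, leaf_leaf, leaf_node, node_leaf, node_node⟩ :=
    exists_tree_order hentry (lt_of_entry hentry hentry_iff) hleQ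
  refine ⟨{
    trees := {n | T n}, le := relSet le, lists := {n | L n}, entry := relSet entry
    trees_mem := Recursive.setOf_mem hT
    le_mem := relSet_mem hle
    lists_mem := Recursive.setOf_mem hL
    entry_mem := relSet_mem hentry
    mem_trees_iff := fun n => ?_
    mem_lists_iff := fun n => by simpa using hLiff n
    not_entry_nil := fun σ => ?_
    entry_cons := fun σ τ ℓ _ => ?_
    leaf_le_leaf := fun x y _ _ => by simpa using leaf_leaf x y
    leaf_le_node := fun x ℓ _ _ => by simpa using leaf_node x ℓ
    not_node_le_leaf := fun k y _ _ => by simpa using node_leaf k y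
    node_le_node := fun k ℓ _ _ => by simpa using node_node k ℓ }⟩
  · refine (hTiff n).trans (or_congr ⟨?_, ?_⟩ (exists_congr fun ℓ => ?_))
    · rintro ⟨_, q, rfl, rfl, hq⟩
      exact ⟨q, hq, rfl⟩
    · rintro ⟨q, hq, rfl⟩
      exact ⟨0, q, rfl, rfl, hq⟩
    · exact ⟨fun ⟨hn, hℓ, h0⟩ => ⟨hℓ, h0, hn⟩, fun ⟨hℓ, h0, hn⟩ => ⟨hn, hℓ, h0⟩⟩
  · simp [hentry_iff σ 0, (pair_ne_zero _ _).symm]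
  · simp [hentry_iff σ (pair τ ℓ), pair_inj]

end Existence

/-! ### The order of the notations -/

namespace EpsilonNotation

variable {M : Type*} [L2Structure M] {A LA : Set M} (E : EpsilonNotation A LA)

theorem const_mem {c : M} (hc : IsConst A c) : c ∈ E.terms := (E.mem_terms_iff c).2 (.inl hc)

theorem omegaC_mem : omegaC ∈ E.terms := E.const_mem (.inr (.inl rfl))

theorem list_cases {n : M} (h : n ∈ E.lists) : n = 0 ∨ ∃ t ℓ, n = pair t ℓ :=
  ((E.mem_lists_iff _).1 h).imp_right fun ⟨t, ℓ, hn, _⟩ => ⟨t, ℓ, hn⟩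

theorem term_cases {n : M} (h : n ∈ E.terms) : IsConst A n ∨ ∃ t ℓ, n = seqC (pair t ℓ) :=
  ((E.mem_terms_iff _).1 h).imp_right fun ⟨t, ℓ, hn, _⟩ => ⟨t, ℓ, hn⟩

theorem const_total (hlin : IsLinearOrder A LA) {a b : M} (ha : IsConst A a) (hb : IsConst A b) :
    Rel E.le a b ∨ Rel E.le b a := by
  rcases ha with rfl | rfl | ⟨α, hα, rfl⟩ <;> rcases hb with rfl | rfl | ⟨β, hβ, rfl⟩
  · exact .inl E.zero_le_zero
  · exact .inl E.zero_lt_omega.1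
  · exact .inl (E.zero_lt_eps β hβ).1
  · exact .inr E.zero_lt_omega.1
  · exact .inl E.omega_le_omega
  · exact .inl (E.omega_lt_eps β hβ).1
  · exact .inr (E.zero_lt_eps α hα).1
  · exact .inr (E.omega_lt_eps α hα).1
  · rw [E.eps_le_eps α hα β hβ, E.eps_le_eps β hβ α hα]
    exact hlin.total α hα β hβ

theorem zeroC_le_const {c : M} (hc : IsConst A c) : Rel E.le zeroC c := by
  rcases hc with rfl | rfl | ⟨γ, hγ, rfl⟩
  exacts [E.zero_le_zero, E.zero_lt_omega.1, (E.zero_lt_eps γ hγ).1]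

theorem const_trans (hlin : IsLinearOrder A LA) {a b c : M} (ha : IsConst A a) (hb : IsConst A b)
    (hc : IsConst A c) (hab : Rel E.le a b) (hbc : Rel E.le b c) : Rel E.le a c := by
  rcases ha with rfl | rfl | ⟨α, hα, rfl⟩
  · exact E.zeroC_le_const hc
  · rcases hc with rfl | rfl | ⟨γ, hγ, rfl⟩
    · rcases hb with rfl | rfl | ⟨β, hβ, rfl⟩
      · exact hab
      · exact hbc
      · exact absurd hbc (E.zero_lt_eps β hβ).2
    · exact E.omega_le_omega
    · exact (E.omega_lt_eps γ hγ).1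
  · rcases hb with rfl | rfl | ⟨β, hβ, rfl⟩
    · exact absurd hab (E.zero_lt_eps α hα).2
    · exact absurd hab (E.omega_lt_eps α hα).2
    · rcases hc with rfl | rfl | ⟨γ, hγ, rfl⟩
      · exact absurd hbc (E.zero_lt_eps β hβ).2
      · exact absurd hbc (E.omega_lt_eps β hβ).2
      · rw [E.eps_le_eps α hα β hβ] at hab
        rw [E.eps_le_eps β hβ γ hγ] at hbc
        rw [E.eps_le_eps α hα γ hγ]
        exact hlin.trans α hα β hβ γ hγ hab hbc

theorem head_le_head_of_lex {s k t ℓ : M} (hs : pair s k ∈ E.lists) (ht : pair t ℓ ∈ E.lists)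
    (h : Rel E.lex (pair s k) (pair t ℓ)) : Rel E.le s t :=
  ((E.cons_lex_cons s k t ℓ hs ht).1 h).elim (fun h => h.1) (fun h => h.1)

variable [hM : Fact (ModelsRCA0 M)]

theorem recursive_terms : Recursive M fun n : M => n ∈ E.terms := .mem E.terms_mem

theorem recursive_lists : Recursive M fun n : M => n ∈ E.lists := .mem E.lists_mem

theorem recursive_le : Recursive M fun x : M × M => Rel E.le x.1 x.2 := recursive_rel E.le_mem

theorem recursive_lt : Recursive M fun x : M × M => SRel E.le x.1 x.2 := recursive_sRel E.le_mem

theorem recursive_lex : Recursive M fun x : M × M => Rel E.lex x.1 x.2 := recursive_rel E.lex_mem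

theorem cons_mem {t ℓ : M} (h : pair t ℓ ∈ E.lists) :
    t ∈ E.terms ∧ ℓ ∈ E.lists ∧ ∀ t' ℓ', ℓ = pair t' ℓ' → SRel E.le t' t := by
  obtain h | ⟨t', ℓ', h, h'⟩ := (E.mem_lists_iff _).1 h
  · exact absurd h (pair_ne_zero _ _)
  · obtain ⟨rfl, rfl⟩ := pair_inj.1 h
    exact h'

theorem seq_list_mem {k : M} (h : seqC k ∈ E.terms) : k ∈ E.lists := by
  obtain h | ⟨t', ℓ', h, h', -⟩ := (E.mem_terms_iff _).1 h
  · exact absurd (by simp [seqC]) h.left_ne_two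
  · rwa [seqC_inj.1 h]

theorem seq_head_mem {t ℓ : M} (h : seqC (pair t ℓ) ∈ E.terms) : t ∈ E.terms :=
  (E.cons_mem (E.seq_list_mem h)).1

theorem head_lt_seq (t ℓ : M) : t < seqC (pair t ℓ) := (left_lt_pair t ℓ).trans (lt_seqC _)

theorem le_and_lex_total (hlin : IsLinearOrder A LA) (x : M × M) :
    (x.1 ∈ E.terms ∧ x.2 ∈ E.terms → Rel E.le x.1 x.2 ∨ Rel E.le x.2 x.1) ∧
    (x.1 ∈ E.lists ∧ x.2 ∈ E.lists → Rel E.lex x.1 x.2 ∨ Rel E.lex x.2 x.1) := by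
  have hT := E.recursive_terms
  have hL := E.recursive_lists
  have hle := E.recursive_le
  have hlex := E.recursive_lex
  refine Recursive.measure_induction (M := M) (P := fun x : M × M =>
    (x.1 ∈ E.terms ∧ x.2 ∈ E.terms → Rel E.le x.1 x.2 ∨ Rel E.le x.2 x.1) ∧
    (x.1 ∈ E.lists ∧ x.2 ∈ E.lists → Rel E.lex x.1 x.2 ∨ Rel E.lex x.2 x.1))
    (.and (.imp (by fun_prop) (by fun_prop)) (.imp (by fun_prop) (by fun_prop)))
    (μ := fun x => x.1 + x.2) (by fun_prop) ?_ x
  rintro ⟨s, t⟩ ih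
  replace ih (a b : M) := ih (a, b)
  dsimp only at ih ⊢
  constructor <;> rintro ⟨hs, ht⟩
  · rcases E.term_cases hs with cs | ⟨a, k, rfl⟩ <;> rcases E.term_cases ht with ct | ⟨b, ℓ, rfl⟩
    · exact E.const_total hlin cs ct
    · have := (ih s b (add_lt_add_right (head_lt_seq b ℓ) s)).1 ⟨hs, E.seq_head_mem ht⟩
      rw [E.const_le_seq _ _ _ cs ht, E.seq_le_const _ _ _ cs ht, SRel]
      tauto
    · have := (ih a t (add_lt_add_left (head_lt_seq a k) t)).1 ⟨E.seq_head_mem hs, ht⟩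
      rw [E.const_le_seq _ _ _ ct hs, E.seq_le_const _ _ _ ct hs, SRel]
      tauto
    · rw [E.seq_le_seq _ _ hs ht, E.seq_le_seq _ _ ht hs]
      exact (ih _ _ (add_lt_add (lt_seqC _) (lt_seqC _))).2 ⟨E.seq_list_mem hs, E.seq_list_mem ht⟩
  · obtain rfl | ⟨a, k, rfl⟩ := E.list_cases hs
    · exact .inl (E.nil_lex _ ht)
    obtain rfl | ⟨b, ℓ, rfl⟩ := E.list_cases ht
    · exact .inr (E.nil_lex _ hs)
    obtain ⟨ha, hk, -⟩ := E.cons_mem hs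
    obtain ⟨hb, hℓ, -⟩ := E.cons_mem ht
    have heads := (ih a b (add_lt_add (left_lt_pair _ _) (left_lt_pair _ _))).1 ⟨ha, hb⟩
    have tails := (ih k ℓ (add_lt_add (right_lt_pair _ _) (right_lt_pair _ _))).2 ⟨hk, hℓ⟩
    rw [E.cons_lex_cons _ _ _ _ hs ht, E.cons_lex_cons _ _ _ _ ht hs, SRel, SRel]
    tauto

theorem le_total (hlin : IsLinearOrder A LA) {s t : M} (hs : s ∈ E.terms) (ht : t ∈ E.terms) :
    Rel E.le s t ∨ Rel E.le t s :=
  (E.le_and_lex_total hlin (s, t)).1 ⟨hs, ht⟩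

/-- The order of the terms is transitive on the triples of terms whose codes have a sum below `n`;
this is the induction hypothesis in the proof that it is transitive. -/
def TransBelow (n : M) : Prop :=
  ∀ r s t, r + s + t < n → r ∈ E.terms → s ∈ E.terms → t ∈ E.terms →
    Rel E.le r s → Rel E.le s t → Rel E.le r t

namespace TransBelow

variable {E} {n r s t : M} (h : E.TransBelow n) (hn : r + s + t < n) (hr : r ∈ E.terms)
  (hs : s ∈ E.terms) (ht : t ∈ E.terms)
include h hn hr hs ht

theorem lt_of_lt_of_le (hrs : SRel E.le r s) (hst : Rel E.le s t) : SRel E.le r t :=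
  ⟨h r s t hn hr hs ht hrs.1 hst,
    fun htr => hrs.2 (h s t r (add_rotate r s t ▸ hn) hs ht hr hst htr)⟩

theorem lt_of_le_of_lt (hrs : Rel E.le r s) (hst : SRel E.le s t) : SRel E.le r t :=
  ⟨h r s t hn hr hs ht hrs hst.1,
    fun htr => hst.2 (h t r s (add_rotate t r s ▸ hn) ht hr hs htr hrs)⟩

end TransBelow

theorem TransBelow.le_trans {E : EpsilonNotation A LA} (hlin : IsLinearOrder A LA) {r s t : M}
    (h : E.TransBelow (r + s + t)) (hr : r ∈ E.terms) (hs : s ∈ E.terms) (ht : t ∈ E.terms)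
    (hlex : ∀ k ℓ m, r = seqC k → s = seqC ℓ → t = seqC m →
      Rel E.lex k ℓ → Rel E.lex ℓ m → Rel E.lex k m)
    (hrs : Rel E.le r s) (hst : Rel E.le s t) : Rel E.le r t := by
  rcases E.term_cases hr with cr | ⟨a, k, rfl⟩ <;>
    rcases E.term_cases hs with cs | ⟨b, ℓ, rfl⟩ <;>
    rcases E.term_cases ht with ct | ⟨c, m, rfl⟩
  · exact E.const_trans hlin cr cs ct hrs hst
  · rw [E.const_le_seq _ _ _ cs ht] at hst
    rw [E.const_le_seq _ _ _ cr ht]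
    exact h r s c (by have := head_lt_seq c m; gcongr) hr hs (E.seq_head_mem ht) hrs hst
  · rw [E.const_le_seq _ _ _ cr hs] at hrs
    rw [E.seq_le_const _ _ _ ct hs] at hst
    exact h r b t (by have := head_lt_seq b ℓ; gcongr) hr (E.seq_head_mem hs) ht hrs hst.1
  · rw [E.const_le_seq _ _ _ cr hs] at hrs
    rw [E.seq_le_seq _ _ hs ht] at hst
    rw [E.const_le_seq _ _ _ cr ht]
    exact h r b c (by have := head_lt_seq b ℓ; have := head_lt_seq c m; gcongr) hr
      (E.seq_head_mem hs) (E.seq_head_mem ht) hrs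
      (E.head_le_head_of_lex (E.seq_list_mem hs) (E.seq_list_mem ht) hst)
  · rw [E.seq_le_const _ _ _ cs hr] at hrs
    rw [E.seq_le_const _ _ _ ct hr]
    exact h.lt_of_lt_of_le (by have := head_lt_seq a k; gcongr) (E.seq_head_mem hr) hs ht hrs hst
  · rw [E.seq_le_const _ _ _ cs hr] at hrs
    rw [E.const_le_seq _ _ _ cs ht] at hst
    rw [E.seq_le_seq _ _ hr ht, E.cons_lex_cons _ _ _ _ (E.seq_list_mem hr) (E.seq_list_mem ht)]
    exact .inl (h.lt_of_lt_of_le (by have := head_lt_seq a k; have := head_lt_seq c m; gcongr)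
      (E.seq_head_mem hr) hs (E.seq_head_mem ht) hrs hst)
  · rw [E.seq_le_seq _ _ hr hs] at hrs
    rw [E.seq_le_const _ _ _ ct hs] at hst
    rw [E.seq_le_const _ _ _ ct hr]
    exact h.lt_of_le_of_lt (by have := head_lt_seq a k; have := head_lt_seq b ℓ; gcongr)
      (E.seq_head_mem hr) (E.seq_head_mem hs) ht
      (E.head_le_head_of_lex (E.seq_list_mem hr) (E.seq_list_mem hs) hrs) hst
  · rw [E.seq_le_seq _ _ hr hs] at hrs
    rw [E.seq_le_seq _ _ hs ht] at hst
    rw [E.seq_le_seq _ _ hr ht]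
    exact hlex _ _ _ rfl rfl rfl hrs hst

theorem TransBelow.lex_trans {E : EpsilonNotation A LA} {j k ℓ : M}
    (h : E.TransBelow (j + k + ℓ)) (hj : j ∈ E.lists) (hk : k ∈ E.lists) (hℓ : ℓ ∈ E.lists)
    (tails : ∀ r j' s k' t ℓ', j = pair r j' → k = pair s k' → ℓ = pair t ℓ' →
      Rel E.lex j' k' → Rel E.lex k' ℓ' → Rel E.lex j' ℓ')
    (hjk : Rel E.lex j k) (hkℓ : Rel E.lex k ℓ) : Rel E.lex j ℓ := by
  obtain rfl | ⟨r, j, rfl⟩ := E.list_cases hj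
  · exact E.nil_lex _ hℓ
  obtain rfl | ⟨s, k, rfl⟩ := E.list_cases hk
  · exact absurd hjk (E.cons_lex_nil _ _ hj)
  obtain rfl | ⟨t, ℓ, rfl⟩ := E.list_cases hℓ
  · exact absurd hkℓ (E.cons_lex_nil _ _ hk)
  have hlt : r + s + t < pair r j + pair s k + pair t ℓ :=
    add_lt_add (add_lt_add (left_lt_pair _ _) (left_lt_pair _ _)) (left_lt_pair _ _)
  have hr := (E.cons_mem hj).1
  have hs := (E.cons_mem hk).1
  have ht := (E.cons_mem hℓ).1
  rw [E.cons_lex_cons _ _ _ _ hj hk] at hjk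
  rw [E.cons_lex_cons _ _ _ _ hk hℓ] at hkℓ
  rw [E.cons_lex_cons _ _ _ _ hj hℓ]
  rcases hjk with hrs | ⟨hrs, hsr, hjk⟩ <;> rcases hkℓ with hst | ⟨hst, hts, hkℓ⟩
  · exact .inl (h.lt_of_lt_of_le hlt hr hs ht hrs hst.1)
  · exact .inl (h.lt_of_lt_of_le hlt hr hs ht hrs hst)
  · exact .inl (h.lt_of_le_of_lt hlt hr hs ht hrs hst)
  · have hlt' : t + s + r < pair r j + pair s k + pair t ℓ := by
      rwa [add_comm t s, ← add_rotate r s t]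
    exact .inr ⟨h r s t hlt hr hs ht hrs hst, h t s r hlt' ht hs hr hts hsr,
      tails _ _ _ _ _ _ rfl rfl rfl hjk hkℓ⟩

theorem le_and_lex_trans (hlin : IsLinearOrder A LA) (x : M × M × M) :
    (x.1 ∈ E.terms ∧ x.2.1 ∈ E.terms ∧ x.2.2 ∈ E.terms ∧ Rel E.le x.1 x.2.1 ∧
      Rel E.le x.2.1 x.2.2 → Rel E.le x.1 x.2.2) ∧
    (x.1 ∈ E.lists ∧ x.2.1 ∈ E.lists ∧ x.2.2 ∈ E.lists ∧ Rel E.lex x.1 x.2.1 ∧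
      Rel E.lex x.2.1 x.2.2 → Rel E.lex x.1 x.2.2) := by
  have hT := E.recursive_terms
  have hL := E.recursive_lists
  have hle := E.recursive_le
  have hlex := E.recursive_lex
  refine Recursive.measure_induction (M := M) (P := fun x : M × M × M =>
    (x.1 ∈ E.terms ∧ x.2.1 ∈ E.terms ∧ x.2.2 ∈ E.terms ∧ Rel E.le x.1 x.2.1 ∧
      Rel E.le x.2.1 x.2.2 → Rel E.le x.1 x.2.2) ∧
    (x.1 ∈ E.lists ∧ x.2.1 ∈ E.lists ∧ x.2.2 ∈ E.lists ∧ Rel E.lex x.1 x.2.1 ∧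
      Rel E.lex x.2.1 x.2.2 → Rel E.lex x.1 x.2.2))
    (.and (.imp (by fun_prop) (by fun_prop)) (.imp (by fun_prop) (by fun_prop)))
    (μ := fun x => x.1 + x.2.1 + x.2.2) (by fun_prop) ?_ x
  rintro ⟨r, s, t⟩ ih
  replace ih (a b c : M) := ih (a, b, c)
  dsimp only at ih ⊢
  have hbelow : E.TransBelow (r + s + t) := fun a b c h ha hb hc hab hbc =>
    (ih a b c h).1 ⟨ha, hb, hc, hab, hbc⟩
  constructor <;> rintro ⟨hr, hs, ht, hrs, hst⟩
  · refine hbelow.le_trans hlin hr hs ht ?_ hrs hst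
    rintro k ℓ m rfl rfl rfl hkℓ hℓm
    exact (ih k ℓ m (add_lt_add (add_lt_add (lt_seqC _) (lt_seqC _)) (lt_seqC _))).2
      ⟨E.seq_list_mem hr, E.seq_list_mem hs, E.seq_list_mem ht, hkℓ, hℓm⟩
  · refine hbelow.lex_trans hr hs ht ?_ hrs hst
    rintro a k b ℓ c m rfl rfl rfl hkℓ hℓm
    exact (ih k ℓ m (add_lt_add (add_lt_add (right_lt_pair _ _) (right_lt_pair _ _))
      (right_lt_pair _ _))).2
      ⟨(E.cons_mem hr).2.1, (E.cons_mem hs).2.1, (E.cons_mem ht).2.1, hkℓ, hℓm⟩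

theorem transBelow (hlin : IsLinearOrder A LA) (n : M) : E.TransBelow n :=
  fun r s t _ hr hs ht hrs hst => (E.le_and_lex_trans hlin (r, s, t)).1 ⟨hr, hs, ht, hrs, hst⟩

theorem le_trans (hlin : IsLinearOrder A LA) {r s t : M} (hr : r ∈ E.terms) (hs : s ∈ E.terms)
    (ht : t ∈ E.terms) (h : Rel E.le r s) (h' : Rel E.le s t) : Rel E.le r t :=
  (E.le_and_lex_trans hlin (r, s, t)).1 ⟨hr, hs, ht, h, h'⟩

theorem lt_of_not_le (hlin : IsLinearOrder A LA) {s t : M} (hs : s ∈ E.terms) (ht : t ∈ E.terms)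
    (h : ¬ Rel E.le s t) : SRel E.le t s :=
  ⟨(E.le_total hlin hs ht).resolve_left h, h⟩

theorem lt_of_lt_of_le (hlin : IsLinearOrder A LA) {r s t : M} (hr : r ∈ E.terms)
    (hs : s ∈ E.terms) (ht : t ∈ E.terms) (h : SRel E.le r s) (h' : Rel E.le s t) :
    SRel E.le r t :=
  (E.transBelow hlin _).lt_of_lt_of_le (Order.lt_add_one_iff.2 le_rfl) hr hs ht h h'

theorem zeroC_le {t : M} (ht : t ∈ E.terms) : Rel E.le zeroC t := by
  have hT := E.recursive_terms
  have hle := E.recursive_le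
  refine Recursive.strong_induction (P := fun t => t ∈ E.terms → Rel E.le zeroC t)
    (.imp (by fun_prop) (by fun_prop)) (fun t ih ht => ?_) t ht
  obtain ct | ⟨t, ℓ, rfl⟩ := E.term_cases ht
  · exact E.zeroC_le_const ct
  · rw [E.const_le_seq _ _ _ (.inl rfl) ht]
    exact ih t (head_lt_seq t ℓ) (E.seq_head_mem ht)

end EpsilonNotation

/-! ### Heights and the tree of a term -/

section Functions

variable {M : Type*} [L2Structure M] [hM : Fact (ModelsRCA0 M)] {γ : Type*} [Coded M γ]

theorem exists_iterate {s : M → M} (hs : Recursive M s) (a : M) :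
    ∃ f : M → M, Recursive M f ∧ f 0 = a ∧ ∀ n, f (n + 1) = s (f n) :=
  exists_primitive_recursion a (s := fun x => s x.2) (by fun_prop)

theorem exists_pow2 : ∃ f : M → M, Recursive M f ∧ f 0 = 1 ∧ ∀ n, f (n + 1) = f n + f n :=
  exists_iterate (s := fun x => x + x) (by fun_prop) 1

/-- Powers of two, also with nonstandard exponents. -/
noncomputable def pow2 : M → M := exists_pow2.choose

@[fun_prop]
theorem Recursive.pow2 {f : γ → M} (hf : Recursive M f) : Recursive M fun a => pow2 (f a) :=
  exists_pow2.choose_spec.1.comp hf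

theorem pow2_zero : pow2 (0 : M) = 1 := exists_pow2.choose_spec.2.1

theorem pow2_succ (n : M) : pow2 (n + 1) = pow2 n + pow2 n := exists_pow2.choose_spec.2.2 n

theorem pow2_pos (n : M) : 0 < pow2 n := by
  refine RecEnum.induction (P := fun n => 0 < pow2 n) (Recursive.recEnum (by fun_prop)) ?_ ?_ n
  · rw [pow2_zero]
    exact zero_lt_one
  · intro n ih
    rw [pow2_succ]
    exact add_pos_of_pos_of_nonneg ih ih.le

theorem pow2_mono {m n : M} (h : m ≤ n) : pow2 m ≤ pow2 n := by
  obtain ⟨k, rfl⟩ := exists_add_of_le h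
  refine RecEnum.induction (P := fun k => pow2 m ≤ pow2 (m + k)) (Recursive.recEnum (by fun_prop))
    (by rw [add_zero]) (fun k ih => ?_) k
  rw [← add_assoc, pow2_succ]
  exact ih.trans le_self_add

theorem lt_pow2 (n : M) : n < pow2 n := by
  refine RecEnum.induction (P := fun n => n < pow2 n) (Recursive.recEnum (by fun_prop))
    (pow2_pos 0) (fun n ih => ?_) n
  rw [pow2_succ]
  exact add_lt_add_of_lt_of_le ih (Order.one_le_iff_pos.2 (pow2_pos n))

theorem exists_monus : ∃ f : M × M → M, Recursive M f ∧ ∀ a b, f (a + b, b) = a := by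
  obtain ⟨f, hf, h⟩ := Recursive.exists_choice (M := M) (γ := M × M)
    (P := fun x y => x.2 ≤ x.1 → x.1 = y + x.2) (.imp (by fun_prop) (by fun_prop)) (fun x => by
      by_cases hx : x.2 ≤ x.1
      · obtain ⟨y, hy⟩ := exists_add_of_le hx
        exact ⟨y, fun _ => by rw [hy, add_comm]⟩
      · exact ⟨0, fun h => absurd h hx⟩)
  exact ⟨f, hf, fun a b => (add_right_cancel (h (a + b, b) le_add_self)).symm⟩

/-- Subtraction, with an unspecified value where the result would be negative. -/
noncomputable def monus (a b : M) : M := exists_monus.choose (a, b)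

@[fun_prop]
theorem Recursive.monus {f g : γ → M} (hf : Recursive M f) (hg : Recursive M g) :
    Recursive M fun a => monus (f a) (g a) :=
  exists_monus.choose_spec.1.comp (hf.prodMk hg)

theorem add_monus (a b : M) : monus (a + b) b = a := exists_monus.choose_spec.2 a b

open Classical in
theorem exists_weight : ∃ f : M → M, Recursive M f ∧ f 0 = 0 ∧ ∀ t ℓ, f (pair t ℓ) =
    pow2 ((if t = seqC (right t) then f (right t) + 1 else 0) + 1 + 1 + 1) + f ℓ := by
  obtain ⟨f, hf, h⟩ := exists_course_of_values_recursion (M := M) (γ := M) (δ := M)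
    (F := fun x => if x.2 = 0 then 0 else
      pow2 ((if left x.2 = seqC (right (left x.2)) then
        lookup x.1 (right (left x.2)) + 1 else 0) + 1 + 1 + 1) + lookup x.1 (right x.2))
    (by fun_prop)
  refine ⟨f, hf, ?_, fun t ℓ => ?_⟩
  · obtain ⟨c, hc, -⟩ := h 0
    exact hc.trans (if_pos rfl)
  · obtain ⟨c, hc, htable⟩ := h (pair t ℓ)
    simp only [pair_ne_zero, if_false, left_pair, right_pair] at hc
    rw [hc, htable ℓ (right_lt_pair t ℓ)]
    split_ifs with ht
    · rw [htable (right t)]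
      calc right t < seqC (right t) := lt_seqC _
        _ = t := ht.symm
        _ < pair t ℓ := left_lt_pair t ℓ
    · rfl

/-- The weight of a list of terms: the sum of `2 ^ (h + 3)` over the heights `h` of its entries. -/
noncomputable def weight : M → M := exists_weight.choose

open Classical in
/-- The height of a term, defined by recursion together with `weight`: it is `0` for constants, and
one more than the weight of the list for the terms `⟨t₀, …, tₖ₋₁⟩`. The tree assigned to a term will
contain no linear tree of larger height. -/
noncomputable def height (t : M) : M := if t = seqC (right t) then weight (right t) + 1 else 0

@[fun_prop]
theorem Recursive.weight {f : γ → M} (hf : Recursive M f) : Recursive M fun a => weight (f a) :=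
  exists_weight.choose_spec.1.comp hf

@[fun_prop]
theorem Recursive.height {f : γ → M} (hf : Recursive M f) : Recursive M fun a => height (f a) := by
  unfold RevMath.height
  fun_prop

theorem weight_nil : weight (0 : M) = 0 := exists_weight.choose_spec.2.1

theorem weight_cons (t ℓ : M) : weight (pair t ℓ) = pow2 (height t + 1 + 1 + 1) + weight ℓ :=
  exists_weight.choose_spec.2.2 t ℓ

theorem height_seq (k : M) : height (seqC k) = weight k + 1 := by
  simp [height, seqC]

theorem height_const {A : Set M} {c : M} (hc : IsConst A c) : height c = 0 := by
  refine if_neg fun h => hc.left_ne_two ?_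
  rw [h, seqC, left_pair]

theorem exists_bar : ∃ f : M → M, Recursive M f ∧ f 0 = leafC label0 ∧
    ∀ n, f (n + 1) = nodeC (pair (f n) 0) :=
  exists_iterate (s := fun x => nodeC (pair x 0)) (by fun_prop) _

/-- The linear tree of the given height whose leaf is labelled by `0`. -/
noncomputable def bar : M → M := exists_bar.choose

@[fun_prop]
theorem Recursive.bar {f : γ → M} (hf : Recursive M f) : Recursive M fun a => bar (f a) :=
  exists_bar.choose_spec.1.comp hf

theorem bar_zero : bar (0 : M) = leafC label0 := exists_bar.choose_spec.2.1

theorem bar_succ (n : M) : bar (n + 1) = nodeC (pair (bar n) 0) := exists_bar.choose_spec.2.2 n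

/-- The tree with two immediate subtrees. -/
def node2 (x y : M) : M := nodeC (pair x (pair y 0))

/-- The tree with immediate subtrees `·1` and `·(x)`. It embeds into no linear tree labelled by
`0`, and `guard x ≤ guard y` exactly if `x ≤ y`. -/
def guard (x : M) : M := node2 (leafC label1) (nodeC (pair x 0))

@[fun_prop]
theorem Recursive.node2 {f g : γ → M} (hf : Recursive M f) (hg : Recursive M g) :
    Recursive M fun a => node2 (f a) (g a) := by
  unfold RevMath.node2
  fun_prop

@[fun_prop]
theorem Recursive.guard {f : γ → M} (hf : Recursive M f) : Recursive M fun a => guard (f a) := by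
  unfold RevMath.guard
  fun_prop

end Functions

section Children

variable {M : Type*} [L2Structure M] [hM : Fact (ModelsRCA0 M)]

/-- `G w ℓ` lists the immediate subtrees that a term with list of entries `ℓ` contributes when
`tree` gives the trees of the entries: the entry at the head of a remaining list of weight `v` is
paired with the linear tree of height `w - v`. -/
structure IsChildren (tree : M → M) (G : M → M → M) : Prop where
  of_forall_ne : ∀ w ℓ, (∀ t k, ℓ ≠ pair t k) → G w ℓ = 0
  cons : ∀ w t ℓ, G w (pair t ℓ) =
    pair (node2 (guard (tree t)) (bar (monus w (weight (pair t ℓ))))) (G w ℓ)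

open Classical in
theorem exists_isChildren {g : M → M → M} (hg : Recursive M fun x : M × M => g x.1 x.2) :
    ∃ G : M → M → M → M, (Recursive M fun x : M × M × M => G x.1 x.2.1 x.2.2) ∧
      ∀ c, IsChildren (g c) (G c) := by
  obtain ⟨f, hf, h⟩ := exists_course_of_values_recursion (M := M) (γ := M × M × M) (δ := M)
    (F := fun ⟨d, c, w, ℓ⟩ => if ℓ = pair (left ℓ) (right ℓ) then
      pair (node2 (guard (g c (left ℓ))) (bar (monus w (weight ℓ)))) (lookup d (c, w, right ℓ))
      else 0) (by fun_prop)
  refine ⟨fun c w ℓ => f (c, w, ℓ), hf, fun c => ⟨fun w ℓ hℓ => ?_, fun w t ℓ => ?_⟩⟩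
  · obtain ⟨d, hd, -⟩ := h (c, w, ℓ)
    exact hd.trans (if_neg (hℓ _ _))
  · obtain ⟨d, hd, htable⟩ := h (c, w, pair t ℓ)
    simp only [left_pair, right_pair, if_true] at hd
    refine hd.trans ?_
    rw [htable (c, w, ℓ)]
    exact pair_lt_pair (add_lt_add_right (pair_lt_pair (add_lt_add_right (right_lt_pair t ℓ) w)) c)

theorem IsChildren.congr {tree tree' : M → M} {G G' : M → M → M} (hG : IsChildren tree G)
    (hG' : IsChildren tree' G') {w ℓ : M} (hGr : Recursive M (G w)) (hGr' : Recursive M (G' w))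
    (h : ∀ t < ℓ, tree t = tree' t) : G w ℓ = G' w ℓ := by
  refine Recursive.strong_induction (P := fun k => k ≤ ℓ → G w k = G' w k)
    (.imp (by fun_prop) (by fun_prop)) (fun k ih hk => ?_) ℓ le_rfl
  by_cases hcons : ∃ t m, k = pair t m
  · obtain ⟨t, m, rfl⟩ := hcons
    rw [hG.cons, hG'.cons, h t ((left_lt_pair t m).trans_le hk),
      ih m (right_lt_pair t m) ((right_lt_pair t m).le.trans hk)]
  · push Not at hcons
    rw [hG.of_forall_ne w k hcons, hG'.of_forall_ne w k hcons]

/-- The simultaneous recursive clauses for the tree of a term and the lists `G w ℓ` of subtrees; the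
predicate `low` singles out the terms that are sent to linear trees. -/
structure IsTreeAssignment (low : M → Prop) (tree : M → M) (G : M → M → M) : Prop
    extends IsChildren tree G where
  recursive_tree : Recursive M tree
  recursive_children : Recursive M fun x : M × M => G x.1 x.2
  tree_zeroC : tree zeroC = leafC label0
  tree_omegaC : tree omegaC = leafC label1
  tree_epsC : ∀ α, tree (epsC α) = leafC (labelOf α)
  tree_seqC_of_low : ∀ k, low (seqC k) → tree (seqC k) = bar (weight k + 1)
  tree_seqC_of_not_low : ∀ k, ¬ low (seqC k) → tree (seqC k) = nodeC (G (weight k) k)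

open Classical in
theorem exists_isTreeAssignment {low : M → Prop} (hlow : Recursive M low) :
    ∃ tree G, IsTreeAssignment low tree G := by
  obtain ⟨G, hG, hGspec⟩ := exists_isChildren (M := M) (g := lookup) (by fun_prop)
  obtain ⟨tree, htree, h⟩ := exists_course_of_values_recursion (M := M) (γ := M) (δ := M)
    (F := fun ⟨c, t⟩ => if t = zeroC then leafC label0 else if t = omegaC then leafC label1 else
      if t = epsC (right t) then leafC (labelOf (right t)) else
      if low t then bar (weight (right t) + 1) else nodeC (G c (weight (right t)) (right t)))
    (by fun_prop)
  obtain ⟨H, hH, hHspec⟩ := exists_isChildren (M := M) (g := fun _ => tree) (by fun_prop)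
  have hzero (k : M) : seqC k ≠ zeroC := fun h => zero_ne_two (pair_inj.1 h).1.symm
  have homega (k : M) : seqC k ≠ omegaC := fun h => zero_ne_two (pair_inj.1 h).1.symm
  have heps (k α : M) : seqC k ≠ epsC α := fun h => one_ne_two (pair_inj.1 h).1.symm
  have hright (k : M) : right (seqC k) = k := right_pair _ _
  refine ⟨tree, H 0, hHspec 0, htree, hH.comp (f := fun x : M × M => (0, x.1, x.2)) (by fun_prop),
    ?_, ?_, fun α => ?_, fun k hk => ?_, fun k hk => ?_⟩
  · obtain ⟨c, hc, -⟩ := h zeroC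
    simpa only [if_true] using hc
  · obtain ⟨c, hc, -⟩ := h omegaC
    simpa only [zeroC_ne_omegaC.symm, if_false, if_true] using hc
  · obtain ⟨c, hc, -⟩ := h (epsC α)
    simpa only [(zeroC_ne_epsC α).symm, (omegaC_ne_epsC α).symm, right_epsC, if_false, if_true]
      using hc
  · obtain ⟨c, hc, -⟩ := h (seqC k)
    simpa only [hzero, homega, heps, hright, hk, if_false, if_true] using hc
  · obtain ⟨c, hc, htable⟩ := h (seqC k)
    have hchildren : G c (weight k) k = H 0 (weight k) k :=
      (hGspec c).congr (hHspec 0) (hG.comp (f := fun ℓ => (c, weight k, ℓ)) (by fun_prop))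
        (hH.comp (f := fun ℓ => (0, weight k, ℓ)) (by fun_prop))
        fun t ht => htable t (ht.trans (lt_seqC k))
    simpa only [hzero, homega, heps, hright, hk, hchildren, if_false] using hc

end Children

namespace EpsilonNotation

variable {M : Type*} [L2Structure M] [hM : Fact (ModelsRCA0 M)] {A LA : Set M}
  (E : EpsilonNotation A LA)

theorem exists_isTreeAssignment :
    ∃ tree G, IsTreeAssignment (fun t => SRel E.le t omegaC) tree G := by
  have := E.recursive_lt
  exact RevMath.exists_isTreeAssignment (by fun_prop)

/-- The tree `h(t)` assigned to a term `t`: constants become leaves, the other terms below `ω`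
become the linear tree of their height, and any remaining term `⟨t₀, …, tₖ₋₁⟩` becomes a node with
one child for each `tᵢ`, made up of `guard h(tᵢ)` and of the linear tree whose height is the weight
of `t₀, …, tᵢ₋₁`. -/
noncomputable def tree : M → M := E.exists_isTreeAssignment.choose

/-- The list of the children contributed by the entries of `ℓ` if the preceding entries have total
weight `n`. -/
noncomputable def children (n ℓ : M) : M :=
  E.exists_isTreeAssignment.choose_spec.choose (n + weight ℓ) ℓ

theorem isTreeAssignment : IsTreeAssignment (fun t => SRel E.le t omegaC) E.tree
    E.exists_isTreeAssignment.choose_spec.choose :=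
  E.exists_isTreeAssignment.choose_spec.choose_spec

theorem recursive_tree : Recursive M E.tree := E.isTreeAssignment.recursive_tree

theorem recursive_children : Recursive M fun x : M × M => E.children x.1 x.2 :=
  E.isTreeAssignment.recursive_children.comp (f := fun x : M × M => (x.1 + weight x.2, x.2))
    (by fun_prop)

theorem tree_zeroC : E.tree zeroC = leafC label0 := E.isTreeAssignment.tree_zeroC

theorem tree_omegaC : E.tree omegaC = leafC label1 := E.isTreeAssignment.tree_omegaC

theorem tree_epsC (α : M) : E.tree (epsC α) = leafC (labelOf α) := E.isTreeAssignment.tree_epsC α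

theorem tree_seq_of_lt {k : M} (h : SRel E.le (seqC k) omegaC) :
    E.tree (seqC k) = bar (weight k + 1) :=
  E.isTreeAssignment.tree_seqC_of_low k h

theorem tree_seq_of_not_lt {k : M} (h : ¬ SRel E.le (seqC k) omegaC) :
    E.tree (seqC k) = nodeC (E.children 0 k) := by
  rw [children, zero_add]
  exact E.isTreeAssignment.tree_seqC_of_not_low k h

theorem children_nil (n : M) : E.children n 0 = 0 :=
  E.isTreeAssignment.of_forall_ne _ _ fun t k => (pair_ne_zero t k).symm

theorem children_cons (n t ℓ : M) : E.children n (pair t ℓ) =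
    pair (node2 (guard (E.tree t)) (bar n)) (E.children (n + pow2 (height t + 1 + 1 + 1)) ℓ) := by
  rw [children, E.isTreeAssignment.cons, add_monus, weight_cons, ← add_assoc]
  rfl

end EpsilonNotation

namespace EpsilonNotation

variable {M : Type*} [L2Structure M] {A LA : Set M} (E : EpsilonNotation A LA)

theorem const_eq_zeroC {c : M} (hc : IsConst A c) (h : SRel E.le c omegaC) : c = zeroC := by
  rcases hc with rfl | rfl | ⟨α, hα, rfl⟩
  · rfl
  · exact absurd h.1 h.2
  · exact absurd (E.omega_lt_eps α hα).1 h.2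

theorem seq_lt_omega {t ℓ : M} (h : seqC (pair t ℓ) ∈ E.terms) :
    SRel E.le (seqC (pair t ℓ)) omegaC ↔ SRel E.le t omegaC := by
  have hc : IsConst A omegaC := Or.inr (Or.inl rfl)
  rw [SRel, E.seq_le_const _ _ _ hc h, E.const_le_seq _ _ _ hc h]
  exact ⟨fun h => h.1, fun h => ⟨h, h.2⟩⟩

theorem equiv_of_cons_lex_cons {s k t ℓ : M} (hs : pair s k ∈ E.lists) (ht : pair t ℓ ∈ E.lists)
    (h : Rel E.lex (pair s k) (pair t ℓ)) (h' : Rel E.lex (pair t ℓ) (pair s k)) :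
    (Rel E.le s t ∧ Rel E.le t s) ∧ Rel E.lex k ℓ ∧ Rel E.lex ℓ k := by
  rw [E.cons_lex_cons _ _ _ _ hs ht] at h
  rw [E.cons_lex_cons _ _ _ _ ht hs] at h'
  rcases h with h | ⟨hst, hts, hkl⟩ <;> rcases h' with h' | ⟨hts', -, hlk⟩
  · exact absurd h.1 h'.2
  · exact absurd hts' h.2
  · exact absurd hst h'.2
  · exact ⟨⟨hst, hts⟩, hkl, hlk⟩

variable [hM : Fact (ModelsRCA0 M)]

theorem height_eq_and_weight_eq (x : M × M) :
    (x.1 ∈ E.terms ∧ x.2 ∈ E.terms ∧ Rel E.le x.1 x.2 ∧ Rel E.le x.2 x.1 →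
      height x.1 = height x.2) ∧
    (x.1 ∈ E.lists ∧ x.2 ∈ E.lists ∧ Rel E.lex x.1 x.2 ∧ Rel E.lex x.2 x.1 →
      weight x.1 = weight x.2) := by
  have hTerms := E.recursive_terms
  have hLists := E.recursive_lists
  have hle := E.recursive_le
  have hlex := E.recursive_lex
  refine Recursive.measure_induction (M := M) (P := fun x : M × M =>
    (x.1 ∈ E.terms ∧ x.2 ∈ E.terms ∧ Rel E.le x.1 x.2 ∧ Rel E.le x.2 x.1 →
      height x.1 = height x.2) ∧
    (x.1 ∈ E.lists ∧ x.2 ∈ E.lists ∧ Rel E.lex x.1 x.2 ∧ Rel E.lex x.2 x.1 →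
      weight x.1 = weight x.2))
    (.and (.imp (by fun_prop) (by fun_prop)) (.imp (by fun_prop) (by fun_prop)))
    (μ := fun x => x.1 + x.2) (by fun_prop) ?_ x
  rintro ⟨s, t⟩ ih
  replace ih (a b : M) := ih (a, b)
  dsimp only at ih ⊢
  constructor
  · rintro ⟨hs, ht, h, h'⟩
    rcases E.term_cases hs with cs | ⟨s', k, rfl⟩ <;> rcases E.term_cases ht with ct | ⟨t', ℓ, rfl⟩
    · rw [height_const cs, height_const ct]
    · rw [E.const_le_seq _ _ _ cs ht] at h
      rw [E.seq_le_const _ _ _ cs ht] at h'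
      exact absurd h h'.2
    · rw [E.seq_le_const _ _ _ ct hs] at h
      rw [E.const_le_seq _ _ _ ct hs] at h'
      exact absurd h' h.2
    · rw [E.seq_le_seq _ _ hs ht] at h
      rw [E.seq_le_seq _ _ ht hs] at h'
      rw [height_seq, height_seq, (ih _ _ (add_lt_add (lt_seqC _) (lt_seqC _))).2
        ⟨E.seq_list_mem hs, E.seq_list_mem ht, h, h'⟩]
  · rintro ⟨hs, ht, h, h'⟩
    rcases E.list_cases hs with rfl | ⟨s', k, rfl⟩ <;>
      rcases E.list_cases ht with rfl | ⟨t', ℓ, rfl⟩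
    · rfl
    · exact absurd h' (E.cons_lex_nil _ _ ht)
    · exact absurd h (E.cons_lex_nil _ _ hs)
    obtain ⟨hst, hkl⟩ := E.equiv_of_cons_lex_cons hs ht h h'
    rw [weight_cons, weight_cons,
      (ih s' t' (add_lt_add (left_lt_pair _ _) (left_lt_pair _ _))).1
        ⟨(E.cons_mem hs).1, (E.cons_mem ht).1, hst⟩,
      (ih k ℓ (add_lt_add (right_lt_pair _ _) (right_lt_pair _ _))).2
        ⟨(E.cons_mem hs).2.1, (E.cons_mem ht).2.1, hkl⟩]

theorem height_eq {s t : M} (hs : s ∈ E.terms) (ht : t ∈ E.terms)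
    (hst : Rel E.le s t) (hts : Rel E.le t s) : height s = height t :=
  (E.height_eq_and_weight_eq (s, t)).1 ⟨hs, ht, hst, hts⟩

/-- The height is strictly monotone on the terms below `ω`, as far as pairs of terms with code sum
less than `n` are concerned. -/
def HeightMonoBelow (n : M) : Prop :=
  ∀ s t, s + t < n → s ∈ E.terms → t ∈ E.terms → SRel E.le s omegaC → SRel E.le t s →
    height t < height s

variable {E}

theorem HeightMonoBelow.weight_lt_pow2 (hlin : IsLinearOrder A LA) {n : M}
    (h : E.HeightMonoBelow n) {ℓ : M} (hℓ : ℓ ∈ E.lists) (hne : ℓ ≠ 0)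
    (hω : SRel E.le (left ℓ) omegaC) (hn : ℓ ≤ n) :
    weight ℓ < pow2 (height (left ℓ) + 1 + 1 + 1 + 1) := by
  have hLists := E.recursive_lists
  have hlt := E.recursive_lt
  refine Recursive.strong_induction (P := fun ℓ => ℓ ∈ E.lists ∧ ℓ ≠ 0 ∧
      SRel E.le (left ℓ) omegaC ∧ ℓ ≤ n → weight ℓ < pow2 (height (left ℓ) + 1 + 1 + 1 + 1))
    (.imp (by fun_prop) (by fun_prop)) ?_ ℓ ⟨hℓ, hne, hω, hn⟩
  rintro ℓ ih ⟨hℓ, hne, hω, hn⟩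
  obtain ⟨a, k, rfl⟩ := (E.list_cases hℓ).resolve_left hne
  obtain ⟨ha, hk, hdesc⟩ := E.cons_mem hℓ
  rw [left_pair] at hω ⊢
  rw [weight_cons, pow2_succ (height a + 1 + 1 + 1)]
  refine add_lt_add_right ?_ _
  rcases E.list_cases hk with rfl | ⟨b, m, rfl⟩
  · rw [weight_nil]
    exact pow2_pos _
  have hb := (E.cons_mem hk).1
  have hba := hdesc b m rfl
  have hheight : height b < height a := by
    refine h a b ?_ ha hb hω hba
    calc a + b < a + pair b m := add_lt_add_right (left_lt_pair b m) a
      _ < pair a (pair b m) := add_lt_pair _ _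
      _ ≤ n := hn
  have hweight := ih (pair b m) (right_lt_pair _ _) ⟨hk, pair_ne_zero b m, by
    rw [left_pair]
    exact E.lt_of_lt_of_le hlin hb ha E.omegaC_mem hba hω.1, (right_lt_pair _ _).le.trans hn⟩
  rw [left_pair] at hweight
  have := Order.add_one_le_iff.2 hheight
  exact hweight.trans_le (pow2_mono (by gcongr))

theorem HeightMonoBelow.weight_lt (hlin : IsLinearOrder A LA) {n : M} (h : E.HeightMonoBelow n)
    {k ℓ : M} (hk : k ∈ E.lists) (hℓ : ℓ ∈ E.lists) (hω : SRel E.le (left k) omegaC)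
    (hlex : SRel E.lex ℓ k) (hn : k + ℓ ≤ n) : weight ℓ < weight k := by
  have hLists := E.recursive_lists
  have hlt := E.recursive_lt
  have hlexLt := recursive_sRel E.lex_mem
  refine Recursive.measure_induction (M := M) (P := fun x : M × M =>
    x.1 ∈ E.lists ∧ x.2 ∈ E.lists ∧ SRel E.le (left x.1) omegaC ∧ SRel E.lex x.2 x.1 ∧
      x.1 + x.2 ≤ n → weight x.2 < weight x.1) (.imp (by fun_prop) (by fun_prop))
    (μ := fun x => x.1) (by fun_prop) ?_ (k, ℓ) ⟨hk, hℓ, hω, hlex, hn⟩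
  rintro ⟨k, ℓ⟩ ih ⟨hk, hℓ, hω, ⟨hlex, hlex'⟩, hn⟩
  replace ih (a b : M) := ih (a, b)
  dsimp only at ih hk hℓ hω hlex hlex' hn ⊢
  rcases E.list_cases hk with rfl | ⟨s, k, rfl⟩
  · exact absurd (E.nil_lex _ hℓ) hlex'
  rw [weight_cons]
  rcases E.list_cases hℓ with rfl | ⟨t, ℓ, rfl⟩
  · rw [weight_nil]
    exact (pow2_pos _).trans_le le_self_add
  rw [left_pair] at hω
  obtain ⟨hs, hkl, hdesc⟩ := E.cons_mem hk
  obtain ⟨ht, hℓl, -⟩ := E.cons_mem hℓ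
  rw [E.cons_lex_cons _ _ _ _ hℓ hk] at hlex
  rw [E.cons_lex_cons _ _ _ _ hk hℓ] at hlex'
  rcases hlex with hts | ⟨hts, hst, htail⟩
  · have hheight : height t < height s :=
      h s t ((add_lt_add (left_lt_pair _ _) (left_lt_pair _ _)).trans_le hn) hs ht hω hts
    have hweight := h.weight_lt_pow2 hlin hℓ (pair_ne_zero t ℓ) (by
      rw [left_pair]
      exact E.lt_of_lt_of_le hlin ht hs E.omegaC_mem hts hω.1) (le_add_self.trans hn)
    rw [left_pair] at hweight
    have := Order.add_one_le_iff.2 hheight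
    exact (hweight.trans_le (pow2_mono (by gcongr))).trans_le le_self_add
  · have htail' : ¬ Rel E.lex k ℓ := fun h => hlex' (.inr ⟨hst, hts, h⟩)
    obtain ⟨a, m, rfl⟩ := (E.list_cases hkl).resolve_left fun h =>
      htail' (h ▸ E.nil_lex ℓ hℓl)
    rw [weight_cons t, E.height_eq ht hs hts hst]
    refine add_lt_add_right (ih (pair a m) ℓ (right_lt_pair _ _) ⟨hkl, hℓl, ?_, ⟨htail, htail'⟩,
      (add_le_add (right_lt_pair _ _).le (right_lt_pair _ _).le).trans hn⟩) _
    rw [left_pair]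
    exact E.lt_of_lt_of_le hlin (E.cons_mem hkl).1 hs E.omegaC_mem (hdesc a m rfl) hω.1

theorem height_lt (hlin : IsLinearOrder A LA) {s t : M} (hs : s ∈ E.terms) (ht : t ∈ E.terms)
    (hω : SRel E.le s omegaC) (hts : SRel E.le t s) : height t < height s := by
  have hTerms := E.recursive_terms
  have hlt := E.recursive_lt
  refine Recursive.measure_induction (M := M) (P := fun x : M × M => x.1 ∈ E.terms ∧
      x.2 ∈ E.terms ∧ SRel E.le x.1 omegaC ∧ SRel E.le x.2 x.1 → height x.2 < height x.1)
    (.imp (by fun_prop) (by fun_prop)) (μ := fun x => x.1 + x.2) (by fun_prop) ?_ (s, t)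
    ⟨hs, ht, hω, hts⟩
  rintro ⟨s, t⟩ ih ⟨hs, ht, hω, hts⟩
  have hmono : E.HeightMonoBelow (s + t) := fun a b hab ha hb hω hba =>
    ih (a, b) hab ⟨ha, hb, hω, hba⟩
  dsimp only at hs ht hω hts ⊢
  rcases E.term_cases hs with cs | ⟨s', k, rfl⟩
  · rw [E.const_eq_zeroC cs hω] at hts
    exact absurd (E.zeroC_le ht) hts.2
  rw [height_seq]
  rcases E.term_cases ht with ct | ⟨t', ℓ, rfl⟩
  · rw [height_const ct]
    exact Order.lt_add_one_iff.2 zero_le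
  · rw [SRel, E.seq_le_seq _ _ hs ht, E.seq_le_seq _ _ ht hs] at hts
    rw [height_seq]
    refine add_lt_add_left (hmono.weight_lt hlin (E.seq_list_mem hs) (E.seq_list_mem ht) ?_ hts
      (add_le_add (lt_seqC _).le (lt_seqC _).le)) 1
    rw [left_pair]
    exact (E.seq_lt_omega hs).1 hω

end EpsilonNotation

/-! ### Embeddings between trees -/

namespace LeafTrees

variable {M : Type*} [L2Structure M] {inQ : M → Prop} {leQ : M → M → Prop} (T : LeafTrees inQ leQ)

theorem leaf_mem {q : M} (hq : inQ q) : leafC q ∈ T.trees :=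
  (T.mem_trees_iff _).2 (Or.inl ⟨q, hq, rfl⟩)

theorem nil_mem : 0 ∈ T.lists := (T.mem_lists_iff _).2 (Or.inl rfl)

theorem cons_mem {τ ℓ : M} (hτ : τ ∈ T.trees) (hℓ : ℓ ∈ T.lists) : pair τ ℓ ∈ T.lists :=
  (T.mem_lists_iff _).2 (Or.inr ⟨τ, ℓ, rfl, hτ, hℓ⟩)

theorem entry_single {σ τ : M} (hτ : τ ∈ T.trees) : Rel T.entry σ (pair τ 0) ↔ σ = τ := by
  rw [T.entry_cons _ _ _ (T.cons_mem hτ T.nil_mem)]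
  exact or_iff_left (T.not_entry_nil σ)

theorem entry_double {σ τ ρ : M} (hτ : τ ∈ T.trees) (hρ : ρ ∈ T.trees) :
    Rel T.entry σ (pair τ (pair ρ 0)) ↔ σ = τ ∨ σ = ρ := by
  rw [T.entry_cons _ _ _ (T.cons_mem hτ (T.cons_mem hρ T.nil_mem)), T.entry_single hρ]

variable [hM : Fact (ModelsRCA0 M)]

theorem node_mem {τ ℓ : M} (hτ : τ ∈ T.trees) (hℓ : ℓ ∈ T.lists) : nodeC (pair τ ℓ) ∈ T.trees :=
  (T.mem_trees_iff _).2 (Or.inr ⟨_, T.cons_mem hτ hℓ, pair_ne_zero _ _, rfl⟩)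

theorem node2_mem {σ τ : M} (hσ : σ ∈ T.trees) (hτ : τ ∈ T.trees) : node2 σ τ ∈ T.trees :=
  T.node_mem hσ (T.cons_mem hτ T.nil_mem)

theorem leaf_le_single {q x : M} (hq : inQ q) (hx : x ∈ T.trees) :
    Rel T.le (leafC q) (nodeC (pair x 0)) ↔ Rel T.le (leafC q) x := by
  rw [T.leaf_le_node _ _ hq (T.node_mem hx T.nil_mem)]
  simp [T.entry_single hx]

theorem leaf_le_node2 {q x y : M} (hq : inQ q) (hx : x ∈ T.trees) (hy : y ∈ T.trees) :
    Rel T.le (leafC q) (node2 x y) ↔ Rel T.le (leafC q) x ∨ Rel T.le (leafC q) y := by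
  rw [node2, T.leaf_le_node _ _ hq (T.node2_mem hx hy)]
  simp [T.entry_double hx hy]

theorem single_le_single {x y : M} (hx : x ∈ T.trees) (hy : y ∈ T.trees) :
    Rel T.le (nodeC (pair x 0)) (nodeC (pair y 0)) ↔ Rel T.le x y := by
  rw [T.node_le_node _ _ (T.node_mem hx T.nil_mem) (T.node_mem hy T.nil_mem)]
  simp [T.entry_single hx, T.entry_single hy]

theorem single_le_node2 {x y z : M} (hx : x ∈ T.trees) (hy : y ∈ T.trees) (hz : z ∈ T.trees) :
    Rel T.le (nodeC (pair x 0)) (node2 y z) ↔ Rel T.le x y ∨ Rel T.le x z := by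
  rw [node2, T.node_le_node _ _ (T.node_mem hx T.nil_mem) (T.node2_mem hy hz)]
  simp [T.entry_single hx, T.entry_double hy hz]

theorem node2_le_single {x y z : M} (hx : x ∈ T.trees) (hy : y ∈ T.trees) (hz : z ∈ T.trees) :
    Rel T.le (node2 x y) (nodeC (pair z 0)) ↔ Rel T.le x z ∧ Rel T.le y z := by
  rw [node2, T.node_le_node _ _ (T.node2_mem hx hy) (T.node_mem hz T.nil_mem)]
  simp [T.entry_double hx hy, T.entry_single hz]

theorem node2_le_node2 {x y z w : M} (hx : x ∈ T.trees) (hy : y ∈ T.trees) (hz : z ∈ T.trees)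
    (hw : w ∈ T.trees) : Rel T.le (node2 x y) (node2 z w) ↔
      (Rel T.le x z ∨ Rel T.le x w) ∧ (Rel T.le y z ∨ Rel T.le y w) := by
  rw [node2, node2, T.node_le_node _ _ (T.node2_mem hx hy) (T.node2_mem hz hw)]
  simp [T.entry_double hx hy, T.entry_double hz hw]

theorem entry_lt {σ ℓ : M} (hℓ : ℓ ∈ T.lists) : Rel T.entry σ ℓ → σ < ℓ := by
  have hlists := Recursive.mem T.lists_mem
  have hentry := recursive_rel T.entry_mem
  refine Recursive.strong_induction (P := fun ℓ => ℓ ∈ T.lists → Rel T.entry σ ℓ → σ < ℓ)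
    (.imp (by fun_prop) (.imp (by fun_prop) (by fun_prop))) (fun ℓ ih hℓ h => ?_) ℓ hℓ
  rcases (T.mem_lists_iff _).1 hℓ with rfl | ⟨τ, k, rfl, hτ, hk⟩
  · exact absurd h (T.not_entry_nil _)
  · rcases (T.entry_cons _ _ _ hℓ).1 h with rfl | h
    · exact left_lt_pair _ _
    · exact (ih k (right_lt_pair _ _) hk h).trans (right_lt_pair _ _)

theorem bar_mem (h0 : inQ label0) (n : M) : bar n ∈ T.trees := by
  have htrees := Recursive.mem T.trees_mem
  refine RecEnum.induction (P := fun n => bar n ∈ T.trees) (Recursive.recEnum (by fun_prop)) ?_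
    (fun n ih => ?_) n
  · rw [bar_zero]
    exact T.leaf_mem h0
  · rw [bar_succ]
    exact T.node_mem ih T.nil_mem

theorem leaf_le_bar (h0 : inQ label0) {q : M} (hq : inQ q) (n : M) :
    Rel T.le (leafC q) (bar n) → leQ q label0 := by
  have hle := recursive_rel T.le_mem
  rw [← T.leaf_le_leaf _ _ hq h0]
  refine RecEnum.induction (P := fun n => Rel T.le (leafC q) (bar n) →
    Rel T.le (leafC q) (leafC label0)) (Recursive.recEnum (.imp (by fun_prop) (by fun_prop))) ?_
    (fun n ih h => ?_) n
  · rw [bar_zero]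
    exact id
  · rw [bar_succ, T.leaf_le_single hq (T.bar_mem h0 n)] at h
    exact ih h

theorem eq_zero_of_bar_le_leaf (h0 : inQ label0) {m q : M} (hq : inQ q)
    (h : Rel T.le (bar m) (leafC q)) : m = 0 := by
  by_contra hm
  obtain ⟨m, rfl⟩ := exists_eq_add_one_of_ne_zero hm
  rw [bar_succ] at h
  exact T.not_node_le_leaf _ _ (T.node_mem (T.bar_mem h0 m) T.nil_mem) hq h

theorem bar_le_bar (h0 : inQ label0) (m n : M) : Rel T.le (bar m) (bar n) → m ≤ n := by
  have hle := recursive_rel T.le_mem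
  refine Recursive.pi1_induction (P := fun m n => Rel T.le (bar m) (bar n) → m ≤ n)
    (.imp (by fun_prop) (by fun_prop)) (fun n _ => zero_le) (fun m ih n h => ?_) m n
  rcases eq_or_ne n 0 with rfl | hn
  · rw [bar_zero] at h
    exact (T.eq_zero_of_bar_le_leaf h0 h0 h).le
  · obtain ⟨n, rfl⟩ := exists_eq_add_one_of_ne_zero hn
    rw [bar_succ, bar_succ, T.single_le_single (T.bar_mem h0 m) (T.bar_mem h0 n)] at h
    exact add_le_add_left (ih n h) 1

end LeafTrees

section Labels

variable {M : Type*} [L2Structure M] {A LA : Set M}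

theorem inTwoUnion_label0 : InTwoUnion A (label0 : M) := Or.inl rfl

theorem inTwoUnion_label1 : InTwoUnion A (label1 : M) := Or.inr (Or.inl rfl)

theorem inTwoUnion_labelOf {α : M} (h : α ∈ A) : InTwoUnion A (labelOf α) :=
  Or.inr (Or.inr ⟨α, h, rfl⟩)

variable [hM : Fact (ModelsRCA0 M)]

theorem not_label1_le_label0 : ¬ LeTwoUnion A LA label1 (label0 : M) := by
  simp [LeTwoUnion, label1, label0, labelOf, pair_inj]

theorem not_labelOf_le_label0 (α : M) : ¬ LeTwoUnion A LA (labelOf α) (label0 : M) := by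
  simp [LeTwoUnion, label1, label0, labelOf, pair_inj]

theorem not_labelOf_le_label1 (α : M) : ¬ LeTwoUnion A LA (labelOf α) (label1 : M) := by
  simp [LeTwoUnion, label1, label0, labelOf, pair_inj]

theorem rel_of_labelOf_le {α β : M} (h : LeTwoUnion A LA (labelOf α) (labelOf β)) :
    Rel LA α β := by
  rcases h with ⟨h, -⟩ | ⟨h, -⟩ | ⟨a, -, b, -, ha, hb, hab⟩
  · exact absurd (pair_inj.1 h).1 one_ne_zero
  · exact absurd (pair_inj.1 h).1 one_ne_zero
  · rwa [(pair_inj.1 ha).2, (pair_inj.1 hb).2]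

end Labels

namespace LeafTrees

variable {M : Type*} [L2Structure M] [hM : Fact (ModelsRCA0 M)] {A LA : Set M}
  (T : LeafTrees (InTwoUnion A) (LeTwoUnion A LA))

theorem guard_mem {x : M} (hx : x ∈ T.trees) : guard x ∈ T.trees :=
  T.node2_mem (T.leaf_mem inTwoUnion_label1) (T.node_mem hx T.nil_mem)

theorem guard_le_guard {x y : M} (hx : x ∈ T.trees) (hy : y ∈ T.trees)
    (h : Rel T.le (guard x) (guard y)) : Rel T.le x y := by
  have h1 := T.leaf_mem (inTwoUnion_label1 (A := A))
  rw [guard, guard, T.node2_le_node2 h1 (T.node_mem hx T.nil_mem) h1 (T.node_mem hy T.nil_mem),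
    T.single_le_single hx hy] at h
  exact h.2.resolve_left (T.not_node_le_leaf _ _ (T.node_mem hx T.nil_mem) inTwoUnion_label1)

theorem not_guard_le_bar {x : M} (hx : x ∈ T.trees) (n : M) : ¬ Rel T.le (guard x) (bar n) := by
  intro h
  rcases eq_or_ne n 0 with rfl | hn
  · rw [bar_zero] at h
    exact T.not_node_le_leaf _ _ (T.guard_mem hx) inTwoUnion_label0 h
  · obtain ⟨n, rfl⟩ := exists_eq_add_one_of_ne_zero hn
    rw [bar_succ, guard, T.node2_le_single (T.leaf_mem inTwoUnion_label1)
      (T.node_mem hx T.nil_mem) (T.bar_mem inTwoUnion_label0 n)] at h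
    exact not_label1_le_label0 (T.leaf_le_bar inTwoUnion_label0 inTwoUnion_label1 n h.1)

theorem leaf_le_guard {q x : M} (hq : InTwoUnion A q) (hx : x ∈ T.trees)
    (h : Rel T.le (leafC q) (guard x)) : LeTwoUnion A LA q label1 ∨ Rel T.le (leafC q) x := by
  rwa [guard, T.leaf_le_node2 hq (T.leaf_mem inTwoUnion_label1) (T.node_mem hx T.nil_mem),
    T.leaf_le_leaf _ _ hq inTwoUnion_label1, T.leaf_le_single hq hx] at h

theorem bar_le_guard {n x : M} (hx : x ∈ T.trees) (h : Rel T.le (bar (n + 1 + 1)) (guard x)) :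
    Rel T.le (bar n) x := by
  have hb := T.bar_mem inTwoUnion_label0
  rw [bar_succ (n + 1), guard, T.single_le_node2 (hb _) (T.leaf_mem inTwoUnion_label1)
    (T.node_mem hx T.nil_mem), bar_succ, T.single_le_single (hb _) hx] at h
  exact h.resolve_left
    (T.not_node_le_leaf _ _ (T.node_mem (hb _) T.nil_mem) inTwoUnion_label1)

theorem not_node2_guard_le_bar {x y : M} (hx : x ∈ T.trees) (hy : y ∈ T.trees) (n : M) :
    ¬ Rel T.le (node2 (guard x) y) (bar n) := by
  have hg := T.guard_mem hx
  intro h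
  rcases eq_or_ne n 0 with rfl | hn
  · rw [bar_zero] at h
    exact T.not_node_le_leaf _ _ (T.node2_mem hg hy) inTwoUnion_label0 h
  · obtain ⟨n, rfl⟩ := exists_eq_add_one_of_ne_zero hn
    rw [bar_succ, T.node2_le_single hg hy (T.bar_mem inTwoUnion_label0 n)] at h
    exact T.not_guard_le_bar hx n h.1

theorem le_of_bar_le_node2_guard {x b : M} (hx : x ∈ T.trees)
    (hb : ∀ n, Rel T.le (bar n) x → n ≤ b) {m p : M}
    (h : Rel T.le (bar m) (node2 (guard x) (bar p))) : m ≤ p + (b + 1 + 1 + 1) := by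
  have hbar := T.bar_mem (inTwoUnion_label0 (A := A))
  rcases eq_or_ne m 0 with rfl | hm
  · exact zero_le
  obtain ⟨m, rfl⟩ := exists_eq_add_one_of_ne_zero hm
  rw [bar_succ, T.single_le_node2 (hbar m) (T.guard_mem hx) (hbar p)] at h
  rcases h with h | h
  · suffices m ≤ b + 1 + 1 from (add_le_add_left this 1).trans le_add_self
    rcases le_or_gt m 1 with hm | hm
    · exact hm.trans le_add_self
    · obtain ⟨n, rfl⟩ : ∃ n, m = n + 1 + 1 := by
        obtain ⟨n, rfl⟩ := exists_add_of_le (Order.add_one_le_iff.2 hm)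
        exact ⟨n, by ac_rfl⟩
      gcongr
      exact hb n (T.bar_le_guard hx h)
  · exact add_le_add (T.bar_le_bar inTwoUnion_label0 m p h) le_add_self

end LeafTrees

/-! ### Reflection of the order -/

namespace EpsilonNotation

variable {M : Type*} [L2Structure M] [hM : Fact (ModelsRCA0 M)] {A LA : Set M}
  (T : LeafTrees (InTwoUnion A) (LeTwoUnion A LA)) (E : EpsilonNotation A LA)

theorem exists_tree_const_eq_leafC {c : M} (hc : IsConst A c) :
    ∃ q, InTwoUnion A q ∧ E.tree c = leafC q := by
  rcases hc with rfl | rfl | ⟨α, hα, rfl⟩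
  · exact ⟨label0, inTwoUnion_label0, E.tree_zeroC⟩
  · exact ⟨label1, inTwoUnion_label1, E.tree_omegaC⟩
  · exact ⟨labelOf α, inTwoUnion_labelOf hα, E.tree_epsC α⟩

theorem tree_mem_and_children_mem (x : M × M) :
    (x.1 ∈ E.terms → E.tree x.1 ∈ T.trees) ∧
    (x.1 ∈ E.lists → E.children x.2 x.1 ∈ T.lists) := by
  have hTerms := E.recursive_terms
  have hLists := E.recursive_lists
  have hTree := E.recursive_tree
  have hChildren := E.recursive_children
  have hTrees := Recursive.mem T.trees_mem
  have hTreeLists := Recursive.mem T.lists_mem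
  refine Recursive.measure_induction (M := M) (P := fun x : M × M =>
    (x.1 ∈ E.terms → E.tree x.1 ∈ T.trees) ∧
    (x.1 ∈ E.lists → E.children x.2 x.1 ∈ T.lists))
    (.and (.imp (by fun_prop) (by fun_prop)) (.imp (by fun_prop) (by fun_prop)))
    (μ := fun x => x.1) (by fun_prop) ?_ x
  rintro ⟨t, n⟩ ih
  replace ih (a b : M) := ih (a, b)
  dsimp only at ih ⊢
  constructor
  · intro ht
    rcases E.term_cases ht with hc | ⟨s, k, rfl⟩
    · obtain ⟨q, hq, htree⟩ := E.exists_tree_const_eq_leafC hc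
      rw [htree]
      exact T.leaf_mem hq
    by_cases hω : SRel E.le (seqC (pair s k)) omegaC
    · rw [E.tree_seq_of_lt hω]
      exact T.bar_mem inTwoUnion_label0 _
    · rw [E.tree_seq_of_not_lt hω]
      refine (T.mem_trees_iff _).2 (Or.inr
        ⟨_, (ih (pair s k) 0 (lt_seqC _)).2 (E.seq_list_mem ht), ?_, rfl⟩)
      rw [E.children_cons]
      exact pair_ne_zero _ _
  · intro ht
    rcases E.list_cases ht with rfl | ⟨s, k, rfl⟩
    · rw [E.children_nil]
      exact T.nil_mem
    · obtain ⟨hs, hk, -⟩ := E.cons_mem ht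
      rw [E.children_cons]
      exact T.cons_mem (T.node2_mem (T.guard_mem ((ih s 0 (left_lt_pair _ _)).1 hs))
        (T.bar_mem inTwoUnion_label0 _)) ((ih k _ (right_lt_pair _ _)).2 hk)

theorem tree_mem {t : M} (h : t ∈ E.terms) : E.tree t ∈ T.trees :=
  (E.tree_mem_and_children_mem T (t, 0)).1 h

theorem children_mem {k : M} (h : k ∈ E.lists) (n : M) : E.children n k ∈ T.lists :=
  (E.tree_mem_and_children_mem T (k, n)).2 h

theorem entry_children_cons {t k : M} (h : pair t k ∈ E.lists) {n σ : M} :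
    Rel T.entry σ (E.children n (pair t k)) ↔ σ = node2 (guard (E.tree t)) (bar n) ∨
      Rel T.entry σ (E.children (n + pow2 (height t + 1 + 1 + 1)) k) := by
  have hmem := E.children_mem T h n
  rw [E.children_cons] at hmem ⊢
  exact T.entry_cons _ _ _ hmem

theorem exists_of_entry_children (hlin : IsLinearOrder A LA) {k n σ : M} (hk : k ∈ E.lists)
    (hσ : Rel T.entry σ (E.children n k)) :
    ∃ t < k, ∃ p < n + weight k, σ = node2 (guard (E.tree t)) (bar p) ∧ t ∈ E.terms ∧
      Rel E.le t (left k) ∧ n ≤ p ∧ p + pow2 (height t + 1 + 1 + 1) ≤ n + weight k := by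
  have hTerms := E.recursive_terms
  have hLists := E.recursive_lists
  have hTree := E.recursive_tree
  have hChildren := E.recursive_children
  have hentry := recursive_rel T.entry_mem
  have hle := E.recursive_le
  refine Recursive.measure_induction (M := M) (P := fun x : M × M =>
    x.1 ∈ E.lists ∧ Rel T.entry σ (E.children x.2 x.1) →
    ∃ t < x.1, ∃ p < x.2 + weight x.1, σ = node2 (guard (E.tree t)) (bar p) ∧ t ∈ E.terms ∧
      Rel E.le t (left x.1) ∧ x.2 ≤ p ∧ p + pow2 (height t + 1 + 1 + 1) ≤ x.2 + weight x.1)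
    (.imp (by fun_prop) (.bex (by fun_prop) (.bex (by fun_prop) (by fun_prop))))
    (μ := fun x => x.1) (by fun_prop) ?_ (k, n) ⟨hk, hσ⟩
  rintro ⟨k, n⟩ ih ⟨hk, hσ⟩
  replace ih (a b : M) := ih (a, b)
  dsimp only at ih hk hσ ⊢
  rcases E.list_cases hk with rfl | ⟨s, k, rfl⟩
  · rw [E.children_nil] at hσ
    exact absurd hσ (T.not_entry_nil _)
  obtain ⟨hs, hk', hdesc⟩ := E.cons_mem hk
  rw [weight_cons, left_pair, ← add_assoc]
  rcases (E.entry_children_cons T hk).1 hσ with rfl | h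
  · refine ⟨s, left_lt_pair _ _, n, ?_, rfl, hs, (E.le_total hlin hs hs).elim id id, le_rfl,
      le_self_add⟩
    exact (lt_add_of_pos_right n (pow2_pos _)).trans_le le_self_add
  · obtain ⟨t, htk, p, hp, rfl, ht, hle, hnp, hpn⟩ := ih k _ (right_lt_pair _ _) ⟨hk', h⟩
    refine ⟨t, htk.trans (right_lt_pair _ _), p, hp, rfl, ht, ?_, le_self_add.trans hnp, hpn⟩
    rcases E.list_cases hk' with rfl | ⟨s', k', rfl⟩
    · exact absurd htk not_lt_zero
    · rw [left_pair] at hle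
      exact E.le_trans hlin ht (E.cons_mem hk').1 hs hle (hdesc _ _ rfl).1

theorem le_height_of_bar_le_tree (hlin : IsLinearOrder A LA) {t m : M} (ht : t ∈ E.terms)
    (h : Rel T.le (bar m) (E.tree t)) : m ≤ height t := by
  have hTerms := E.recursive_terms
  have hTree := E.recursive_tree
  have hle := recursive_rel T.le_mem
  refine Recursive.measure_induction (M := M) (P := fun x : M × M =>
    x.1 ∈ E.terms ∧ Rel T.le (bar x.2) (E.tree x.1) → x.2 ≤ height x.1)
    (.imp (by fun_prop) (by fun_prop)) (μ := fun x => x.1) (by fun_prop) ?_ (t, m) ⟨ht, h⟩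
  rintro ⟨t, m⟩ ih ⟨ht, h⟩
  replace ih (a b : M) := ih (a, b)
  dsimp only at ih ht h ⊢
  rcases E.term_cases ht with hc | ⟨s, k, rfl⟩
  · obtain ⟨q, hq, htree⟩ := E.exists_tree_const_eq_leafC hc
    rw [htree] at h
    rw [T.eq_zero_of_bar_le_leaf inTwoUnion_label0 hq h]
    exact zero_le
  rw [height_seq]
  by_cases hω : SRel E.le (seqC (pair s k)) omegaC
  · rw [E.tree_seq_of_lt hω] at h
    exact T.bar_le_bar inTwoUnion_label0 _ _ h
  have hmem := E.tree_mem T ht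
  rw [E.tree_seq_of_not_lt hω] at h hmem
  rcases eq_or_ne m 0 with rfl | hm
  · exact zero_le
  obtain ⟨m, rfl⟩ := exists_eq_add_one_of_ne_zero hm
  have hbar := T.bar_mem (inTwoUnion_label0 (A := A)) m
  rw [bar_succ, T.node_le_node _ _ (T.node_mem hbar T.nil_mem) hmem] at h
  obtain ⟨σ, hσ, hm⟩ := h _ ((T.entry_single hbar).2 rfl)
  obtain ⟨t, htk, p, -, rfl, ht', -, -, hp⟩ :=
    E.exists_of_entry_children T hlin (E.seq_list_mem ht) hσ
  refine add_le_add_left ?_ 1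
  calc m ≤ p + (height t + 1 + 1 + 1) := T.le_of_bar_le_node2_guard (E.tree_mem T ht')
        (fun n hn => ih t n (htk.trans (lt_seqC _)) ⟨ht', hn⟩) hm
    _ ≤ p + pow2 (height t + 1 + 1 + 1) := by
        gcongr
        exact (lt_pow2 _).le
    _ ≤ 0 + weight (pair s k) := hp
    _ = weight (pair s k) := zero_add _

end EpsilonNotation

namespace LeafTrees

variable {M : Type*} [L2Structure M] {inQ : M → Prop} {leQ : M → M → Prop} (T : LeafTrees inQ leQ)

/-- Every entry of the list `k` embeds into an entry of `ℓ`. The bounds hold for all entries of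
lists; they are there to make the relation recursive. -/
def ListLe (k ℓ : M) : Prop :=
  ∀ σ < k, Rel T.entry σ k → ∃ τ < ℓ, Rel T.entry τ ℓ ∧ Rel T.le σ τ

variable [hM : Fact (ModelsRCA0 M)]

theorem recursive_listLe : Recursive M fun x : M × M => T.ListLe x.1 x.2 := by
  have hentry := recursive_rel T.entry_mem
  have hle := recursive_rel T.le_mem
  exact .ball (by fun_prop) (.imp (by fun_prop) (.bex (by fun_prop) (by fun_prop)))

variable {T}

theorem listLe_iff {k ℓ : M} (hk : k ∈ T.lists) (hℓ : ℓ ∈ T.lists) :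
    T.ListLe k ℓ ↔ ∀ σ, Rel T.entry σ k → ∃ τ, Rel T.entry τ ℓ ∧ Rel T.le σ τ := by
  refine ⟨fun h σ hσ => ?_, fun h σ _ hσ => ?_⟩
  · obtain ⟨τ, -, hτ⟩ := h σ (T.entry_lt hk hσ) hσ
    exact ⟨τ, hτ⟩
  · obtain ⟨τ, hτ⟩ := h σ hσ
    exact ⟨τ, T.entry_lt hℓ hτ.1, hτ⟩

end LeafTrees

namespace EpsilonNotation

variable {M : Type*} [L2Structure M] [hM : Fact (ModelsRCA0 M)] {A LA : Set M}
  {T : LeafTrees (InTwoUnion A) (LeTwoUnion A LA)} {E : EpsilonNotation A LA}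

theorem const_le_const_of_tree_le {s t : M} (hs : IsConst A s) (ht : IsConst A t)
    (h : Rel T.le (E.tree s) (E.tree t)) : Rel E.le s t := by
  have h0 := inTwoUnion_label0 (A := A)
  have h1 := inTwoUnion_label1 (A := A)
  rcases hs with rfl | rfl | ⟨α, hα, rfl⟩
  · exact E.zeroC_le (E.const_mem ht)
  · rcases ht with rfl | rfl | ⟨β, hβ, rfl⟩
    · rw [E.tree_omegaC, E.tree_zeroC, T.leaf_le_leaf _ _ h1 h0] at h
      exact absurd h not_label1_le_label0
    · exact E.omega_le_omega
    · exact (E.omega_lt_eps β hβ).1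
  · have hlabel := inTwoUnion_labelOf hα
    rw [E.tree_epsC] at h
    rcases ht with rfl | rfl | ⟨β, hβ, rfl⟩
    · rw [E.tree_zeroC, T.leaf_le_leaf _ _ hlabel h0] at h
      exact absurd h (not_labelOf_le_label0 α)
    · rw [E.tree_omegaC, T.leaf_le_leaf _ _ hlabel h1] at h
      exact absurd h (not_labelOf_le_label1 α)
    · rw [E.tree_epsC, T.leaf_le_leaf _ _ hlabel (inTwoUnion_labelOf hβ)] at h
      exact (E.eps_le_eps α hα β hβ).2 (rel_of_labelOf_le h)

theorem not_tree_seq_le_leaf {k q : M} (hk : seqC k ∈ E.terms) (hq : InTwoUnion A q) :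
    ¬ Rel T.le (E.tree (seqC k)) (leafC q) := by
  by_cases hω : SRel E.le (seqC k) omegaC
  · rw [E.tree_seq_of_lt hω, bar_succ]
    exact T.not_node_le_leaf _ _ (T.node_mem (T.bar_mem inTwoUnion_label0 _) T.nil_mem) hq
  · have hmem := E.tree_mem T hk
    rw [E.tree_seq_of_not_lt hω] at hmem ⊢
    exact T.not_node_le_leaf _ _ hmem hq

theorem exists_of_leaf_le_tree_seq (hlin : IsLinearOrder A LA) {t k q : M}
    (ht : seqC (pair t k) ∈ E.terms) (hq : InTwoUnion A q)
    (h : Rel T.le (leafC q) (E.tree (seqC (pair t k)))) :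
    LeTwoUnion A LA q label0 ∨ LeTwoUnion A LA q label1 ∨
      ∃ r < pair t k, r ∈ E.terms ∧ Rel E.le r t ∧ Rel T.le (leafC q) (E.tree r) := by
  by_cases hω : SRel E.le (seqC (pair t k)) omegaC
  · rw [E.tree_seq_of_lt hω] at h
    exact Or.inl (T.leaf_le_bar inTwoUnion_label0 hq _ h)
  have hmem := E.tree_mem T ht
  rw [E.tree_seq_of_not_lt hω] at h hmem
  obtain ⟨σ, hσ, hqσ⟩ := (T.leaf_le_node _ _ hq hmem).1 h
  obtain ⟨r, hrk, p, -, rfl, hr, hrt, -⟩ :=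
    E.exists_of_entry_children T hlin (E.seq_list_mem ht) hσ
  rw [left_pair] at hrt
  rw [T.leaf_le_node2 hq (T.guard_mem (E.tree_mem T hr)) (T.bar_mem inTwoUnion_label0 p)] at hqσ
  rcases hqσ with hguard | hbar
  · exact Or.inr ((T.leaf_le_guard hq (E.tree_mem T hr) hguard).imp_right
      fun h => ⟨r, hrk, hr, hrt, h⟩)
  · exact Or.inl (T.leaf_le_bar inTwoUnion_label0 hq p hbar)

theorem const_le_seq_of_tree_le (hlin : IsLinearOrder A LA) {c t k : M} (hc : IsConst A c)
    (ht : seqC (pair t k) ∈ E.terms)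
    (ih : ∀ r < pair t k, r ∈ E.terms → Rel T.le (E.tree c) (E.tree r) → Rel E.le c r)
    (h : Rel T.le (E.tree c) (E.tree (seqC (pair t k)))) : Rel E.le c (seqC (pair t k)) := by
  rcases id hc with rfl | rfl | ⟨α, hα, rfl⟩
  · exact E.zeroC_le ht
  · by_contra hle
    rw [E.tree_omegaC, E.tree_seq_of_lt (E.lt_of_not_le hlin E.omegaC_mem ht hle)] at h
    exact not_label1_le_label0 (T.leaf_le_bar inTwoUnion_label0 inTwoUnion_label1 _ h)
  · rw [E.tree_epsC] at h ih
    rcases exists_of_leaf_le_tree_seq hlin ht (inTwoUnion_labelOf hα) h with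
      h | h | ⟨r, hrk, hr, hrt, h⟩
    · exact absurd h (not_labelOf_le_label0 α)
    · exact absurd h (not_labelOf_le_label1 α)
    · exact (E.const_le_seq _ _ _ hc ht).2 (E.le_trans hlin (E.const_mem hc) hr
        (E.seq_head_mem ht) (ih r hrk hr h) hrt)

theorem seq_le_seq_of_tree_le (hlin : IsLinearOrder A LA) {s k t ℓ : M}
    (hs : seqC (pair s k) ∈ E.terms) (ht : seqC (pair t ℓ) ∈ E.terms)
    (hlists : T.ListLe (E.children 0 (pair s k)) (E.children 0 (pair t ℓ)) →
      Rel E.lex (pair s k) (pair t ℓ))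
    (h : Rel T.le (E.tree (seqC (pair s k))) (E.tree (seqC (pair t ℓ)))) :
    Rel E.le (seqC (pair s k)) (seqC (pair t ℓ)) := by
  have hbar := T.bar_mem (inTwoUnion_label0 (A := A))
  have hk := E.seq_list_mem hs
  have hℓ := E.seq_list_mem ht
  have hsT := E.tree_mem T hs
  have htT := E.tree_mem T ht
  by_cases hωs : SRel E.le (seqC (pair s k)) omegaC
  · by_contra hst
    have hts := E.lt_of_not_le hlin hs ht hst
    have hωt := E.lt_of_lt_of_le hlin ht hs E.omegaC_mem hts hωs.1
    have hheight := height_lt hlin hs ht hωs hts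
    rw [E.tree_seq_of_lt hωs, E.tree_seq_of_lt hωt] at h
    rw [height_seq, height_seq] at hheight
    exact hheight.not_ge (T.bar_le_bar inTwoUnion_label0 _ _ h)
  rw [E.tree_seq_of_not_lt hωs] at h hsT
  by_cases hωt : SRel E.le (seqC (pair t ℓ)) omegaC
  · rw [E.tree_seq_of_lt hωt, bar_succ, T.node_le_node _ _ hsT (T.node_mem (hbar _) T.nil_mem)] at h
    obtain ⟨τ, hτ, hle⟩ := h _ ((E.entry_children_cons T hk).2 (Or.inl rfl))
    rw [(T.entry_single (hbar _)).1 hτ] at hle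
    exact absurd hle (T.not_node2_guard_le_bar (E.tree_mem T (E.seq_head_mem hs)) (hbar 0) _)
  · rw [E.tree_seq_of_not_lt hωt] at h htT
    rw [E.seq_le_seq _ _ hs ht]
    exact hlists ((LeafTrees.listLe_iff (E.children_mem T hk 0) (E.children_mem T hℓ 0)).2
      ((T.node_le_node _ _ hsT htT).1 h))

theorem le_of_node2_le_entry_children (hlin : IsLinearOrder A LA) {s t ℓ n m τ : M}
    (hs : s ∈ E.terms) (hℓ : pair t ℓ ∈ E.lists)
    (ih : ∀ r < pair t ℓ, r ∈ E.terms → Rel T.le (E.tree s) (E.tree r) → Rel E.le s r)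
    (hτ : Rel T.entry τ (E.children n (pair t ℓ)))
    (h : Rel T.le (node2 (guard (E.tree s)) (bar m)) τ) : Rel E.le s t := by
  have hbar := T.bar_mem (inTwoUnion_label0 (A := A))
  obtain ⟨r, hrℓ, p, -, rfl, hr, hrt, -⟩ := E.exists_of_entry_children T hlin hℓ hτ
  rw [left_pair] at hrt
  have hsT := E.tree_mem T hs
  have hrT := E.tree_mem T hr
  rw [T.node2_le_node2 (T.guard_mem hsT) (hbar m) (T.guard_mem hrT) (hbar p)] at h
  have hguard := h.1.resolve_right (T.not_guard_le_bar hsT p)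
  exact E.le_trans hlin hs hr (E.cons_mem hℓ).1 (ih r hrℓ hr (T.guard_le_guard hsT hrT hguard)) hrt

theorem not_entry_children_le_node2 (hlin : IsLinearOrder A LA) {k t n σ : M} (hk : k ∈ E.lists)
    (ht : t ∈ E.terms) (hσ : Rel T.entry σ (E.children (n + pow2 (height t + 1 + 1 + 1)) k)) :
    ¬ Rel T.le σ (node2 (guard (E.tree t)) (bar n)) := by
  intro h
  have hbar := T.bar_mem (inTwoUnion_label0 (A := A))
  have htT := E.tree_mem T ht
  obtain ⟨r, -, p, -, rfl, hr, -, hnp, -⟩ := E.exists_of_entry_children T hlin hk hσ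
  rw [T.node2_le_node2 (T.guard_mem (E.tree_mem T hr)) (hbar p) (T.guard_mem htT) (hbar n)] at h
  have hsucc : Rel T.le (bar (p + 1)) (node2 (guard (E.tree t)) (bar n)) := by
    rw [bar_succ, T.single_le_node2 (hbar p) (T.guard_mem htT) (hbar n)]
    exact h.2
  refine lt_irrefl p ?_
  calc p < p + 1 := lt_add_one p
    _ ≤ n + (height t + 1 + 1 + 1) := T.le_of_bar_le_node2_guard htT
        (fun m hm => E.le_height_of_bar_le_tree T hlin ht hm) hsucc
    _ ≤ n + pow2 (height t + 1 + 1 + 1) := by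
        gcongr
        exact (lt_pow2 _).le
    _ ≤ p := hnp

theorem lex_of_children_listLe (hlin : IsLinearOrder A LA) {k ℓ n : M} (hk : k ∈ E.lists)
    (hℓ : ℓ ∈ E.lists)
    (ihTerms : ∀ s t, s < k → t < ℓ → s ∈ E.terms → t ∈ E.terms →
      Rel T.le (E.tree s) (E.tree t) → Rel E.le s t)
    (ihLists : ∀ k' ℓ' n', k' < k → ℓ' < ℓ → k' ∈ E.lists → ℓ' ∈ E.lists →
      T.ListLe (E.children n' k') (E.children n' ℓ') → Rel E.lex k' ℓ')
    (h : T.ListLe (E.children n k) (E.children n ℓ)) : Rel E.lex k ℓ := by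
  rw [LeafTrees.listLe_iff (E.children_mem T hk n) (E.children_mem T hℓ n)] at h
  rcases E.list_cases hk with rfl | ⟨s, k, rfl⟩
  · exact E.nil_lex _ hℓ
  obtain ⟨τ, hτ, hhead⟩ := h _ ((E.entry_children_cons T hk).2 (Or.inl rfl))
  rcases E.list_cases hℓ with rfl | ⟨t, ℓ, rfl⟩
  · rw [E.children_nil] at hτ
    exact absurd hτ (T.not_entry_nil τ)
  obtain ⟨hs, hk', -⟩ := E.cons_mem hk
  obtain ⟨ht, hℓ', -⟩ := E.cons_mem hℓ
  have hst : Rel E.le s t := le_of_node2_le_entry_children hlin hs hℓ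
    (fun r hrℓ hr => ihTerms s r (left_lt_pair _ _) hrℓ hs hr) hτ hhead
  rw [E.cons_lex_cons _ _ _ _ hk hℓ]
  by_cases hts : Rel E.le t s
  swap
  · exact Or.inl ⟨hst, hts⟩
  refine Or.inr ⟨hst, hts, ihLists k ℓ (n + pow2 (height t + 1 + 1 + 1)) (right_lt_pair _ _)
    (right_lt_pair _ _) hk' hℓ' ?_⟩
  rw [LeafTrees.listLe_iff (E.children_mem T hk' _) (E.children_mem T hℓ' _)]
  intro σ hσ
  obtain ⟨τ, hτ, hle⟩ := h σ ((E.entry_children_cons T hk).2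
    (Or.inr (by rwa [E.height_eq hs ht hst hts])))
  rcases (E.entry_children_cons T hℓ).1 hτ with rfl | hτ
  · exact absurd hle (not_entry_children_le_node2 hlin hk' ht hσ)
  · exact ⟨τ, hτ, hle⟩

theorem le_and_lex_of_tree_le (hlin : IsLinearOrder A LA) (x : M × M × M) :
    (x.1 ∈ E.terms ∧ x.2.1 ∈ E.terms ∧ Rel T.le (E.tree x.1) (E.tree x.2.1) →
      Rel E.le x.1 x.2.1) ∧
    (x.1 ∈ E.lists ∧ x.2.1 ∈ E.lists ∧
      T.ListLe (E.children x.2.2 x.1) (E.children x.2.2 x.2.1) → Rel E.lex x.1 x.2.1) := by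
  have hTerms := E.recursive_terms
  have hLists := E.recursive_lists
  have hTree := E.recursive_tree
  have hChildren := E.recursive_children
  have hTreeLe := recursive_rel T.le_mem
  have hListLe := T.recursive_listLe
  have hle := E.recursive_le
  have hlex := E.recursive_lex
  refine Recursive.measure_induction (M := M) (P := fun x : M × M × M =>
    (x.1 ∈ E.terms ∧ x.2.1 ∈ E.terms ∧ Rel T.le (E.tree x.1) (E.tree x.2.1) →
      Rel E.le x.1 x.2.1) ∧
    (x.1 ∈ E.lists ∧ x.2.1 ∈ E.lists ∧
      T.ListLe (E.children x.2.2 x.1) (E.children x.2.2 x.2.1) → Rel E.lex x.1 x.2.1))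
    (.and (.imp (by fun_prop) (by fun_prop)) (.imp (by fun_prop) (by fun_prop)))
    (μ := fun x => x.1 + x.2.1) (by fun_prop) ?_ x
  rintro ⟨s, t, n⟩ ih
  have ihTerms (a b : M) (hab : a + b < s + t) (ha : a ∈ E.terms) (hb : b ∈ E.terms)
      (h : Rel T.le (E.tree a) (E.tree b)) : Rel E.le a b := (ih (a, b, 0) hab).1 ⟨ha, hb, h⟩
  have ihLists (k ℓ m : M) (hkℓ : k + ℓ < s + t) (hk : k ∈ E.lists) (hℓ : ℓ ∈ E.lists)
      (h : T.ListLe (E.children m k) (E.children m ℓ)) : Rel E.lex k ℓ :=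
    (ih (k, ℓ, m) hkℓ).2 ⟨hk, hℓ, h⟩
  dsimp only
  constructor
  · rintro ⟨hs, ht, h⟩
    rcases E.term_cases hs with hc | ⟨s', k, rfl⟩ <;> rcases E.term_cases ht with hd | ⟨t', ℓ, rfl⟩
    · exact const_le_const_of_tree_le hc hd h
    · exact const_le_seq_of_tree_le hlin hc ht
        (fun r hr => ihTerms _ _ (add_lt_add_right (hr.trans (lt_seqC _)) _) hs) h
    · obtain ⟨q, hq, htree⟩ := E.exists_tree_const_eq_leafC hd
      rw [htree] at h
      exact absurd h (not_tree_seq_le_leaf hs hq)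
    · exact seq_le_seq_of_tree_le hlin hs ht (ihLists _ _ 0 (add_lt_add (lt_seqC _) (lt_seqC _))
        (E.seq_list_mem hs) (E.seq_list_mem ht)) h
  · rintro ⟨hs, ht, h⟩
    exact lex_of_children_listLe hlin hs ht (fun a b ha hb => ihTerms a b (add_lt_add ha hb))
      (fun k ℓ m hk hℓ => ihLists k ℓ m (add_lt_add hk hℓ)) h

theorem le_of_tree_le (hlin : IsLinearOrder A LA) {s t : M} (hs : s ∈ E.terms) (ht : t ∈ E.terms)
    (h : Rel T.le (E.tree s) (E.tree t)) : Rel E.le s t :=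
  (le_and_lex_of_tree_le hlin (s, t, 0)).1 ⟨hs, ht, h⟩

theorem exists_isOrderReflecting (E : EpsilonNotation A LA)
    (T : LeafTrees (InTwoUnion A) (LeTwoUnion A LA)) (hlin : IsLinearOrder A LA) :
    ∃ h ∈ sets M, IsOrderReflecting E.terms E.le T.trees T.le h := by
  have hTerms := E.recursive_terms
  have hTree := E.recursive_tree
  refine ⟨relSet fun s x => s ∈ E.terms ∧ x = E.tree s, relSet_mem (by fun_prop), ?_, ?_, ?_⟩
  · rintro n ⟨hn, hs, htree⟩
    exact ⟨_, hs, _, htree ▸ E.tree_mem T hs, hn⟩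
  · intro s hs
    exact ⟨E.tree s, rel_relSet.2 ⟨hs, rfl⟩, fun x hx => (rel_relSet.1 hx).2⟩
  · intro s t x y hx hy hxy
    obtain ⟨hs, rfl⟩ := rel_relSet.1 hx
    obtain ⟨ht, rfl⟩ := rel_relSet.1 hy
    exact le_of_tree_le hlin hs ht hxy

end EpsilonNotation

end RevMath

/-- `RCA₀` proves: for every linear order `Ω = (A, LA)`, the notation system `ε_Ω` and the
quasi-order `T_f(2 ∪ Ω)` exist, and there is an order-reflecting map from the first to the second.
Provability is expressed as truth in all models `M` of `RCA₀`. -/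
theorem theorem3p28 {M : Type*} [RevMath.L2Structure M] (hM : RevMath.ModelsRCA0 M)
    (A LA : Set M) (hA : A ∈ RevMath.sets M) (hLA : LA ∈ RevMath.sets M)
    (hlin : RevMath.IsLinearOrder A LA) :
    Nonempty (RevMath.EpsilonNotation A LA) ∧
    Nonempty (RevMath.LeafTrees (RevMath.InTwoUnion A) (RevMath.LeTwoUnion A LA)) ∧
    ∀ (E : RevMath.EpsilonNotation A LA)
      (T : RevMath.LeafTrees (RevMath.InTwoUnion A) (RevMath.LeTwoUnion A LA)),
      ∃ h ∈ RevMath.sets M, RevMath.IsOrderReflecting E.terms E.le T.trees T.le h := by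
  have : Fact (RevMath.ModelsRCA0 M) := ⟨hM⟩
  exact ⟨RevMath.nonempty_epsilonNotation hA hLA,
    RevMath.nonempty_leafTrees (RevMath.recursive_inTwoUnion hA)
      (RevMath.recursive_leTwoUnion hA hLA),
    fun E T => E.exists_isOrderReflecting T hlin⟩
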